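/- For integers $n,d\ge 0$ and reals $R,M,\rho$, let $\mathcal I_{n,d,R,M,\rho}$ be the class of problems $\min\{f(x,y):(x,y)\in C\cap(\mathbb Z^n\times\mathbb R^d)\}$ such that 1. $f:\mathbb R^n\times\mathbb R^d\to\mathbb R$ is convex, $C\subseteq\{z\in\mathbb R^n\times\mathbb R^d:\|z\|_\infty\le R\}$ is closed and convex, and $C\cap(\mathbb Z^n\times\mathbb R^d)\neq\emptyset$; 2. $|f(x,y)-f(x,y')|\le M\|y-y'\|_\infty$ for all $x\in[-R,R]^n\cap\mathbb Z^n$ and $y,y'\in[-R,R]^d$; 3. for every optimal solution $(x^\star,y^\star)$ there is $\hat y\in\mathbb R^d$ with $\{(x^\star,y):\|y-\hat y\|_\infty\le\rho\}\subseteq C$. An $\epsilon$-approximate solution is a point of $C\cap(\mathbb Z^n\times\mathbb R^d)$ whose value exceeds the optimal value by at most $\epsilon$. An instance is accessed through a separation oracle for $C$ (queried at any $z\in\mathbb R^n\times\mathbb R^d$, it says that $z\in C$, or returns $(a,b)$ with $\langle a,w\rangle\le b<\langle a,z\rangle$ for all $w\in C$) and a first-order oracle for $f$ (queried at any $z$,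 it returns $f(z)$ and a subgradient of $f$ at $z$). An instance consists of $(f,C)$ together with arbitrary correct oracles of these two kinds, so that the worst case is also taken over the choice of separating hyperplanes and subgradients. An adaptive query strategy $D$ maps each finite set of query-answer pairs (those obtained so far) to the next query. For an instance $I$, let $\mathrm{icomp}_\epsilon(D,I)$ be the least $k\ge 0$ such that some single point is an $\epsilon$-approximate solution of every instance that gives the same answers as $I$ to the first $k$ queries of $D$ on $I$ ($+\infty$ if there is no such $k$). The $\epsilon$-information complexity, counting queries, is $\mathrm{icomp}_\epsilon(n,d,R,M,\rho)=\inf_D\sup_I\mathrm{icomp}_\epsilon(D,I)$, with $I$ ranging over the instances of $\mathcal I_{n,d,R,M,\rho}$. **Theorem.** There are absolute constants $c,c',K>0$ such that the following hold for all parameters with $0<\rho\le 1$. *Lower bounds.* - If $n,d\ge1$, $R\ge1$, $M\ge0$, $\epsilon\ge0$ and $R/\rho\ge K$, then $\mathrm{icomp}_\epsilon(n,d,R,M,\rho)\ge c\,d\,2^n\log\frac R\rho$. - If $d=0$, $n\ge1$, $R\ge1$, $M\ge 0$ and $\epsilon\ge0$, then $\mathrm{icomp}_\epsilon(n,0,R,M,\rho)\ge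 c\,2^n\log R$. - If $n=0$, $d\ge1$, $R\ge1$, $M\ge0$, $\epsilon>0$ and $\frac{MR}{\rho\epsilon}\ge K$, then $\mathrm{icomp}_\epsilon(0,d,R,M,\rho)\ge c\,d\log\frac{MR}{\rho\epsilon}$. *Upper bounds.* - If $n,d\ge1$, $R>0$, $0<\epsilon\le M$ and $\frac{MR}{\rho\epsilon}\ge2$, then $\mathrm{icomp}_\epsilon(n,d,R,M,\rho)\le c'(n+d)\,d\,2^n\log\frac{MR}{\rho\epsilon}$. - If $d=0$, $n\ge1$, $R\ge2$, $M\ge0$ and $\epsilon\ge0$, then $\mathrm{icomp}_\epsilon(n,0,R,M,\rho)\le c'\,n\,2^n\log R$. - If $n=0$, $d\ge1$, $R>0$, $0<\epsilon\le M$ and $\frac{MR}{\rho\epsilon}\ge2$, then $\mathrm{icomp}_\epsilon(0,d,R,M,\rho)\le c'\,d\log\frac{MR}{\rho\epsilon}$. -/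

import Mathlib

open scoped ENNReal

/-! ### Information complexity of a general problem class accessed through an oracle

`Inst` is the set of instances, `Q` the set of queries, `H` the set of answers and `G` the set of
possible solutions; `ans q I` is the answer to the query `q` on the instance `I`. -/

/-- An adaptive query strategy: from the finite set of all query-answer pairs obtained so far it
computes the next query. -/
abbrev QueryStrategy (Q H : Type*) := Finset (Q × H) → Q

open Classical in
/-- The set of the first `k` query-answer pairs when the strategy `D` is run on the instance `I`. -/
noncomputable def transcript {Inst Q H : Type*} (ans : Q → Inst → H) (D : QueryStrategy Q H)
    (I : Inst) : ℕ → Finset (Q × H)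
  | 0 => ∅
  | k + 1 => insert (D (transcript ans D I k), ans (D (transcript ans D I k)) I)
      (transcript ans D I k)

/-- The number `k` of queries is enough for the strategy `D` on the instance `I`: a single solution
is acceptable for every instance that gives the same answers to the first `k` queries. -/
def IsEnough {Inst Q H G : Type*} (ans : Q → Inst → H) (S : Inst → Set G) (D : QueryStrategy Q H)
    (I : Inst) (k : ℕ) : Prop :=
  ∃ z : G, ∀ I' : Inst, (∀ p ∈ transcript ans D I k, ans p.1 I' = p.2) → z ∈ S I'

/-- The least number of queries that is enough for `D` on `I` (`⊤` if no finite number is). -/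
noncomputable def infoCompOn {Inst Q H G : Type*} (ans : Q → Inst → H) (S : Inst → Set G)
    (D : QueryStrategy Q H) (I : Inst) : ℕ∞ :=
  ⨅ (k : ℕ) (_ : IsEnough ans S D I k), (k : ℕ∞)

/-- The information complexity of a problem class, counted in queries: the infimum over all adaptive
strategies of the worst case over all instances. -/
noncomputable def infoComp {Inst Q H G : Type*} (ans : Q → Inst → H) (S : Inst → Set G) : ℕ∞ :=
  ⨅ D : QueryStrategy Q H, ⨆ I : Inst, infoCompOn ans S D I

/-! ### Mixed-integer convex optimization -/

/-- The space `ℝⁿ × ℝᵈ`; its norm is the `ℓ^∞` norm. -/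
abbrev MISpace (n d : ℕ) := (Fin n → ℝ) × (Fin d → ℝ)

/-- The standard scalar product of `ℝⁿ × ℝᵈ`. -/
def miDot {n d : ℕ} (z w : MISpace n d) : ℝ := z.1 ⬝ᵥ w.1 + z.2 ⬝ᵥ w.2

/-- The integer lattice `ℤⁿ × ℝᵈ`. -/
def miLattice (n d : ℕ) : Set (MISpace n d) := {z | ∀ i, ∃ m : ℤ, z.1 i = m}

/-- The feasible solutions `z` of `inf {f w : w ∈ C ∩ (ℤⁿ × ℝᵈ)}` whose value exceeds the optimal
value by at most `ε`. -/
def approxSolutions {n d : ℕ} (f : MISpace n d → ℝ) (C : Set (MISpace n d)) (ε : ℝ) :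
    Set (MISpace n d) :=
  {z | z ∈ C ∩ miLattice n d ∧ ∀ w ∈ C ∩ miLattice n d, f z ≤ f w + ε}

/-- The pair `(f, C)` belongs to the class with the parameters `n, d, R, M, ρ`. -/
structure IsMIConvex (n d : ℕ) (R M ρ : ℝ) (f : MISpace n d → ℝ) (C : Set (MISpace n d)) :
    Prop where
  convex_f : ConvexOn ℝ Set.univ f
  closed_C : IsClosed C
  convex_C : Convex ℝ C
  feasible : (C ∩ miLattice n d).Nonempty
  bounded : ∀ z ∈ C, ‖z‖ ≤ R
  lipschitz : ∀ x : Fin n → ℝ, (∀ i, ∃ m : ℤ, x i = m) → ‖x‖ ≤ R →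
    ∀ y y' : Fin d → ℝ, ‖y‖ ≤ R → ‖y'‖ ≤ R → |f (x, y) - f (x, y')| ≤ M * ‖y - y'‖
  strictly_feasible : ∀ z ∈ approxSolutions f C 0,
    ∃ ŷ : Fin d → ℝ, ∀ y : Fin d → ℝ, ‖y - ŷ‖ ≤ ρ → (z.1, y) ∈ C

/-- `sep` is a separation oracle for `C`: `none` says that the point is in `C`, and `some (a, b)`
reports the half-space `⟨a, w⟩ ≤ b`, which contains `C` but not the point. -/
def IsSeparationOracle {n d : ℕ} (C : Set (MISpace n d))
    (sep : MISpace n d → Option (MISpace n d × ℝ)) : Prop :=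
  ∀ z, (sep z = none ↔ z ∈ C) ∧
    ∀ a b, sep z = some (a, b) → (∀ w ∈ C, miDot a w ≤ b) ∧ b < miDot a z

/-- `g` reports a subgradient of `f` at each point. -/
def IsSubgradientOracle {n d : ℕ} (f : MISpace n d → ℝ) (g : MISpace n d → MISpace n d) : Prop :=
  ∀ z w, f z + miDot (g z) (w - z) ≤ f w

/-- An instance of the class with parameters `n, d, R, M, ρ`, together with the (arbitrary) correct
separation oracle and first-order oracle through which it is accessed. -/
structure MIInstance (n d : ℕ) (R M ρ : ℝ) where
  f : MISpace n d → ℝ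
  C : Set (MISpace n d)
  mem : IsMIConvex n d R M ρ f C
  sep : MISpace n d → Option (MISpace n d × ℝ)
  sep_correct : IsSeparationOracle C sep
  subgrad : MISpace n d → MISpace n d
  subgrad_correct : IsSubgradientOracle f subgrad

/-- A query: the separation oracle or the first-order oracle, at some point of `ℝⁿ × ℝᵈ`. -/
inductive MIQuery (n d : ℕ) where
  | separation (z : MISpace n d)
  | firstOrder (z : MISpace n d)

/-- An answer: that of the separation oracle, or a function value with a subgradient. -/
inductive MIAnswer (n d : ℕ) where
  | separation (r : Option (MISpace n d × ℝ))
  | firstOrder (value : ℝ) (subgradient : MISpace n d)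

/-- The answer to a query on an instance. -/
def miAnswer {n d : ℕ} {R M ρ : ℝ} : MIQuery n d → MIInstance n d R M ρ → MIAnswer n d
  | .separation z, I => .separation (I.sep z)
  | .firstOrder z, I => .firstOrder (I.f z) (I.subgrad z)

/-- The `ε`-information complexity (number of queries) of the class with parameters
`n, d, R, M, ρ`. -/
noncomputable def miInfoComp (ε : ℝ) (n d : ℕ) (R M ρ : ℝ) : ℕ∞ :=
  infoComp (miAnswer (n := n) (d := d) (R := R) (M := M) (ρ := ρ))
    (fun I => approxSolutions I.f I.C ε)

/-! The lower bounds come from a resisting oracle. Queries are answered while a set of instances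
compatible with all answers is kept; as long as no single point solves every instance of that set, a
further query is needed (`le_infoComp_of_adversary`).

For the feasibility bounds `f = 0` and the feasible region lies over a cube `{0,1}^J`. Its lattice
points lie in the `2^|J|` fibers over the vertices, and a half-space that cuts a query point out of
one fiber can be tilted so steeply along the cube that the other fibers stay whole (`exists_tilt`).
A query thus makes progress in one fiber only. Inside a fiber the adversary plays bisection: a box
in `ℝᵈ` survives on the order of `d log (R/ρ)` cuts, an integer interval on the order of `log R`.

For `n = 0` the dependence on `MR/ε` comes from the values. The objective is a maximum of `d`
one-variable functions, each with a V-shaped tip. A query reveals a coordinate that attains the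
maximum, and its tip is replaced by one three times narrower and flatter, but deeper, away from the
query (`IsVShape.exists_deeper`). It takes about `log (MR/ε)` such rounds per coordinate until the
possible gain drops to `ε`. As `MR/(ρε) ≤ (R/ρ)(MR/ε)` for `R ≥ 1`, the better of the two bounds
suffices.

The upper bounds come from cutting planes through lattice points. Near an optimum there is a ball of
`ε`-good points of radius `r = ρ min(1, ε/(2MR))`; once a cut hits this target, the best feasible
query point is `ε`-approximate (`isEnough_of_cut`). With integer variables, progress is the number
of surviving points of a grid that meets every target. A query at their centerpoint removes the
fraction `1/(2ⁿ(d+1))`, by the Helly number of `ℤⁿ × ℝᵈ` (`exists_centerpoint`). For `n = 0` this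
would lose a factor `d`; there the query is the centre of the largest inscribed ellipsoid, and each
cut shrinks the largest volume by a constant factor (`abs_det_le_of_cut`), starting from at most
`R^d` with threshold `r^d`. -/

section Abstract

/-! ### Adversaries and strategies for abstract query problems -/

variable {Inst Q H G : Type*} {ans : Q → Inst → H} {S : Inst → Set G}

/-- The resisting-oracle argument: `P r 𝒞` says that the set `𝒞` of instances survives `r` further
queries. -/
theorem le_infoComp_of_adversary (P : ℕ → Set Inst → Prop)
    (nonempty : ∀ r 𝒞, P r 𝒞 → 𝒞.Nonempty)
    (unsolved : ∀ r 𝒞, P (r + 1) 𝒞 → ∀ z, ∃ I ∈ 𝒞, z ∉ S I)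
    (step : ∀ r 𝒞, P (r + 1) 𝒞 → ∀ q, ∃ h, ∃ 𝒞' ⊆ 𝒞, P r 𝒞' ∧ ∀ I ∈ 𝒞', ans q I = h)
    {r : ℕ} {𝒞 : Set Inst} (h : P r 𝒞) : (r : ℕ∞) ≤ infoComp ans S := by
  classical
  refine le_iInf fun D => ?_
  have key : ∀ (r : ℕ) (𝒞 : Set Inst) (k : ℕ) (τ : Finset (Q × H)), P r 𝒞 →
      (∀ I ∈ 𝒞, transcript ans D I k = τ) → (∀ I ∈ 𝒞, ∀ p ∈ τ, ans p.1 I = p.2) →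
      (∀ I ∈ 𝒞, ∀ k' < k, ¬ IsEnough ans S D I k') →
      ∃ I ∈ 𝒞, ∀ k' < k + r, ¬ IsEnough ans S D I k' := by
    intro r
    induction r with
    | zero =>
      intro 𝒞 k τ hP _ _ hk
      obtain ⟨I, hI⟩ := nonempty _ _ hP
      exact ⟨I, hI, hk I hI⟩
    | succ r ih =>
      intro 𝒞 k τ hP hτ hans hk
      obtain ⟨a, 𝒞', hsub, hP', ha⟩ := step r 𝒞 hP (D τ)
      obtain ⟨I, hI, hI'⟩ := ih 𝒞' (k + 1) (insert (D τ, a) τ) hP'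
        (fun I hI => by
          rw [transcript, hτ I (hsub hI), ha I hI])
        (fun I hI p hp => by
          rcases Finset.mem_insert.1 hp with rfl | hp
          · exact ha I hI
          · exact hans I (hsub hI) p hp)
        (fun I hI k' hk' => by
          rcases Nat.lt_succ_iff_lt_or_eq.1 hk' with h | rfl
          · exact hk I (hsub hI) k' h
          · rintro ⟨z, hz⟩
            -- All of `𝒞` is consistent with the transcript `τ`, so a point that is safe after `k`
            -- queries would have to solve every instance in `𝒞`.
            obtain ⟨I₀, hI₀, hz₀⟩ := unsolved r 𝒞 hP z
            refine hz₀ (hz I₀ fun p hp => ?_)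
            rw [hτ I (hsub hI)] at hp
            exact hans I₀ hI₀ p hp)
      exact ⟨I, hsub hI, fun k' hk' => hI' k' (by omega)⟩
  obtain ⟨I, -, hI⟩ := key r 𝒞 0 ∅ h (fun _ _ => rfl) (by simp) (by simp)
  refine le_iSup_of_le I (le_iInf fun k => le_iInf fun hk => ?_)
  by_contra hlt
  exact hI k (by simpa using hlt) hk

theorem infoComp_le_of_strategy (D : QueryStrategy Q H) (N : ℕ)
    (h : ∀ I, ∃ k ≤ N, IsEnough ans S D I k) : infoComp ans S ≤ N := by
  refine iInf_le_of_le D (iSup_le fun I => ?_)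
  obtain ⟨k, hk, hE⟩ := h I
  exact (iInf₂_le k hE).trans (by exact_mod_cast hk)

theorem transcript_consistent (D : QueryStrategy Q H) (I : Inst) (k : ℕ) :
    ∀ p ∈ transcript ans D I k, ans p.1 I = p.2 := by
  induction k with
  | zero => simp [transcript]
  | succ k ih =>
    intro p hp
    classical
    rcases Finset.mem_insert.1 hp with rfl | hp
    · rfl
    · exact ih p hp

end Abstract

/-! ### The scalar product and separating half-spaces -/

section Dot

variable {n d : ℕ}

theorem miDot_add_left (a a' z : MISpace n d) : miDot (a + a') z = miDot a z + miDot a' z := by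
  simp only [miDot, Prod.fst_add, Prod.snd_add, add_dotProduct]; ring

theorem miDot_add (a z w : MISpace n d) : miDot a (z + w) = miDot a z + miDot a w := by
  simp only [miDot, Prod.fst_add, Prod.snd_add, dotProduct_add]; ring

theorem miDot_sub (a z w : MISpace n d) : miDot a (z - w) = miDot a z - miDot a w := by
  simp only [miDot, Prod.fst_sub, Prod.snd_sub, dotProduct_sub]; ring

theorem miDot_smul (t : ℝ) (a z : MISpace n d) : miDot a (t • z) = t * miDot a z := by
  simp only [miDot, Prod.smul_fst, Prod.smul_snd, dotProduct_smul, smul_eq_mul]; ring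

theorem miDot_smul_left (t : ℝ) (a z : MISpace n d) : miDot (t • a) z = t * miDot a z := by
  simp only [miDot, Prod.smul_fst, Prod.smul_snd, smul_dotProduct, smul_eq_mul]; ring

@[simp]
theorem miDot_zero_left (z : MISpace n d) : miDot 0 z = 0 := by
  simp [miDot]

theorem isLinearMap_miDot (a : MISpace n d) : IsLinearMap ℝ (miDot a) :=
  ⟨miDot_add a, fun t z => miDot_smul t a z⟩

theorem continuous_miDot (a : MISpace n d) : Continuous (miDot a) := by
  unfold miDot dotProduct
  fun_prop

theorem convex_miDot_le (a : MISpace n d) (b : ℝ) : Convex ℝ {z | miDot a z ≤ b} :=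
  convex_halfSpace_le (isLinearMap_miDot a) b

theorem convex_miDot_lt (a : MISpace n d) (b : ℝ) : Convex ℝ {z | miDot a z < b} :=
  convex_halfSpace_lt (isLinearMap_miDot a) b

theorem isClosed_miDot_le (a : MISpace n d) (b : ℝ) : IsClosed {z | miDot a z ≤ b} :=
  isClosed_le (continuous_miDot a) continuous_const

theorem exists_miDot_eq (φ : StrongDual ℝ (MISpace n d)) : ∃ a, ∀ z, φ z = miDot a z := by
  refine ⟨(fun i => φ (Pi.single i 1, 0), fun i => φ (0, Pi.single i 1)), fun z => ?_⟩
  have h1 : z = ∑ i, z.1 i • ((Pi.single i 1, 0) : MISpace n d)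
      + ∑ i, z.2 i • ((0, Pi.single i 1) : MISpace n d) := by
    refine Prod.ext ?_ ?_
    · ext j
      simp [Prod.fst_sum, Finset.sum_apply, Pi.single_apply]
    · ext j
      simp [Prod.snd_sum, Finset.sum_apply, Pi.single_apply]
  conv_lhs => rw [h1]
  simp only [map_add, map_sum, map_smul, smul_eq_mul, miDot, dotProduct]
  congr 1 <;> exact Finset.sum_congr rfl fun i _ => mul_comm _ _

theorem exists_separating {C : Set (MISpace n d)} (hc : Convex ℝ C) (hcl : IsClosed C)
    {z : MISpace n d} (hz : z ∉ C) : ∃ a b, (∀ w ∈ C, miDot a w ≤ b) ∧ b < miDot a z := by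
  obtain ⟨φ, u, hu, hz⟩ := geometric_hahn_banach_closed_point hc hcl hz
  obtain ⟨a, ha⟩ := exists_miDot_eq φ
  exact ⟨a, u, fun w hw => by rw [← ha]; exact (hu w hw).le, by rwa [← ha]⟩

theorem exists_separationOracle {C : Set (MISpace n d)} (hc : Convex ℝ C) (hcl : IsClosed C) :
    ∃ sep, IsSeparationOracle C sep := by
  classical
  choose a b hab hz using fun z : {z // z ∉ C} => exists_separating hc hcl z.2
  refine ⟨fun z => if hz : z ∈ C then none else some (a ⟨z, hz⟩, b ⟨z, hz⟩), fun z => ?_⟩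
  by_cases h : z ∈ C
  · simp [h]
  · simp only [h, dite_false, reduceCtorEq, Option.some.injEq, Prod.mk.injEq, and_imp, true_and]
    rintro _ _ rfl rfl
    exact ⟨hab ⟨z, h⟩, hz ⟨z, h⟩⟩

theorem isClosed_miLattice : IsClosed (miLattice n d) := by
  have : miLattice n d = ⋂ i : Fin n, (fun z : MISpace n d => z.1 i) ⁻¹' (Set.range ((↑) : ℤ → ℝ)) := by
    ext z
    simp [miLattice, eq_comm]
  rw [this]
  exact isClosed_iInter fun i => Int.isClosedEmbedding_coe_real.isClosed_range.preimage (by fun_prop)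

end Dot

/-! ### Optimality of the largest inscribed ellipsoid -/

section Ellipsoid

open Matrix Filter Topology

variable {ι : Type*} [Fintype ι]

/-- The Euclidean norm of a vector. -/
noncomputable def euclNorm (v : ι → ℝ) : ℝ := √(v ⬝ᵥ v)

theorem euclNorm_eq (v : ι → ℝ) : euclNorm v = ‖(WithLp.toLp 2 v : EuclideanSpace ℝ ι)‖ := by
  rw [euclNorm, EuclideanSpace.norm_eq]
  simp [dotProduct, pow_two]

theorem euclNorm_nonneg (v : ι → ℝ) : 0 ≤ euclNorm v := Real.sqrt_nonneg _

theorem dotProduct_self_nonneg' (v : ι → ℝ) : 0 ≤ v ⬝ᵥ v :=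
  Finset.sum_nonneg fun i _ => mul_self_nonneg (v i)

theorem euclNorm_sq (v : ι → ℝ) : euclNorm v ^ 2 = v ⬝ᵥ v :=
  Real.sq_sqrt (dotProduct_self_nonneg' v)

theorem dotProduct_le_euclNorm (u v : ι → ℝ) : u ⬝ᵥ v ≤ euclNorm u * euclNorm v := by
  rw [euclNorm_eq, euclNorm_eq]
  have := real_inner_le_norm (WithLp.toLp 2 u : EuclideanSpace ℝ ι) (WithLp.toLp 2 v)
  simpa [PiLp.inner_apply, dotProduct, mul_comm] using this

theorem neg_dotProduct_le_euclNorm (u v : ι → ℝ) : -(u ⬝ᵥ v) ≤ euclNorm u * euclNorm v := by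
  have := dotProduct_le_euclNorm (-u) v
  simpa [euclNorm] using this

theorem abs_euclNorm_sub_le (u v : ι → ℝ) : |euclNorm u - euclNorm v| ≤ euclNorm (u - v) := by
  simp only [euclNorm_eq, WithLp.toLp_sub]
  exact abs_norm_sub_norm_le _ _

theorem euclNorm_pos {v : ι → ℝ} (hv : v ≠ 0) : 0 < euclNorm v := by
  rw [euclNorm_eq]; simpa using hv

@[simp]
theorem euclNorm_zero : euclNorm (0 : ι → ℝ) = 0 := by simp [euclNorm]

theorem continuous_euclNorm : Continuous (euclNorm : (ι → ℝ) → ℝ) := by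
  unfold euclNorm dotProduct; fun_prop

theorem abs_apply_le_euclNorm (v : ι → ℝ) (i : ι) : |v i| ≤ euclNorm v := by
  refine Real.abs_le_sqrt ?_
  rw [pow_two]
  exact Finset.single_le_sum (f := fun i => v i * v i) (fun i _ => mul_self_nonneg (v i))
    (Finset.mem_univ i)

theorem euclNorm_smul {t : ℝ} (ht : 0 ≤ t) (v : ι → ℝ) : euclNorm (t • v) = t * euclNorm v := by
  rw [euclNorm, euclNorm, smul_dotProduct, dotProduct_smul, smul_smul, smul_eq_mul,
    Real.sqrt_mul (mul_self_nonneg t), Real.sqrt_mul_self ht]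

/-- The pairs `(c, B)` such that the ellipsoid `{c + B u : |u| ≤ 1}` lies in the polyhedron
`{x : ∀ (a, b) ∈ 𝓗, ⟨a, x⟩ ≤ b}`. -/
def inscribedEllipsoids (𝓗 : Set ((ι → ℝ) × ℝ)) : Set ((ι → ℝ) × Matrix ι ι ℝ) :=
  {p | ∀ h ∈ 𝓗, h.1 ⬝ᵥ p.1 + euclNorm (p.2ᵀ *ᵥ h.1) ≤ h.2}

variable [DecidableEq ι]

/-- The determinant expands as `1 + t * g t` with `g` continuous and `g 0 = X.trace`. -/
theorem eventually_one_lt_det {X : Matrix ι ι ℝ} (hX : 0 < X.trace) :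
    ∀ᶠ t : ℝ in 𝓝[>] 0, 1 < (1 + t • X).det := by
  set g : ℝ → ℝ := fun t =>
    X.trace + (det (1 + (Polynomial.X : Polynomial ℝ) • X.map Polynomial.C)).divX.divX.eval t * t
  have hg : Continuous g := by
    have := (det (1 + (Polynomial.X : Polynomial ℝ) • X.map Polynomial.C)).divX.divX.continuous
    exact continuous_const.add (this.mul continuous_id)
  have h0 : ∀ᶠ t in 𝓝[>] (0 : ℝ), 0 < g t := by
    refine nhdsWithin_le_nhds ((hg.tendsto 0).eventually (lt_mem_nhds ?_))
    simpa [g] using hX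
  filter_upwards [h0, self_mem_nhdsWithin] with t ht ht0
  rw [Matrix.det_one_add_smul]
  have := mul_pos (Set.mem_Ioi.1 ht0) ht
  simp only [g] at this
  nlinarith

/-- First-order optimality of the unit ball among the ellipsoids in a polyhedron. -/
theorem trace_nonpos_of_isMax {𝓗 : Set ((ι → ℝ) × ℝ)} (hfin : 𝓗.Finite)
    (hball : ∀ h ∈ 𝓗, euclNorm h.1 ≤ h.2)
    (hmax : ∀ p ∈ inscribedEllipsoids 𝓗, |p.2.det| ≤ 1) (X : Matrix ι ι ℝ) (m : ι → ℝ)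
    (hX : ∀ h ∈ 𝓗, euclNorm h.1 = h.2 →
      h.1 ⬝ᵥ (Xᵀ *ᵥ h.1) + (h.1 ⬝ᵥ m) * euclNorm h.1 ≤ 0) : X.trace ≤ 0 := by
  by_contra! htr
  -- Subtracting this multiple of the identity makes the contact inequalities strict while the trace
  -- stays positive. The perturbed ellipsoid `(t • m, 1 + t • Y)` is then feasible and larger than
  -- the unit ball for small `t`.
  set σ : ℝ := X.trace / (2 * (Fintype.card ι + 1)) with hσ
  have hσ0 : 0 < σ := by positivity
  set Y : Matrix ι ι ℝ := X - σ • (1 : Matrix ι ι ℝ) with hY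
  have hYtr : 0 < Y.trace := by
    rw [hY, trace_sub, trace_smul, trace_one, smul_eq_mul, hσ, sub_pos, div_mul_eq_mul_div,
      div_lt_iff₀ (by positivity)]
    nlinarith [(Nat.cast_nonneg (Fintype.card ι) : (0 : ℝ) ≤ _)]
  have hfeas : ∀ h ∈ 𝓗, ∀ᶠ t : ℝ in 𝓝[>] 0,
      h.1 ⬝ᵥ (t • m) + euclNorm ((1 + t • Y)ᵀ *ᵥ h.1) ≤ h.2 := by
    intro h hh
    set a := h.1
    have hexp : ∀ t : ℝ, (1 + t • Y)ᵀ *ᵥ a = a + t • (Yᵀ *ᵥ a) := fun t => by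
      rw [transpose_add, transpose_one, transpose_smul, add_mulVec, one_mulVec, smul_mulVec]
    simp only [hexp, dotProduct_smul, smul_eq_mul]
    rcases (hball h hh).lt_or_eq with hlt | heq
    · have hc : Continuous fun t : ℝ => t * (a ⬝ᵥ m) + euclNorm (a + t • (Yᵀ *ᵥ a)) := by
        have := continuous_euclNorm (ι := ι)
        fun_prop
      refine nhdsWithin_le_nhds ((hc.tendsto 0).eventually (ge_mem_nhds ?_))
      simpa using hlt
    · rcases eq_or_ne a 0 with ha | ha
      · have : 0 ≤ h.2 := by rw [← heq]; exact euclNorm_nonneg _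
        exact Eventually.of_forall fun t => by simpa [ha] using this
      · set β := euclNorm a with hβ
        have hβ0 : 0 < β := euclNorm_pos ha
        have hq : a ⬝ᵥ (Yᵀ *ᵥ a) + (a ⬝ᵥ m) * β ≤ -(σ * β ^ 2) := by
          have h1 := hX h hh heq
          have h2 : a ⬝ᵥ (Yᵀ *ᵥ a) = a ⬝ᵥ (Xᵀ *ᵥ a) - σ * β ^ 2 := by
            rw [hY, transpose_sub, transpose_smul, transpose_one, sub_mulVec, smul_mulVec,
              one_mulVec, dotProduct_sub, dotProduct_smul, smul_eq_mul, hβ, euclNorm_sq]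
          rw [h2]; linarith
        set z := Yᵀ *ᵥ a
        -- For the squared form of `|a + t z| ≤ β - t ⟨a, m⟩`: the first-order gain `2tσβ²`
        -- outweighs `t²|z|²` by `e1`, and the right-hand side is nonnegative by `e2`.
        have e1 : ∀ᶠ t : ℝ in 𝓝[>] 0, t * (z ⬝ᵥ z) < 2 * σ * β ^ 2 := by
          have hc : Continuous fun t : ℝ => t * (z ⬝ᵥ z) := by fun_prop
          refine nhdsWithin_le_nhds ((hc.tendsto 0).eventually (gt_mem_nhds ?_))
          simp; positivity
        have e2 : ∀ᶠ t : ℝ in 𝓝[>] 0, t * (a ⬝ᵥ m) < β := by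
          have hc : Continuous fun t : ℝ => t * (a ⬝ᵥ m) := by fun_prop
          refine nhdsWithin_le_nhds ((hc.tendsto 0).eventually (gt_mem_nhds ?_))
          simpa using hβ0
        filter_upwards [e1, e2, self_mem_nhdsWithin] with t h1 h2 h3
        have ht : 0 < t := h3
        rw [← heq, ← le_sub_iff_add_le', euclNorm]
        refine Real.sqrt_le_iff.2 ⟨by linarith, ?_⟩
        have hexp2 : (a + t • z) ⬝ᵥ (a + t • z) = β ^ 2 + 2 * t * (a ⬝ᵥ z) + t ^ 2 * (z ⬝ᵥ z) := by
          rw [hβ, euclNorm_sq, add_dotProduct, dotProduct_add, dotProduct_add]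
          simp only [smul_dotProduct, dotProduct_smul, smul_eq_mul, dotProduct_comm z a]
          ring
        rw [hexp2]
        nlinarith [mul_pos ht ht, mul_lt_mul_of_pos_left h1 ht, mul_le_mul_of_nonneg_left hq ht.le,
          sq_nonneg (t * (a ⬝ᵥ m))]
  have hall : ∀ᶠ t : ℝ in 𝓝[>] 0, ∀ h ∈ 𝓗,
      h.1 ⬝ᵥ (t • m) + euclNorm ((1 + t • Y)ᵀ *ᵥ h.1) ≤ h.2 :=
    (Filter.eventually_all_finite hfin).2 hfeas
  obtain ⟨t, ht1, ht2⟩ := (hall.and (eventually_one_lt_det hYtr)).exists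
  have := hmax (t • m, 1 + t • Y) ht1
  linarith [le_abs_self (1 + t • Y).det]

end Ellipsoid

/-! ### A cut through the centre shrinks the largest ellipsoid -/

section EllipsoidCut

open Matrix Filter Topology

/-- For `x ≥ 0` the quadratic lower bound of `exp` at `y = x - x²/4` is enough, as `y ≥ 3x/4`. For
`x < 0` the first two terms of the logarithmic series give it. -/
theorem log_one_add_le {x : ℝ} (hx : -1 < x) (hx1 : x ≤ 1) :
    Real.log (1 + x) ≤ x - x ^ 2 / 4 := by
  rcases le_or_gt 0 x with h0 | h0
  · rw [Real.log_le_iff_le_exp (by linarith)]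
    have hy : 0 ≤ x - x ^ 2 / 4 := by nlinarith
    refine le_trans ?_ (Real.quadratic_le_exp_of_nonneg hy)
    have : (3 / 4 : ℝ) ^ 2 ≤ (1 - x / 4) ^ 2 := by
      apply pow_le_pow_left₀ <;> linarith
    nlinarith [mul_le_mul_of_nonneg_left this (sq_nonneg x)]
  · have h := Real.hasSum_pow_div_log_of_abs_lt_one (x := -x) (by rw [abs_lt]; constructor <;> linarith)
    have h2 := sum_le_hasSum (Finset.range 2) (fun i _ => by
      have : 0 ≤ -x := by linarith
      positivity) h
    simp [Finset.sum_range_succ] at h2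
    nlinarith [sq_nonneg x]

theorem lt_one_of_sub_log_le {x : ℝ} (h : x - Real.log (1 + x) ≤ 1 / 100) : x < 1 := by
  by_contra! h1
  have h2 : Real.log (1 + x) = Real.log 2 + Real.log ((1 + x) / 2) := by
    rw [← Real.log_mul (by norm_num) (by linarith)]; congr 1; ring
  have h3 := Real.log_le_sub_one_of_pos (x := (1 + x) / 2) (by linarith)
  have := Real.log_two_lt_d9
  linarith

variable {ι : Type*} [Fintype ι]

/-- The terms `x - log (1 + x)` are nonnegative with sum at most `1/100`. Each one being that small
forces `x i < 1`, and there `log_one_add_le` bounds the term below by `x²/4`. -/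
theorem sum_bounds_of_prod {x : ι → ℝ} (hx : ∀ i, -1 < x i) (hsum : ∑ i, x i ≤ 0)
    (hprod : Real.exp (-(1 / 100)) < ∏ i, (1 + x i)) :
    -(1 / 100) ≤ ∑ i, x i ∧ ∑ i, x i ^ 2 ≤ 4 * (1 / 100) := by
  have hlog : -(1 / 100) < ∑ i, Real.log (1 + x i) := by
    rw [← Real.log_prod fun i _ => by have := hx i; linarith]
    rwa [Real.lt_log_iff_exp_lt (Finset.prod_pos fun i _ => by have := hx i; linarith)]
  have hle : ∀ i, Real.log (1 + x i) ≤ x i := fun i => by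
    have := Real.log_le_sub_one_of_pos (x := 1 + x i) (by have := hx i; linarith)
    linarith
  have hφ : ∑ i, (x i - Real.log (1 + x i)) ≤ 1 / 100 := by
    rw [Finset.sum_sub_distrib]; linarith
  have h1 : ∀ i, x i < 1 := fun i => lt_one_of_sub_log_le <| le_trans
    (Finset.single_le_sum (f := fun i => x i - Real.log (1 + x i))
      (fun j _ => sub_nonneg.2 (hle j)) (Finset.mem_univ i)) hφ
  refine ⟨hlog.le.trans (Finset.sum_le_sum fun i _ => hle i), ?_⟩
  have : ∑ i, x i ^ 2 / 4 ≤ ∑ i, (x i - Real.log (1 + x i)) :=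
    Finset.sum_le_sum fun i _ => by linarith [log_one_add_le (hx i) (h1 i).le]
  rw [← Finset.sum_div] at this
  linarith

variable [DecidableEq ι]

/-- An inscribed ellipsoid of nearly the volume of the maximal unit ball is close to it in shape and
position: `μ i ≥ 4/5` and `|c| ≤ 2/5`. It then has the origin in its interior and cannot lie behind
a hyperplane through the origin. Both estimates follow from `trace_nonpos_of_isMax` with `m = c` and
two choices of the matrix. -/
theorem diagonal_prod_le_of_cut {𝓗 : Set ((ι → ℝ) × ℝ)} (hfin : 𝓗.Finite)
    (hball : ∀ h ∈ 𝓗, euclNorm h.1 ≤ h.2)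
    (hmax : ∀ p ∈ inscribedEllipsoids 𝓗, |p.2.det| ≤ 1) {c μ : ι → ℝ} (hμ : ∀ i, 0 < μ i)
    (hc : (c, diagonal μ) ∈ inscribedEllipsoids 𝓗) {a : ι → ℝ} (ha : a ≠ 0)
    (hcut : a ⬝ᵥ c + euclNorm (diagonal μ *ᵥ a) ≤ 0) :
    ∏ i, μ i ≤ Real.exp (-(1 / 100)) := by
  by_contra! hprod
  set x : ι → ℝ := fun i => μ i - 1 with hx
  have hμx : ∀ i, μ i = 1 + x i := fun i => by simp [hx]
  have hx1 : ∀ i, -1 < x i := fun i => by simp [hx, hμ i]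
  -- the common estimates for a contact constraint
  have contact : ∀ h ∈ 𝓗, euclNorm h.1 = h.2 → ∃ s : ℝ, 0 ≤ s ∧
      h.1 ⬝ᵥ (diagonal x *ᵥ h.1) + (h.1 ⬝ᵥ c) * euclNorm h.1 ≤ -(euclNorm h.1 * s) ∧
      s ≤ euclNorm h.1 * (1 + euclNorm c) ∧
      (h.1 ⬝ᵥ c) ^ 2 ≤ 2 * euclNorm (diagonal x *ᵥ h.1) ^ 2 + 2 * s ^ 2 := by
    intro h hh heq
    have hin := hc h hh
    simp only [diagonal_transpose, ← heq] at hin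
    set v := h.1
    set β := euclNorm v with hβ
    set q := euclNorm (diagonal μ *ᵥ v) with hq
    have hβ0 : 0 ≤ β := euclNorm_nonneg v
    have hq0 : 0 ≤ q := euclNorm_nonneg _
    have hdiff : diagonal μ *ᵥ v - v = diagonal x *ᵥ v := by
      ext i; simp [mulVec_diagonal, hμx]; ring
    have hδ : |q - β| ≤ euclNorm (diagonal x *ᵥ v) := by
      rw [← hdiff]; exact abs_euclNorm_sub_le _ _
    have hcs := dotProduct_le_euclNorm v (diagonal μ *ᵥ v)
    have hquad : v ⬝ᵥ (diagonal x *ᵥ v) = v ⬝ᵥ (diagonal μ *ᵥ v) - β ^ 2 := by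
      rw [← hdiff, dotProduct_sub, hβ, euclNorm_sq]
    have hvc := neg_dotProduct_le_euclNorm v c
    -- `s` is the slack that the second ellipsoid leaves in this constraint. The first bound rests
    -- on `⟨v, diagonal μ v⟩ ≤ βq`, the last one on `|q - β| ≤ |diagonal x v|`.
    refine ⟨β - q - v ⬝ᵥ c, by linarith, ?_, ?_, ?_⟩
    · rw [hquad]; nlinarith
    · nlinarith
    · have : (q - β) ^ 2 ≤ euclNorm (diagonal x *ᵥ v) ^ 2 := sq_le_sq' (by linarith [neg_abs_le (q - β)])
        (le_trans (le_abs_self _) hδ)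
      nlinarith [sq_nonneg ((β - q) + (β - q - v ⬝ᵥ c))]
  have htr1 : ∑ i, x i ≤ 0 := by
    have := trace_nonpos_of_isMax hfin hball hmax (diagonal x) c fun h hh heq => by
      obtain ⟨s, hs, h1, -, -⟩ := contact h hh heq
      rw [diagonal_transpose]
      have := mul_nonneg (euclNorm_nonneg h.1) hs
      linarith
    simpa [trace_diagonal] using this
  obtain ⟨hb1, hb2⟩ := sum_bounds_of_prod hx1 htr1 (by simpa [← hμx] using hprod)
  have hC0 := euclNorm_nonneg c
  set θ : ℝ := 1 / (2 * (1 + euclNorm c)) with hθ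
  have hθ0 : 0 < θ := by positivity
  have hθ1 : θ * (2 * (1 + euclNorm c)) = 1 := by rw [hθ]; field_simp
  -- The summand `θ c cᵀ` brings `|c|²` into the trace. At a contact constraint it contributes `θ
  -- ⟨v, c⟩² ≤ 2θ |diagonal x v|² + 2θ s²`; the first part is cancelled by the term with `x i ^ 2`,
  -- the second is absorbed by `β s`, as `θ` is chosen so that `2θs ≤ β`.
  have htr2 : ∑ i, x i + θ * euclNorm c ^ 2 - 2 * θ * ∑ i, x i ^ 2 ≤ 0 := by
    have := trace_nonpos_of_isMax hfin hball hmax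
      (diagonal x + θ • vecMulVec c c - (2 * θ) • diagonal fun i => x i ^ 2) c fun h hh heq => by
      obtain ⟨s, hs, h1, h2, h3⟩ := contact h hh heq
      have e1 : h.1 ⬝ᵥ ((diagonal x + θ • vecMulVec c c - (2 * θ) • diagonal fun i => x i ^ 2)ᵀ
          *ᵥ h.1) = h.1 ⬝ᵥ (diagonal x *ᵥ h.1) + θ * (h.1 ⬝ᵥ c) ^ 2
            - 2 * θ * euclNorm (diagonal x *ᵥ h.1) ^ 2 := by
        rw [transpose_sub, transpose_add, transpose_smul, transpose_smul, diagonal_transpose,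
          diagonal_transpose, transpose_vecMulVec, sub_mulVec, add_mulVec, smul_mulVec, smul_mulVec,
          dotProduct_sub, dotProduct_add, dotProduct_smul, dotProduct_smul, vecMulVec_mulVec,
          euclNorm_sq]
        have : h.1 ⬝ᵥ ((diagonal fun i => x i ^ 2) *ᵥ h.1) =
            (diagonal x *ᵥ h.1) ⬝ᵥ (diagonal x *ᵥ h.1) := by
          simp only [dotProduct, mulVec_diagonal]
          exact Finset.sum_congr rfl fun i _ => by ring
        rw [this]
        simp only [smul_eq_mul, dotProduct_smul, op_smul_eq_smul, dotProduct_comm c h.1]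
        ring
      rw [e1]
      have e2 : 2 * θ * s ^ 2 ≤ euclNorm h.1 * s := by
        have : 2 * θ * s ≤ euclNorm h.1 := by
          calc 2 * θ * s ≤ 2 * θ * (euclNorm h.1 * (1 + euclNorm c)) := by gcongr
            _ = euclNorm h.1 * (θ * (2 * (1 + euclNorm c))) := by ring
            _ = euclNorm h.1 := by rw [hθ1, mul_one]
        nlinarith
      have e3 := mul_le_mul_of_nonneg_left h3 hθ0.le
      linarith
    rw [trace_sub, trace_add, trace_smul, trace_smul, trace_diagonal, trace_diagonal,
      trace_vecMulVec, ← euclNorm_sq] at this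
    simpa using this
  -- At `|c| = 2/5` the inequality `e2` would read `0.16 ≤ 0.108`, and it only gets worse for larger
  -- `|c|`.
  have hcb : euclNorm c ≤ 2 / 5 := by
    by_contra! hlt
    have e1 : θ * euclNorm c ^ 2 ≤ 1 / 100 + 2 * θ * (4 * (1 / 100)) := by
      have := mul_le_mul_of_nonneg_left hb2 hθ0.le
      linarith
    have e2 : euclNorm c ^ 2 ≤ (2 * (1 + euclNorm c)) * (1 / 100) + 2 * (4 * (1 / 100)) := by
      have := mul_le_mul_of_nonneg_left e1 (by positivity : 0 ≤ 2 * (1 + euclNorm c))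
      linear_combination this + (2 * (4 * (1 / 100)) - euclNorm c ^ 2) * hθ1
    nlinarith
  have hxi : ∀ i, 4 / 5 ≤ μ i := fun i => by
    have h1 := (Finset.single_le_sum (f := fun i => x i ^ 2) (fun j _ => sq_nonneg (x j))
      (Finset.mem_univ i)).trans hb2
    rw [hμx]
    nlinarith
  have ha0 := euclNorm_pos ha
  have hlow : 4 / 5 * euclNorm a ≤ euclNorm (diagonal μ *ᵥ a) := by
    rw [← euclNorm_smul (by norm_num)]
    refine Real.sqrt_le_sqrt (Finset.sum_le_sum fun i _ => ?_)
    simp only [Pi.smul_apply, smul_eq_mul, mulVec_diagonal]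
    nlinarith [mul_self_nonneg (a i), mul_le_mul (hxi i) (hxi i) (by norm_num) (hμ i).le]
  have := neg_dotProduct_le_euclNorm a c
  nlinarith

/-- Reduction to the diagonal case by an affine change of variables. An ellipsoid depends on `B`
only through `B * Bᵀ`. With `B₁ = B₀ * M` and `M * Mᵀ = U * diagonal l * Uᵀ`, the substitution `c₀ +
(B₀ * U) u` turns the maximal ellipsoid into the unit ball and the other one into a diagonal one
with semi-axes `√(l i)`. -/
theorem abs_det_le_of_cut {𝓗 : Set ((ι → ℝ) × ℝ)} (hfin : 𝓗.Finite) {c₀ c₁ : ι → ℝ}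
    {B₀ B₁ : Matrix ι ι ℝ} (h₀ : (c₀, B₀) ∈ inscribedEllipsoids 𝓗) (hdet : B₀.det ≠ 0)
    (hmax : ∀ p ∈ inscribedEllipsoids 𝓗, |p.2.det| ≤ |B₀.det|)
    (h₁ : (c₁, B₁) ∈ inscribedEllipsoids 𝓗) {a : ι → ℝ} (ha : a ≠ 0)
    (hcut : a ⬝ᵥ c₁ + euclNorm (B₁ᵀ *ᵥ a) ≤ a ⬝ᵥ c₀) :
    |B₁.det| ≤ Real.exp (-(1 / 100)) * |B₀.det| := by
  rcases eq_or_ne B₁.det 0 with hz | hz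
  · rw [hz, abs_zero]; positivity
  have hu₀ : IsUnit B₀.det := hdet.isUnit
  obtain ⟨M, hBM⟩ : ∃ M, B₀ * M = B₁ :=
    ⟨B₀⁻¹ * B₁, by rw [← mul_assoc, mul_nonsing_inv _ hu₀, one_mul]⟩
  have hMdet : M.det ≠ 0 := by
    intro h; apply hz; rw [← hBM, det_mul, h, mul_zero]
  have hpd : (M * Mᵀ).PosDef := by
    have := Matrix.PosDef.mul_conjTranspose_self M
      (vecMul_injective_iff_isUnit.2 ((isUnit_iff_isUnit_det _).2 hMdet.isUnit))
    simpa [conjTranspose_eq_transpose_of_trivial] using this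
  have hherm := hpd.isHermitian
  set U : Matrix ι ι ℝ := (hherm.eigenvectorUnitary : Matrix ι ι ℝ) with hU
  set l := hherm.eigenvalues with hl
  have hl0 : ∀ i, 0 < l i := hpd.eigenvalues_pos
  have hUU : U * Uᵀ = 1 := by
    have := Unitary.coe_mul_star_self hherm.eigenvectorUnitary
    simpa [star_eq_conjTranspose, conjTranspose_eq_transpose_of_trivial] using this
  have hspec : M * Mᵀ = U * diagonal l * Uᵀ := by
    have := hherm.spectral_theorem
    simpa [Unitary.conjStarAlgAut_apply, star_eq_conjTranspose, Function.comp_def,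
      conjTranspose_eq_transpose_of_trivial] using this
  set μ : ι → ℝ := fun i => √(l i) with hμ
  have hμ0 : ∀ i, 0 < μ i := fun i => Real.sqrt_pos.2 (hl0 i)
  have hμμ : diagonal μ * diagonal μ = diagonal l := by
    rw [diagonal_mul_diagonal]
    congr 1; ext i; exact Real.mul_self_sqrt (hl0 i).le
  have hUdet : |U.det| = 1 := by
    have : U.det * U.det = 1 := by
      have := congrArg det hUU
      rwa [det_mul, det_transpose, det_one] at this
    have h2 : |U.det| * |U.det| = 1 := by rw [← abs_mul, this, abs_one]
    nlinarith [abs_nonneg U.det]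
  set W := B₀ * U with hW
  have hWdet : |W.det| = |B₀.det| := by rw [hW, det_mul, abs_mul, hUdet, mul_one]
  have hWu : IsUnit W.det := by
    rw [isUnit_iff_ne_zero, ← abs_pos, hWdet, abs_pos]; exact hdet
  set 𝓗' : Set ((ι → ℝ) × ℝ) := (fun h => (Wᵀ *ᵥ h.1, h.2 - h.1 ⬝ᵥ c₀)) '' 𝓗
  have hdot : ∀ v w : ι → ℝ, (Wᵀ *ᵥ v) ⬝ᵥ w = v ⬝ᵥ (W *ᵥ w) := fun v w => by
    rw [mulVec_transpose, dotProduct_mulVec]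
  have hnormU : ∀ v : ι → ℝ, euclNorm (Wᵀ *ᵥ v) = euclNorm (B₀ᵀ *ᵥ v) := fun v => by
    have : Wᵀ *ᵥ v = Uᵀ *ᵥ (B₀ᵀ *ᵥ v) := by rw [hW, transpose_mul, mulVec_mulVec]
    rw [euclNorm, euclNorm, this]
    congr 1
    rw [dotProduct_mulVec, vecMul_mulVec]
    rw [transpose_transpose, hUU, vecMul_one]
  have hnorm1 : ∀ v : ι → ℝ, euclNorm (diagonal μ *ᵥ (Wᵀ *ᵥ v)) = euclNorm (B₁ᵀ *ᵥ v) := fun v => by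
    rw [euclNorm, euclNorm, mulVec_mulVec, dotProduct_mulVec, dotProduct_mulVec, vecMul_mulVec,
      vecMul_mulVec]
    congr 3
    rw [transpose_transpose, transpose_mul, transpose_transpose, diagonal_transpose]
    calc W * diagonal μ * (diagonal μ * Wᵀ) = B₀ * (U * (diagonal μ * diagonal μ) * Uᵀ) * B₀ᵀ := by
          rw [hW, transpose_mul]; simp only [mul_assoc]
      _ = B₁ * B₁ᵀ := by rw [hμμ, ← hspec, ← hBM, transpose_mul]; simp only [mul_assoc]
  have hprod : ∏ i, μ i ≤ Real.exp (-(1 / 100)) := by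
    refine diagonal_prod_le_of_cut (𝓗 := 𝓗') (c := W⁻¹ *ᵥ (c₁ - c₀)) (a := Wᵀ *ᵥ a) (hfin.image _)
      ?_ ?_ hμ0 ?_ ?_ ?_
    · rintro _ ⟨h, hh, rfl⟩
      have := h₀ h hh
      simp only [hnormU] at this ⊢
      linarith
    · rintro ⟨c, B⟩ hp
      have hmem : (c₀ + W *ᵥ c, W * B) ∈ inscribedEllipsoids 𝓗 := by
        intro h hh
        have := hp _ ⟨h, hh, rfl⟩
        simp only [hdot, mulVec_mulVec] at this
        simp only [dotProduct_add, transpose_mul]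
        linarith
      have := hmax _ hmem
      simp only [det_mul, abs_mul, hWdet] at this ⊢
      exact le_of_mul_le_mul_left (by linarith) (abs_pos.2 hdet)
    · rintro _ ⟨h, hh, rfl⟩
      have := h₁ h hh
      simp only [diagonal_transpose, hnorm1] at this ⊢
      simp only [hdot, mulVec_mulVec, mul_nonsing_inv _ hWu, one_mulVec, dotProduct_sub]
      linarith
    · intro h0
      apply ha
      have : (Wᵀ)⁻¹ *ᵥ (Wᵀ *ᵥ a) = a := by
        rw [mulVec_mulVec, nonsing_inv_mul _ (by rwa [det_transpose]), one_mulVec]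
      rw [← this, h0, mulVec_zero]
    · rw [hnorm1]
      simp only [hdot, mulVec_mulVec, mul_nonsing_inv _ hWu, one_mulVec, dotProduct_sub]
      linarith
  have hdetM : |M.det| = ∏ i, μ i := by
    have h1 : M.det * M.det = (∏ i, μ i) * ∏ i, μ i := by
      have := congrArg det hspec
      rw [det_mul, det_transpose, det_mul, det_mul, det_transpose, det_diagonal] at this
      rw [this, ← Finset.prod_mul_distrib, Finset.prod_congr rfl fun i _ =>
        Real.mul_self_sqrt (hl0 i).le]
      have : U.det * U.det = 1 := by rw [← abs_mul_abs_self, hUdet, mul_one]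
      linear_combination (∏ i, l i) * this
    rw [← abs_of_pos (Finset.prod_pos fun i _ => hμ0 i)]
    exact abs_eq_abs.2 (mul_self_eq_mul_self_iff.1 h1)
  rw [← hBM, det_mul, abs_mul, hdetM, mul_comm]
  gcongr

end EllipsoidCut

/-! ### Doignon's theorem: Helly's theorem for integer points -/

section Doignon

variable {n : ℕ}

/-- The real vector of an integer vector. -/
def intVec (p : Fin n → ℤ) : Fin n → ℝ := fun i => p i

/-- The convex hull of finitely many integer vectors. -/
def intHull (A : Finset (Fin n → ℤ)) : Set (Fin n → ℝ) := convexHull ℝ (intVec '' A)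

theorem intHull_mono {A B : Finset (Fin n → ℤ)} (h : A ⊆ B) : intHull A ⊆ intHull B :=
  convexHull_mono (Set.image_mono (by exact_mod_cast h))

theorem mem_intHull {A : Finset (Fin n → ℤ)} {p : Fin n → ℤ} (h : p ∈ A) : intVec p ∈ intHull A :=
  subset_convexHull _ _ ⟨p, h, rfl⟩

theorem convex_intHull (A : Finset (Fin n → ℤ)) : Convex ℝ (intHull A) := convex_convexHull ℝ _

theorem intHull_insert_subset {A : Finset (Fin n → ℤ)} {p : Fin n → ℤ} {K : Set (Fin n → ℝ)}
    (hK : Convex ℝ K) (hA : intHull A ⊆ K) (hp : intVec p ∈ K) : intHull (insert p A) ⊆ K := by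
  refine convexHull_min ?_ hK
  rintro _ ⟨q, hq, rfl⟩
  rcases Finset.mem_insert.1 (Finset.mem_coe.1 hq) with rfl | hq
  · exact hp
  · exact hA (mem_intHull hq)

/-- If `q` is the midpoint of `p` and of a point of the hull of `A`, then adding `q` to `A` puts `p`
into the hull only if it was there before. -/
theorem mem_intHull_of_midpoint {A : Finset (Fin n → ℤ)} {p p' q : Fin n → ℤ}
    (hp' : intVec p' ∈ intHull A) (hq : intVec q = (1 / 2 : ℝ) • (intVec p + intVec p'))
    (hp : intVec p ∈ intHull (insert q A)) : intVec p ∈ intHull A := by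
  have hne : (intVec '' (A : Set (Fin n → ℤ))).Nonempty := convexHull_nonempty_iff.1 ⟨_, hp'⟩
  rw [intHull, Finset.coe_insert, Set.image_insert_eq, convexHull_insert hne] at hp
  simp only [convexJoin_singleton_left, Set.mem_iUnion] at hp
  obtain ⟨a, ha, t, u, ht, hu, htu, hpe⟩ := hp
  -- In `p = t q + u a`, substitute `q = (p + p')/2` and solve for `p`: it is a convex combination
  -- of `a` and `p'` with weights proportional to `u` and `t/2`.
  have hconv := convex_intHull A ha hp' (a := u / (u + t / 2)) (b := (t / 2) / (u + t / 2))
    (by positivity) (by positivity) (by rw [← add_div]; exact div_self (by linarith))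
  convert hconv using 1
  have h0 : u + t / 2 ≠ 0 := by linarith
  rw [hq] at hpe
  have h1 : (u + t / 2) • intVec p = u • a + (t / 2) • intVec p' := by
    have h2 : u + t / 2 = 1 - t / 2 := by linarith
    rw [h2, sub_smul, one_smul, sub_eq_iff_eq_add]
    conv_lhs => rw [← hpe]
    module
  rw [div_eq_inv_mul, div_eq_inv_mul (t / 2), mul_smul, mul_smul, ← smul_add, ← h1, smul_smul,
    inv_mul_cancel₀ h0, one_smul]

/-- Among the counterexamples with all sets inside `S` take a maximal one, and for each `i` a point
`p i` outside the hull of `A i` but in all others, chosen as close to that hull as possible. Two of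
these points agree modulo `2`, and their midpoint turns out to be a common point. Counting points of
`S` serves as the measure of closeness. -/
theorem exists_common_point_of_card_lt {κ : Type*} [Fintype κ] (hκ : 2 ^ n < Fintype.card κ)
    {S : Finset (Fin n → ℤ)} (hS : ∀ p ∈ S, ∀ p' ∈ S, ∀ q, q + q = p + p' → q ∈ S)
    (A : κ → Finset (Fin n → ℤ)) (hAS : ∀ i, A i ⊆ S)
    (hA : ∀ i, ∃ p ∈ S, ∀ j, j ≠ i → intVec p ∈ intHull (A j)) :
    ∃ z ∈ S, ∀ i, intVec z ∈ intHull (A i) := by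
  classical
  by_contra hno
  set bad : Set (κ → Finset (Fin n → ℤ)) := {A | (∀ i, A i ⊆ S) ∧
    (∀ i, ∃ p ∈ S, ∀ j, j ≠ i → intVec p ∈ intHull (A j)) ∧
    ¬ ∃ z ∈ S, ∀ i, intVec z ∈ intHull (A i)} with hbad
  have hfin : bad.Finite := by
    refine (Fintype.piFinset fun _ : κ => S.powerset).finite_toSet.subset fun A hA => ?_
    simpa using hA.1
  obtain ⟨A, -, hmax⟩ := hfin.exists_le_maximal (a := A) ⟨hAS, hA, hno⟩
  obtain ⟨hAS, hA, hno⟩ := hmax.prop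
  -- the number of points of `S` in the hull after adding `p`
  set N : κ → (Fin n → ℤ) → ℕ := fun i p => (S.filter fun q => intVec q ∈ intHull (insert p (A i))).card
  have hchoice : ∀ i, ∃ p ∈ S, (∀ j, j ≠ i → intVec p ∈ intHull (A j)) ∧
      ∀ z ∈ S, (∀ j, j ≠ i → intVec z ∈ intHull (A j)) → N i p ≤ N i z := by
    intro i
    obtain ⟨p, hp⟩ := hA i
    obtain ⟨q, hq, hmin⟩ := Finset.exists_min_image
      (S.filter fun p => ∀ j, j ≠ i → intVec p ∈ intHull (A j)) (N i) ⟨p, by simpa using hp⟩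
    rw [Finset.mem_filter] at hq
    exact ⟨q, hq.1, hq.2, fun z hz hz' => hmin z (by simp [hz]; exact hz')⟩
  choose p hpS hpj hpmin using hchoice
  have hpi : ∀ i, intVec (p i) ∉ intHull (A i) := fun i hi => hno ⟨p i, hpS i, fun j => by
    by_cases h : j = i
    · rwa [h]
    · exact hpj i j h⟩
  -- There are more than `2ⁿ` points and only `2ⁿ` parity classes.
  obtain ⟨i, j, hij, hpar⟩ := Fintype.exists_ne_map_eq_of_card_lt
    (fun i k => ((p i k : ℤ) : ZMod 2)) (by simpa using hκ)
  have hdiv : ∀ k, ∃ m : ℤ, m + m = p i k + p j k := fun k => by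
    have h2 := (ZMod.intCast_eq_intCast_iff_dvd_sub _ _ 2).1 (congrFun hpar k)
    obtain ⟨m, hm⟩ := h2
    exact ⟨m + p i k, by push_cast at hm; linarith⟩
  choose q hq using hdiv
  have hqS : q ∈ S := hS _ (hpS i) _ (hpS j) q (funext hq)
  have hqv : intVec q = (1 / 2 : ℝ) • (intVec (p i) + intVec (p j)) := by
    ext k
    have : (q k + q k : ℝ) = p i k + p j k := by exact_mod_cast hq k
    simp only [intVec, Pi.smul_apply, Pi.add_apply, smul_eq_mul]
    linarith
  -- `q` lies in the hull of `A i`; the argument is symmetric in `i` and `j`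
  have main : ∀ i j, i ≠ j → intVec q = (1 / 2 : ℝ) • (intVec (p i) + intVec (p j)) →
      intVec q ∈ intHull (A i) := by
    intro i j hij hqv
    by_contra hqi
    -- The hypotheses survive an enlargement of `A i`, so by maximality the enlarged family must
    -- have a common point `z`.
    have hnew : Function.update A i (insert q (A i)) ∉ bad := by
      intro hb
      have hle : A ≤ Function.update A i (insert q (A i)) := by
        intro k
        by_cases h : k = i
        · subst h; simp
        · simp [h]
      have := hmax.le_of_ge hb hle i
      simp only [Function.update_self] at this
      exact hqi (mem_intHull (this (Finset.mem_insert_self _ _)))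
    have hsup : ∀ k, intHull (A k) ⊆ intHull (Function.update A i (insert q (A i)) k) := by
      intro k
      by_cases h : k = i
      · subst h; simpa using intHull_mono (Finset.subset_insert _ _)
      · simp [h]
    obtain ⟨z, hzS, hz⟩ : ∃ z ∈ S, ∀ k, intVec z ∈ intHull (Function.update A i (insert q (A i)) k) := by
      by_contra hz
      refine hnew ⟨fun k => ?_, fun k => ?_, hz⟩
      · by_cases h : k = i
        · subst h; simpa using Finset.insert_subset hqS (hAS k)
        · simpa [h] using hAS k
      · obtain ⟨p, hp, hp'⟩ := hA k
        exact ⟨p, hp, fun j hj => hsup j (hp' j hj)⟩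
    have hzi : intVec z ∈ intHull (insert q (A i)) := by simpa using hz i
    have hzj : ∀ k, k ≠ i → intVec z ∈ intHull (A k) := fun k hk => by simpa [hk] using hz k
    have hpji : intVec (p j) ∈ intHull (A i) := hpj j i hij
    have hsub1 : intHull (insert z (A i)) ⊆ intHull (insert q (A i)) :=
      intHull_insert_subset (convex_intHull _) (intHull_mono (Finset.subset_insert _ _)) hzi
    have hsub2 : intHull (insert q (A i)) ⊆ intHull (insert (p i) (A i)) := by
      refine intHull_insert_subset (convex_intHull _) (intHull_mono (Finset.subset_insert _ _)) ?_
      rw [hqv, smul_add]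
      exact convex_intHull _ (mem_intHull (Finset.mem_insert_self _ _))
        (intHull_mono (Finset.subset_insert _ _) hpji) (by norm_num) (by norm_num) (by norm_num)
    -- The hulls of `A i` with `z`, with `q` and with `p i` added are nested. By minimality of `p i`
    -- the outer two contain the same points of `S`, so `p i` lies in the hull of `A i` and `q`,
    -- hence in that of `A i` by the midpoint lemma.
    have heq := Finset.eq_of_subset_of_card_le
      (Finset.monotone_filter_right S fun w _ hw => hsub2 (hsub1 hw)) (hpmin i z hzS hzj)
    have hpin : p i ∈ S.filter fun w => intVec w ∈ intHull (insert z (A i)) := by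
      rw [heq, Finset.mem_filter]
      exact ⟨hpS i, mem_intHull (Finset.mem_insert_self _ _)⟩
    exact hpi i (mem_intHull_of_midpoint hpji hqv (hsub1 (Finset.mem_filter.1 hpin).2))
  refine hno ⟨q, hqS, fun k => ?_⟩
  by_cases hki : k = i
  · subst hki; exact main k j hij hqv
  by_cases hkj : k = j
  · subst hkj; exact main k i hij.symm (by rw [hqv, add_comm])
  rw [hqv, smul_add]
  exact convex_intHull _ (hpj i k hki) (hpj j k hkj) (by norm_num) (by norm_num) (by norm_num)

/-- Doignon's theorem: the Helly number of `ℤⁿ` is at most `2ⁿ`. -/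
theorem helly_int {κ : Type*} (s : Finset κ) (F : κ → Set (Fin n → ℝ))
    (hF : ∀ i ∈ s, Convex ℝ (F i))
    (h : ∀ J ⊆ s, J.card ≤ 2 ^ n → ∃ p, ∀ i ∈ J, intVec p ∈ F i) :
    ∃ p, ∀ i ∈ s, intVec p ∈ F i := by
  classical
  induction hc : s.card using Nat.strong_induction_on generalizing s with
  | _ m ih =>
    subst hc
    by_cases hs : s.card ≤ 2 ^ n
    · exact h s subset_rfl hs
    push Not at hs
    have herase : ∀ i : s, ∃ p, ∀ j ∈ s.erase i, intVec p ∈ F j := fun i =>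
      ih _ (Finset.card_erase_lt_of_mem i.2) (s.erase i)
        (fun j hj => hF j (Finset.mem_of_mem_erase hj))
        (fun J hJ => h J (hJ.trans (Finset.erase_subset _ _))) rfl
    choose p hp using herase
    obtain ⟨r, hr⟩ : ∃ r : ℤ, ∀ i k, |p i k| ≤ r :=
      ⟨∑ i, ∑ k, |p i k|, fun i k => le_trans
        (Finset.single_le_sum (f := fun k => |p i k|) (fun _ _ => abs_nonneg _) (Finset.mem_univ k))
        (Finset.single_le_sum (f := fun i => ∑ k, |p i k|)
          (fun _ _ => Finset.sum_nonneg fun _ _ => abs_nonneg _) (Finset.mem_univ i))⟩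
    -- A box that holds all the witnesses; boxes are closed under integral midpoints.
    set S : Finset (Fin n → ℤ) := Fintype.piFinset fun _ => Finset.Icc (-r) r with hSdef
    have hmem : ∀ q, q ∈ S ↔ ∀ k, |q k| ≤ r := fun q => by simp [S, abs_le]
    have hpS : ∀ i, p i ∈ S := fun i => (hmem _).2 (hr i)
    obtain ⟨z, -, hz⟩ := exists_common_point_of_card_lt (κ := s) (by simpa using hs) (S := S)
      (fun a ha b hb q hq => by
        rw [hmem] at ha hb ⊢
        intro k
        have h1 := congrFun hq k
        have h2 := ha k
        have h3 := hb k
        simp only [Pi.add_apply] at h1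
        rw [abs_le] at *
        constructor <;> linarith)
      (fun i => S.filter fun q => intVec q ∈ F i) (fun i => Finset.filter_subset _ _)
      (fun i => ⟨p i, hpS i, fun j hj => mem_intHull (Finset.mem_filter.2 ⟨hpS i, hp i j
        (Finset.mem_erase.2 ⟨fun h => hj (Subtype.ext h), j.2⟩)⟩)⟩)
    refine ⟨z, fun i hi => convexHull_min ?_ (hF i hi) (hz ⟨i, hi⟩)⟩
    rintro _ ⟨q, hq, rfl⟩
    exact (Finset.mem_filter.1 (Finset.mem_coe.1 hq)).2

end Doignon

/-! ### Mixed-integer Helly theorem and centerpoints -/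

section Centerpoint

variable {n d : ℕ}

theorem mem_miLattice_iff {z : MISpace n d} : z ∈ miLattice n d ↔ ∃ p, z.1 = intVec p := by
  constructor
  · intro h
    choose p hp using h
    exact ⟨p, funext hp⟩
  · rintro ⟨p, hp⟩ i
    exact ⟨p i, by rw [hp]; rfl⟩

/-- The Helly number of `ℤⁿ × ℝᵈ` is at most `2ⁿ (d + 1)`. -/
theorem helly_miLattice {κ : Type*} (s : Finset κ) (F : κ → Set (MISpace n d))
    (hF : ∀ i ∈ s, Convex ℝ (F i))
    (h : ∀ J ⊆ s, J.card ≤ 2 ^ n * (d + 1) → ∃ z ∈ miLattice n d, ∀ i ∈ J, z ∈ F i) :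
    ∃ z ∈ miLattice n d, ∀ i ∈ s, z ∈ F i := by
  classical
  -- Helly's theorem in `ℤⁿ` is applied to the projections of the intersections of at most `d + 1`
  -- sets; `2ⁿ` of these involve at most `2ⁿ (d + 1)` sets. Over the resulting `p` every `d + 1`
  -- fibers meet, and Helly's theorem in `ℝᵈ` finishes.
  obtain ⟨p, hp⟩ := helly_int (s.powerset.filter fun J => J.card ≤ d + 1)
    (fun J => {x | ∃ y : Fin d → ℝ, ∀ i ∈ J, (x, y) ∈ F i})
    (fun J hJ => by
      rintro x ⟨y, hy⟩ x' ⟨y', hy'⟩ a b ha hb hab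
      have hJs := Finset.mem_powerset.1 (Finset.mem_filter.1 hJ).1
      exact ⟨a • y + b • y', fun i hi => by
        simpa using hF i (hJs hi) (hy i hi) (hy' i hi) ha hb hab⟩)
    (fun 𝒦 h𝒦 hcard => by
      obtain ⟨z, hz, hzF⟩ := h (𝒦.biUnion id)
        (Finset.biUnion_subset.2 fun J hJ =>
          Finset.mem_powerset.1 (Finset.mem_filter.1 (h𝒦 hJ)).1)
        ((Finset.card_biUnion_le_card_mul _ _ (d + 1) fun J hJ =>
          (Finset.mem_filter.1 (h𝒦 hJ)).2).trans (Nat.mul_le_mul_right _ hcard))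
      obtain ⟨p, hp⟩ := mem_miLattice_iff.1 hz
      refine ⟨p, fun J hJ => ⟨z.2, fun i hi => ?_⟩⟩
      rw [← hp]
      exact hzF i (Finset.mem_biUnion.2 ⟨J, hJ, hi⟩))
  obtain ⟨y, hy⟩ := Convex.helly_theorem' (𝕜 := ℝ) (F := fun i => {y | (intVec p, y) ∈ F i}) (s := s)
    (fun i hi y hy y' hy' a b ha hb hab => by
      have := hF i hi hy hy' ha hb hab
      simp only [Prod.smul_mk, Prod.mk_add_mk, ← add_smul, hab, one_smul] at this
      exact this)
    (fun J hJ hcard => by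
      rw [Module.finrank_fin_fun] at hcard
      obtain ⟨y, hy⟩ := hp J (by simp [hJ, hcard])
      exact ⟨y, by simpa using hy⟩)
  exact ⟨(intVec p, y), mem_miLattice_iff.2 ⟨p, rfl⟩, by simpa using hy⟩

/-- A centerpoint in `ℤⁿ × ℝᵈ`: every open half-space that avoids it misses a positive fraction of
the points. -/
theorem exists_centerpoint (A : Finset (MISpace n d)) (hA : ∀ z ∈ A, z ∈ miLattice n d) :
    ∃ z ∈ miLattice n d, ∀ a, (2 ^ n * (d + 1)) * (A.filter fun w => miDot a (w - z) < 0).card ≤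
      (2 ^ n * (d + 1) - 1) * A.card := by
  classical
  set h := 2 ^ n * (d + 1) with hh
  have hpos : 0 < h := by positivity
  clear_value h
  -- `z` is taken in the hulls of all subsets that contain more than the fraction `(h - 1)/h` of
  -- `A`. The complements of `h` such subsets do not cover `A`, so these subsets share a point of
  -- `A`.
  obtain ⟨z, hz, hzF⟩ := helly_miLattice
    (A.powerset.filter fun T => (h - 1) * A.card < h * T.card)
    (fun T => convexHull ℝ (T : Set (MISpace n d))) (fun T _ => convex_convexHull ℝ _)
    (fun J hJ hcard => by
      rcases J.eq_empty_or_nonempty with rfl | hJne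
      · exact ⟨0, fun i => ⟨0, by simp⟩, by simp⟩
      have hlt : ((J.biUnion fun T => A \ T)).card < A.card := by
        have h1 : h * (J.biUnion fun T => A \ T).card ≤ ∑ T ∈ J, h * (A \ T).card := by
          rw [← Finset.mul_sum]
          exact Nat.mul_le_mul_left _ Finset.card_biUnion_le
        have h2 : ∑ T ∈ J, h * (A \ T).card < ∑ T ∈ J, A.card := by
          refine Finset.sum_lt_sum_of_nonempty hJne fun T hT => ?_
          have hT' := Finset.mem_filter.1 (hJ hT)
          have h3 := Finset.card_sdiff_add_card_eq_card (Finset.mem_powerset.1 hT'.1)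
          have h4 := hT'.2
          rw [Nat.sub_mul, one_mul] at h4
          have h5 : h * (A \ T).card + h * T.card = h * A.card := by rw [← mul_add, h3]
          have h6 : A.card ≤ h * A.card := Nat.le_mul_of_pos_left _ hpos
          omega
        rw [Finset.sum_const, smul_eq_mul] at h2
        have h3 := Nat.mul_le_mul_right A.card (hcard.trans_eq hh.symm)
        exact Nat.lt_of_mul_lt_mul_left (a := h) (by omega)
      obtain ⟨w, hwA, hw⟩ := Finset.exists_mem_notMem_of_card_lt_card hlt
      refine ⟨w, hA w hwA, fun T hT => subset_convexHull _ _ ?_⟩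
      by_contra hwT
      exact hw (Finset.mem_biUnion.2 ⟨T, hT, Finset.mem_sdiff.2 ⟨hwA, hwT⟩⟩))
  refine ⟨z, hz, fun a => ?_⟩
  by_contra! hlt
  -- If the open half-space held too many points, `z` would be in their hull and thus in the
  -- half-space itself.
  have := hzF (A.filter fun w => miDot a (w - z) < 0)
    (Finset.mem_filter.2 ⟨Finset.mem_powerset.2 (Finset.filter_subset _ _), hlt⟩)
  have hsub : convexHull ℝ ((A.filter fun w => miDot a (w - z) < 0 : Finset _) : Set (MISpace n d))
      ⊆ {w | miDot a w < miDot a z} := by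
    refine convexHull_min (fun w hw => ?_) (convex_miDot_lt a _)
    have := (Finset.mem_filter.1 (Finset.mem_coe.1 hw)).2
    rw [miDot_sub] at this
    simpa using this
  exact lt_irrefl (miDot a z) (hsub this)

end Centerpoint

/-! ### The cutting-plane scheme with a general potential -/

section CuttingPlane

variable {n d : ℕ} {R M ρ ε : ℝ}

/-- The cuts `(a, z)`, standing for the half-space `⟨a, w - z⟩ < 0`, reported by the answers
in `τ`. -/
def cuts (τ : Finset (MIQuery n d × MIAnswer n d)) : Set (MISpace n d × MISpace n d) :=
  {p | (∃ b, (MIQuery.separation p.2, MIAnswer.separation (some (p.1, b))) ∈ τ) ∨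
    ∃ v, (MIQuery.firstOrder p.2, MIAnswer.firstOrder v p.1) ∈ τ}

theorem cuts_empty : cuts (∅ : Finset (MIQuery n d × MIAnswer n d)) = ∅ := by
  simp [cuts]

theorem cuts_finite (τ : Finset (MIQuery n d × MIAnswer n d)) : (cuts τ).Finite := by
  let g : MIQuery n d × MIAnswer n d → MISpace n d × MISpace n d
    | (.separation z, .separation (some (a, _))) => (a, z)
    | (.firstOrder z, .firstOrder _ a) => (a, z)
    | _ => 0
  refine (τ.finite_toSet.image g).subset ?_
  rintro ⟨a, z⟩ (⟨b, h⟩ | ⟨v, h⟩)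
  · exact ⟨_, h, rfl⟩
  · exact ⟨_, h, rfl⟩

open Classical in
/-- The strategy that queries both oracles at the point `cen 𝒞` chosen from the present cuts `𝒞`, the
first-order oracle only if that point is feasible. -/
noncomputable def cuttingPlaneStrategy (cen : Set (MISpace n d × MISpace n d) → MISpace n d) :
    QueryStrategy (MIQuery n d) (MIAnswer n d) := fun τ =>
  if (MIQuery.separation (cen (cuts τ)), MIAnswer.separation none) ∈ τ then
    .firstOrder (cen (cuts τ)) else .separation (cen (cuts τ))

/-- All queries are at lattice points, and first-order queries only at points known to be
feasible. -/
def IsCuttingPlaneTranscript (τ : Finset (MIQuery n d × MIAnswer n d)) : Prop :=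
  ∀ p ∈ τ, (∃ z ∈ miLattice n d, p.1 = .separation z) ∨
    ∃ z ∈ miLattice n d, p.1 = .firstOrder z ∧ (MIQuery.separation z, MIAnswer.separation none) ∈ τ

theorem isCuttingPlaneTranscript {cen : Set (MISpace n d × MISpace n d) → MISpace n d}
    (hcen : ∀ 𝒞, cen 𝒞 ∈ miLattice n d) (I : MIInstance n d R M ρ) (k : ℕ) :
    IsCuttingPlaneTranscript (transcript miAnswer (cuttingPlaneStrategy cen) I k) := by
  classical
  induction k with
  | zero => simp [transcript, IsCuttingPlaneTranscript]
  | succ k ih =>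
    intro p hp
    rcases Finset.mem_insert.1 hp with rfl | hp
    · set τ := transcript miAnswer (cuttingPlaneStrategy cen) I k with hτ
      by_cases h : (MIQuery.separation (cen (cuts τ)), MIAnswer.separation none) ∈ τ
      · exact Or.inr ⟨cen (cuts τ), hcen _, by simp [cuttingPlaneStrategy, h],
          Finset.mem_insert_of_mem h⟩
      · exact Or.inl ⟨cen (cuts τ), hcen _, by simp [cuttingPlaneStrategy, h]⟩
    · rcases ih p hp with h | ⟨z, hz, hpz, hzτ⟩
      · exact Or.inl h
      · exact Or.inr ⟨z, hz, hpz, Finset.mem_insert_of_mem hzτ⟩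

theorem mem_of_sep_eq_none {I : MIInstance n d R M ρ} {z : MISpace n d} (h : I.sep z = none) :
    z ∈ I.C := (I.sep_correct z).1.1 h

theorem sep_eq_of_consistent {I : MIInstance n d R M ρ} {τ : Finset (MIQuery n d × MIAnswer n d)}
    (h : ∀ p ∈ τ, miAnswer p.1 I = p.2) {z : MISpace n d} {r} (hz : (.separation z, .separation r) ∈ τ) :
    I.sep z = r := by
  have := h _ hz
  simpa [miAnswer] using this

theorem firstOrder_eq_of_consistent {I : MIInstance n d R M ρ}
    {τ : Finset (MIQuery n d × MIAnswer n d)} (h : ∀ p ∈ τ, miAnswer p.1 I = p.2)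
    {z : MISpace n d} {v g} (hz : (.firstOrder z, .firstOrder v g) ∈ τ) :
    I.f z = v ∧ I.subgrad z = g := by
  have := h _ hz
  simpa [miAnswer] using this

/-- Once some target of every consistent instance is cut, the best feasible point found is an
approximate solution. -/
theorem isEnough_of_cut {D : QueryStrategy (MIQuery n d) (MIAnswer n d)} (I : MIInstance n d R M ρ)
    {k : ℕ} (hinv : IsCuttingPlaneTranscript (transcript miAnswer D I k))
    (hcut : ∀ I' : MIInstance n d R M ρ, ∃ w ∈ I'.C,
      (∀ w' ∈ I'.C ∩ miLattice n d, I'.f w ≤ I'.f w' + ε) ∧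
      ∃ p ∈ cuts (transcript miAnswer D I k), 0 ≤ miDot p.1 (w - p.2)) :
    IsEnough miAnswer (fun I => approxSolutions I.f I.C ε) D I k := by
  classical
  set τ := transcript miAnswer D I k
  have key : ∀ I' : MIInstance n d R M ρ, (∀ p ∈ τ, miAnswer p.1 I' = p.2) →
      ∃ z v g, (MIQuery.firstOrder z, MIAnswer.firstOrder v g) ∈ τ ∧
        ∀ w' ∈ I'.C ∩ miLattice n d, v ≤ I'.f w' + ε := by
    intro I' hI'
    obtain ⟨w, hw, hwε, ⟨a, z⟩, (⟨b, hp⟩ | ⟨v, hp⟩), h0⟩ := hcut I'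
    -- A separating half-space never removes the feasible point `w`. So the cut stems from a
    -- subgradient, and then the value at the query point is at most `I'.f w`.
    · have h1 := (I'.sep_correct z).2 a b (sep_eq_of_consistent hI' hp)
      have h2 := h1.1 w hw
      rw [miDot_sub] at h0
      linarith [h1.2]
    · obtain ⟨h1, h2⟩ := firstOrder_eq_of_consistent hI' hp
      refine ⟨z, v, a, hp, fun w' hw' => ?_⟩
      have h3 := I'.subgrad_correct z w
      rw [h1, h2] at h3
      simp only at h0
      linarith [hwε w' hw']
  let val : MIQuery n d × MIAnswer n d → ℝ
    | (_, .firstOrder v _) => v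
    | _ => 0
  obtain ⟨z₀, v₀, g₀, hz₀, -⟩ := key I (transcript_consistent D I k)
  obtain ⟨p, hp, hmin⟩ := Finset.exists_min_image
    (τ.filter fun p => ∃ z v g, p = (MIQuery.firstOrder z, MIAnswer.firstOrder v g)) val
    ⟨_, Finset.mem_filter.2 ⟨hz₀, _, _, _, rfl⟩⟩
  obtain ⟨hpτ, z, v, g, rfl⟩ := Finset.mem_filter.1 hp
  refine ⟨z, fun I' hI' => ?_⟩
  rcases hinv _ hpτ with ⟨z', -, h⟩ | ⟨z', hz', h, hnone⟩
  · exact absurd h (by simp)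
  obtain rfl : z = z' := by simpa using h
  refine ⟨⟨mem_of_sep_eq_none (sep_eq_of_consistent hI' hnone), hz'⟩, fun w' hw' => ?_⟩
  obtain ⟨z₁, v₁, g₁, hz₁, h₁⟩ := key I' hI'
  have := hmin _ (Finset.mem_filter.2 ⟨hz₁, _, _, _, rfl⟩)
  rw [(firstOrder_eq_of_consistent hI' hpτ).1]
  exact this.trans (h₁ w' hw')

/-- A feasible point with subgradient zero is optimal for every consistent instance. -/
theorem isEnough_of_subgrad_eq_zero (hε : 0 ≤ ε) {D : QueryStrategy (MIQuery n d) (MIAnswer n d)}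
    (I : MIInstance n d R M ρ) {k : ℕ} {z : MISpace n d} {v : ℝ} (hz : z ∈ miLattice n d)
    (hnone : (.separation z, .separation none) ∈ transcript miAnswer D I k)
    (hzero : (.firstOrder z, .firstOrder v 0) ∈ transcript miAnswer D I k) :
    IsEnough miAnswer (fun I => approxSolutions I.f I.C ε) D I k := by
  refine ⟨z, fun I' hI' => ⟨⟨mem_of_sep_eq_none (sep_eq_of_consistent hI' hnone), hz⟩,
    fun w _ => ?_⟩⟩
  have h := I'.subgrad_correct z w
  rw [(firstOrder_eq_of_consistent hI' hzero).2, miDot_zero_left] at h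
  linarith

/-- A round takes at most two queries, separation and, if the centre is feasible, first order. It
either ends with a zero subgradient, which certifies optimality, or adds one nonzero cut through the
centre and multiplies `Φ` by at most `γ`. Once `Φ` is below `φ₀`, some point of the target `G` of
each instance has been cut. The normal of a separating half-space is nonzero because the region is
nonempty. -/
theorem miInfoComp_le_of_potential (hε : 0 ≤ ε)
    (cen : Set (MISpace n d × MISpace n d) → MISpace n d)
    (Φ : Set (MISpace n d × MISpace n d) → ℝ) {γ φ₀ : ℝ} (hγ : 0 ≤ γ) {m : ℕ}
    (hcen : ∀ 𝒞, cen 𝒞 ∈ miLattice n d)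
    (hΦ : ∀ 𝒞, 𝒞.Finite → φ₀ ≤ Φ 𝒞 → ∀ a, a ≠ 0 → Φ (insert (a, cen 𝒞) 𝒞) ≤ γ * Φ 𝒞)
    (htarget : ∀ I : MIInstance n d R M ρ, ∃ G ⊆ I.C,
      (∀ w ∈ G, ∀ w' ∈ I.C ∩ miLattice n d, I.f w ≤ I.f w' + ε) ∧
      ∀ 𝒞, 𝒞.Finite → (∀ w ∈ G, ∀ p ∈ 𝒞, miDot p.1 (w - p.2) < 0) → φ₀ ≤ Φ 𝒞)
    (hm : γ ^ m * Φ ∅ < φ₀) : miInfoComp ε n d R M ρ ≤ (2 * m : ℕ) := by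
  classical
  set D := cuttingPlaneStrategy cen with hD
  refine infoComp_le_of_strategy D (2 * m) fun I => ?_
  set τ := transcript miAnswer D I with hτ
  have hsolved : ∀ k, Φ (cuts (τ k)) < φ₀ →
      IsEnough miAnswer (fun I => approxSolutions I.f I.C ε) D I k := by
    intro k hk
    refine isEnough_of_cut I (isCuttingPlaneTranscript hcen I k) fun I' => ?_
    obtain ⟨G, hGC, hG, hG'⟩ := htarget I'
    by_contra! hno
    refine absurd (hG' (cuts (τ k)) (cuts_finite _) fun w hw p hp => ?_) (not_le.2 hk)
    exact hno w (hGC hw) (hG w hw) p hp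
  have hsucc : ∀ k, τ (k + 1) = insert (D (τ k), miAnswer (D (τ k)) I) (τ k) := fun k => by
    rw [hτ, transcript]
  have hprog : ∀ j, ∃ k ≤ 2 * j, IsEnough miAnswer (fun I => approxSolutions I.f I.C ε) D I k ∨
      Φ (cuts (τ k)) ≤ γ ^ j * Φ ∅ := by
    intro j
    induction j with
    | zero => exact ⟨0, le_rfl, Or.inr (by simp [hτ, transcript, cuts_empty])⟩
    | succ j ih =>
      obtain ⟨k, hk, h | hle⟩ := ih
      · exact ⟨k, by omega, Or.inl h⟩
      by_cases hlt : Φ (cuts (τ k)) < φ₀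
      · exact ⟨k, by omega, Or.inl (hsolved k hlt)⟩
      push Not at hlt
      have step : ∀ a, a ≠ 0 → Φ (insert (a, cen (cuts (τ k))) (cuts (τ k))) ≤ γ ^ (j + 1) * Φ ∅ :=
        fun a ha => (hΦ _ (cuts_finite _) hlt a ha).trans (by
          rw [pow_succ']
          calc γ * Φ (cuts (τ k)) ≤ γ * (γ ^ j * Φ ∅) := by gcongr
            _ = _ := by ring)
      set z := cen (cuts (τ k)) with hz
      -- a first-order query at a feasible `z`
      have hfo : ∀ l ≤ 2 * j + 1, cuts (τ l) = cuts (τ k) →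
          (MIQuery.separation z, MIAnswer.separation none) ∈ τ l →
          ∃ k ≤ 2 * (j + 1), IsEnough miAnswer (fun I => approxSolutions I.f I.C ε) D I k ∨
            Φ (cuts (τ k)) ≤ γ ^ (j + 1) * Φ ∅ := by
        intro l hl hcl hmem
        have hDl : D (τ l) = .firstOrder z := by
          rw [hD, cuttingPlaneStrategy, hcl, ← hz, if_pos hmem]
        have hsl := hsucc l
        rw [hDl] at hsl
        refine ⟨l + 1, by omega, ?_⟩
        by_cases hg : I.subgrad z = 0
        · left
          have h1 : (MIQuery.firstOrder z, MIAnswer.firstOrder (I.f z) 0) ∈ τ (l + 1) := by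
            rw [hsl, miAnswer, hg]; exact Finset.mem_insert_self _ _
          have h2 : (MIQuery.separation z, MIAnswer.separation none) ∈ τ (l + 1) := by
            rw [hsl]; exact Finset.mem_insert_of_mem hmem
          exact isEnough_of_subgrad_eq_zero hε I (hcen _) h2 h1
        · right
          have : cuts (τ (l + 1)) = insert (I.subgrad z, z) (cuts (τ k)) := by
            rw [← hcl, hsl]
            ext ⟨a, y⟩
            simp [cuts, miAnswer, exists_or, and_comm, or_left_comm]
          rw [this]
          exact step _ hg
      by_cases hmem : (MIQuery.separation z, MIAnswer.separation none) ∈ τ k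
      · exact hfo k (by omega) rfl hmem
      have hDk : D (τ k) = .separation z := by
        rw [hD, cuttingPlaneStrategy, ← hz, if_neg hmem]
      have hsk := hsucc k
      rw [hDk, miAnswer] at hsk
      rcases hsep : I.sep z with _ | ⟨a, b⟩
      · rw [hsep] at hsk
        refine hfo (k + 1) (by omega) ?_ (by rw [hsk]; exact Finset.mem_insert_self _ _)
        rw [hsk]
        ext ⟨a, y⟩
        simp [cuts]
      · rw [hsep] at hsk
        refine ⟨k + 1, by omega, Or.inr ?_⟩
        have : cuts (τ (k + 1)) = insert (a, z) (cuts (τ k)) := by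
          rw [hsk]
          ext ⟨a', y⟩
          simp only [cuts, Finset.mem_insert, Set.mem_ofPred_eq, Set.mem_insert_iff, Prod.mk.injEq,
            MIQuery.separation.injEq, MIAnswer.separation.injEq, Option.some.injEq, reduceCtorEq,
            false_and, false_or, exists_or, or_assoc]
          simp [and_comm]
        rw [this]
        refine step a ?_
        rintro rfl
        obtain ⟨w, hw, -⟩ := I.mem.feasible
        have h1 := (I.sep_correct z).2 0 b hsep
        have h2 := h1.1 w hw
        have h3 := h1.2
        rw [miDot_zero_left] at h2 h3
        linarith
  obtain ⟨k, hk, h | h⟩ := hprog m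
  · exact ⟨k, hk, h⟩
  · exact ⟨k, hk, hsolved k (h.trans_lt hm)⟩

end CuttingPlane

/-! ### Optimal solutions and the ball of good points around them -/

section Target

variable {n d : ℕ} {R M ρ ε : ℝ}

theorem IsMIConvex.isCompact {f : MISpace n d → ℝ} {C : Set (MISpace n d)}
    (h : IsMIConvex n d R M ρ f C) : IsCompact C :=
  Metric.isCompact_of_isClosed_isBounded h.closed_C
    ((Metric.isBounded_closedBall (x := 0) (r := R)).subset fun z hz => by
      simpa using h.bounded z hz)

theorem IsMIConvex.exists_optimal {f : MISpace n d → ℝ} {C : Set (MISpace n d)}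
    (h : IsMIConvex n d R M ρ f C) : (approxSolutions f C 0).Nonempty := by
  have hf : Continuous f := by
    rw [← continuousOn_univ]
    exact h.convex_f.continuousOn isOpen_univ
  obtain ⟨z, hz, hmin⟩ := (h.isCompact.inter_right isClosed_miLattice).exists_isMinOn h.feasible
    hf.continuousOn
  exact ⟨z, hz, fun w hw => by simpa using hmin hw⟩

theorem norm_fst_le_of_mem {f : MISpace n d → ℝ} {C : Set (MISpace n d)}
    (h : IsMIConvex n d R M ρ f C) {z : MISpace n d} (hz : z ∈ C) : ‖z.1‖ ≤ R ∧ ‖z.2‖ ≤ R := by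
  have := h.bounded z hz
  rwa [Prod.norm_def, max_le_iff] at this

/-- In the fiber of an optimal solution there is a whole ball of `ε`-good points. -/
theorem IsMIConvex.exists_good_ball {f : MISpace n d → ℝ} {C : Set (MISpace n d)}
    (h : IsMIConvex n d R M ρ f C) (hM : 0 < M) (hR : 0 < R) (hε : 0 < ε) :
    ∃ z ∈ miLattice n d, ∀ y, ‖y - z.2‖ ≤ ρ * min 1 (ε / (2 * M * R)) → (z.1, y) ∈ C ∧
      ∀ w ∈ C ∩ miLattice n d, f (z.1, y) ≤ f w + ε := by
  obtain ⟨⟨x, y₀⟩, hz⟩ := h.exists_optimal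
  obtain ⟨u₀, hu₀⟩ := h.strictly_feasible _ hz
  obtain ⟨⟨hzC, hzL⟩, hopt⟩ := hz
  -- The strictly feasible `ρ`-ball is shrunk towards the optimum `y₀` by the factor `t`. It stays
  -- in the convex set `C`, and its points are within `2Rt` of `y₀`, which costs at most `2MRt ≤ ε`
  -- in value.
  set t := min 1 (ε / (2 * M * R)) with ht
  have ht0 : 0 < t := lt_min one_pos (by positivity)
  have ht1 : t ≤ 1 := min_le_left _ _
  refine ⟨(x, y₀ + t • (u₀ - y₀)), hzL, fun y hy => ?_⟩
  set u := y₀ + t⁻¹ • (y - y₀) with hu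
  have hyu : y = (1 - t) • y₀ + t • u := by
    rw [hu, smul_add, smul_smul, mul_inv_cancel₀ ht0.ne', one_smul]; module
  have huC : (x, u) ∈ C := by
    refine hu₀ u ?_
    have : u - u₀ = t⁻¹ • (y - (y₀ + t • (u₀ - y₀))) := by
      ext i
      simp only [hu, Pi.sub_apply, Pi.add_apply, Pi.smul_apply, smul_eq_mul]
      field_simp
      ring
    rw [this, norm_smul, norm_inv, Real.norm_of_nonneg ht0.le, inv_mul_le_iff₀ ht0]
    linarith
  have hyC : (x, y) ∈ C := by
    have := h.convex_C hzC huC (a := 1 - t) (b := t) (by linarith) ht0.le (by ring)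
    rwa [Prod.smul_mk, Prod.smul_mk, Prod.mk_add_mk, ← hyu, ← add_smul, sub_add_cancel,
      one_smul] at this
  refine ⟨hyC, fun w hw => ?_⟩
  have hL := h.lipschitz x hzL (norm_fst_le_of_mem h hzC).1 y y₀ (norm_fst_le_of_mem h hyC).2
    (norm_fst_le_of_mem h hzC).2
  have hyy : ‖y - y₀‖ ≤ t * (2 * R) := by
    have : y - y₀ = t • (u - y₀) := by rw [hyu]; module
    rw [this, norm_smul, Real.norm_of_nonneg ht0.le]
    gcongr
    have h1 := (norm_fst_le_of_mem h huC).2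
    have h2 := (norm_fst_le_of_mem h hzC).2
    simp only at h1 h2
    linarith [norm_sub_le u y₀]
  have hε' : M * (t * (2 * R)) ≤ ε := by
    have : t ≤ ε / (2 * M * R) := min_le_right _ _
    rw [le_div_iff₀ (by positivity)] at this
    linarith
  have h1 := le_abs_self (f (x, y) - f (x, y₀))
  have h2 := mul_le_mul_of_nonneg_left hyy hM.le
  have h3 := hopt w hw
  linarith

end Target

/-! ### Halving a finite grid by centerpoints -/

section Grid

variable {n d : ℕ} {R M ρ ε : ℝ}

/-- The points of `A` that lie in all the half-spaces `⟨a, w - z⟩ < 0` given by `𝒞`. -/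
noncomputable def aliveCount (A : Finset (MISpace n d)) (𝒞 : Set (MISpace n d × MISpace n d)) : ℕ := by
  classical exact (A.filter fun w => ∀ p ∈ 𝒞, miDot p.1 (w - p.2) < 0).card

/-- A centerpoint of the surviving points: the number of survivors plays the role of the volume. -/
theorem exists_center_aliveCount (A : Finset (MISpace n d)) (hA : ∀ z ∈ A, z ∈ miLattice n d)
    (𝒞 : Set (MISpace n d × MISpace n d)) : ∃ z ∈ miLattice n d, ∀ a,
      (aliveCount A (insert (a, z) 𝒞) : ℝ) ≤ (1 - (2 ^ n * (d + 1) : ℝ)⁻¹) * aliveCount A 𝒞 := by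
  classical
  obtain ⟨z, hz, h⟩ := exists_centerpoint (A.filter fun w => ∀ p ∈ 𝒞, miDot p.1 (w - p.2) < 0)
    fun z hz => hA z (Finset.mem_filter.1 hz).1
  refine ⟨z, hz, fun a => ?_⟩
  have h1 := h a
  rw [Finset.filter_filter] at h1
  have e1 : aliveCount A (insert (a, z) 𝒞) = (A.filter fun w =>
      (∀ p ∈ 𝒞, miDot p.1 (w - p.2) < 0) ∧ miDot a (w - z) < 0).card := by
    unfold aliveCount
    congr 1
    ext w
    simp [and_comm, and_left_comm]
  have e2 : aliveCount A 𝒞 = (A.filter fun w => ∀ p ∈ 𝒞, miDot p.1 (w - p.2) < 0).card := rfl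
  rw [← e1, ← e2] at h1
  have hpos : 0 < 2 ^ n * (d + 1) := by positivity
  have h2 : ((2 ^ n * (d + 1) : ℝ)) * aliveCount A (insert (a, z) 𝒞) ≤
      (2 ^ n * (d + 1) - 1) * aliveCount A 𝒞 := by
    have := (Nat.cast_le (α := ℝ)).2 h1
    rw [Nat.cast_mul, Nat.cast_mul _ (aliveCount A 𝒞), Nat.cast_sub hpos] at this
    exact_mod_cast this
  have hpos' : (0 : ℝ) < 2 ^ n * (d + 1) := by positivity
  rw [← mul_le_mul_iff_right₀ hpos']
  calc _ ≤ _ := h2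
    _ = _ := by field_simp

/-- The halving strategy on a finite set of points that meets the targets of all instances. -/
theorem miInfoComp_le_of_finset (hε : 0 ≤ ε) (A : Finset (MISpace n d))
    (hA : ∀ z ∈ A, z ∈ miLattice n d)
    (htarget : ∀ I : MIInstance n d R M ρ, ∃ w ∈ A, w ∈ I.C ∧
      ∀ w' ∈ I.C ∩ miLattice n d, I.f w ≤ I.f w' + ε) {m : ℕ}
    (hm : (2 ^ n * (d + 1)) * Real.log A.card < m) : miInfoComp ε n d R M ρ ≤ (2 * m : ℕ) := by
  classical
  choose cen hcen hcen' using exists_center_aliveCount A hA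
  have hh : (1 : ℝ) ≤ 2 ^ n * (d + 1) := by
    exact_mod_cast Nat.one_le_iff_ne_zero.2 (by positivity)
  have hγ : 0 ≤ 1 - (2 ^ n * (d + 1) : ℝ)⁻¹ := sub_nonneg.2 (inv_le_one_of_one_le₀ hh)
  -- The target is a single point of `A`, so the threshold is one survivor. It is passed because `(1
  -- - 1/h)^m ≤ exp (-m/h)` for `h = 2ⁿ (d + 1)`.
  refine miInfoComp_le_of_potential hε cen (fun 𝒞 => aliveCount A 𝒞) (φ₀ := 1) hγ hcen
    (fun 𝒞 _ _ a _ => hcen' 𝒞 a) (fun I => ?_) ?_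
  · obtain ⟨w, hwA, hwC, hw⟩ := htarget I
    refine ⟨{w}, by simpa using hwC, by simpa using hw, fun 𝒞 _ h => ?_⟩
    have : 0 < aliveCount A 𝒞 :=
      Finset.card_pos.2 ⟨w, Finset.mem_filter.2 ⟨hwA, fun p hp => h w rfl p hp⟩⟩
    exact_mod_cast this
  · have h0 : aliveCount A ∅ = A.card := by simp [aliveCount]
    rw [h0]
    rcases A.eq_empty_or_nonempty with rfl | hne
    · simp
    have hc : (0 : ℝ) < A.card := by exact_mod_cast hne.card_pos
    have hle : (1 - (2 ^ n * (d + 1) : ℝ)⁻¹) ^ m ≤ Real.exp (-(m / (2 ^ n * (d + 1)))) := by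
      calc (1 - (2 ^ n * (d + 1) : ℝ)⁻¹) ^ m ≤ Real.exp (-(2 ^ n * (d + 1) : ℝ)⁻¹) ^ m :=
            pow_le_pow_left₀ hγ (by
              have := Real.add_one_le_exp (-(2 ^ n * (d + 1) : ℝ)⁻¹); linarith) m
        _ = _ := by rw [← Real.exp_nat_mul]; congr 1; ring
    calc _ ≤ Real.exp (-(m / (2 ^ n * (d + 1)))) * A.card := by gcongr
      _ = Real.exp (Real.log A.card - m / (2 ^ n * (d + 1))) := by
        rw [sub_eq_add_neg, Real.exp_add, Real.exp_log hc, mul_comm]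
      _ < 1 := by
        rw [Real.exp_lt_one_iff, sub_neg, lt_div_iff₀ (by positivity)]
        linarith

/-- The grid of the lattice points of norm at most `R` with the real coordinates
`-R, -R + 2r, -R + 4r, …`. -/
noncomputable def gridPoints (n d : ℕ) (R r : ℝ) : Finset (MISpace n d) :=
  ((Fintype.piFinset fun _ : Fin n => Finset.Icc (-⌊R⌋) ⌊R⌋) ×ˢ
    (Fintype.piFinset fun _ : Fin d => Finset.range (⌊R / r⌋₊ + 1))).image
      fun p => (intVec p.1, fun i => -R + 2 * r * (p.2 i : ℝ))

theorem mem_miLattice_of_mem_gridPoints {r : ℝ} {z : MISpace n d} (hz : z ∈ gridPoints n d R r) :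
    z ∈ miLattice n d := by
  obtain ⟨p, -, rfl⟩ := Finset.mem_image.1 hz
  exact mem_miLattice_iff.2 ⟨p.1, rfl⟩

theorem card_gridPoints_le (hR : 0 ≤ R) {r : ℝ} (hr : 0 < r) :
    ((gridPoints n d R r).card : ℝ) ≤ (2 * R + 1) ^ n * (R / r + 1) ^ d := by
  classical
  have h1 : (gridPoints n d R r).card ≤ (2 * ⌊R⌋ + 1).toNat ^ n * (⌊R / r⌋₊ + 1) ^ d := by
    refine Finset.card_image_le.trans ?_
    rw [Finset.card_product, Fintype.card_piFinset, Fintype.card_piFinset]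
    simp only [Int.card_Icc, Finset.card_range, Finset.prod_const, Finset.card_univ, Fintype.card_fin]
    refine Nat.mul_le_mul_right _ (Nat.pow_le_pow_left (le_of_eq ?_) _)
    congr 1; ring
  have hf : 0 ≤ ⌊R⌋ := Int.floor_nonneg.2 hR
  have h2 : (((2 * ⌊R⌋ + 1).toNat : ℕ) : ℝ) ≤ 2 * R + 1 := by
    have h3 : (((2 * ⌊R⌋ + 1).toNat : ℕ) : ℝ) = 2 * (⌊R⌋ : ℝ) + 1 := by
      have : (((2 * ⌊R⌋ + 1).toNat : ℕ) : ℤ) = 2 * ⌊R⌋ + 1 := Int.toNat_of_nonneg (by omega)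
      exact_mod_cast congrArg (Int.cast : ℤ → ℝ) this
    rw [h3]
    linarith [Int.floor_le R]
  calc ((gridPoints n d R r).card : ℝ) ≤
      (((2 * ⌊R⌋ + 1).toNat ^ n * (⌊R / r⌋₊ + 1) ^ d : ℕ) : ℝ) := by exact_mod_cast h1
    _ = (((2 * ⌊R⌋ + 1).toNat : ℕ) : ℝ) ^ n * ((⌊R / r⌋₊ : ℝ) + 1) ^ d := by push_cast; ring
    _ ≤ _ := by
      gcongr
      exact Nat.floor_le (by positivity)

/-- The spacing `2r` leaves every point within `r` of the grid. As the whole `r`-ball lies in the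
box, the coordinates of `z` are between `-R + r` and `R - r`, which keeps the indices in the range
of the grid. -/
theorem exists_grid_point_near {r : ℝ} (hr : 0 < r) {z : MISpace n d} (hz : z ∈ miLattice n d)
    (hz1 : ‖z.1‖ ≤ R) (hz2 : ∀ y, ‖y - z.2‖ ≤ r → ‖y‖ ≤ R) :
    ∃ w ∈ gridPoints n d R r, w.1 = z.1 ∧ ‖w.2 - z.2‖ ≤ r := by
  classical
  obtain ⟨p, hp⟩ := mem_miLattice_iff.1 hz
  have hR : 0 ≤ R := (norm_nonneg _).trans hz1
  have hb : ∀ i, -R + r ≤ z.2 i ∧ z.2 i ≤ R - r := by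
    intro i
    have h1 := hz2 (z.2 + Pi.single i r) (by simp [Pi.norm_single, abs_of_pos hr])
    have h2 := hz2 (z.2 - Pi.single i r) (by simp [Pi.norm_single, abs_of_pos hr])
    have h3 := (norm_le_pi_norm _ i).trans h1
    have h4 := (norm_le_pi_norm _ i).trans h2
    simp only [Pi.add_apply, Pi.sub_apply, Pi.single_eq_same, Real.norm_eq_abs, abs_le] at h3 h4
    constructor <;> linarith
  set j : Fin d → ℕ := fun i => ⌈(z.2 i - r + R) / (2 * r)⌉₊ with hj
  have hj1 : ∀ i, (z.2 i - r + R) / (2 * r) ≤ j i := fun i => Nat.le_ceil _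
  have hj0 : ∀ i, 0 ≤ (z.2 i - r + R) / (2 * r) := fun i =>
    div_nonneg (by linarith [(hb i).1]) (by positivity)
  have hj2 : ∀ i, (j i : ℝ) < (z.2 i - r + R) / (2 * r) + 1 := fun i => Nat.ceil_lt_add_one (hj0 i)
  have hj3 : ∀ i, (j i : ℝ) * (2 * r) < z.2 i + r + R := fun i => by
    have := mul_lt_mul_of_pos_right (hj2 i) (by positivity : 0 < 2 * r)
    rw [add_mul, div_mul_cancel₀ _ (by positivity)] at this
    linarith
  have hj4 : ∀ i, z.2 i - r + R ≤ (j i : ℝ) * (2 * r) := fun i => by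
    rw [← div_le_iff₀ (by positivity)]; exact hj1 i
  refine ⟨(intVec p, fun i => -R + 2 * r * (j i : ℝ)), Finset.mem_image.2 ⟨(p, j), ?_, rfl⟩,
    hp.symm, ?_⟩
  · rw [Finset.mem_product, Fintype.mem_piFinset, Fintype.mem_piFinset]
    refine ⟨fun i => ?_, fun i => ?_⟩
    · have := (norm_le_pi_norm z.1 i).trans hz1
      rw [hp, Real.norm_eq_abs, abs_le] at this
      simp only [intVec] at this
      rw [Finset.mem_Icc]
      exact ⟨neg_le.1 (Int.le_floor.2 (by push_cast; linarith)), Int.le_floor.2 this.2⟩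
    · rw [Finset.mem_range, Nat.lt_succ_iff]
      refine Nat.le_floor ?_
      rw [le_div_iff₀ hr]
      nlinarith [hj3 i, (hb i).2]
  · rw [pi_norm_le_iff_of_nonneg hr.le]
    intro i
    simp only [Pi.sub_apply, Real.norm_eq_abs, abs_le]
    constructor <;> nlinarith [hj3 i, hj4 i]

end Grid

/-! ### The inscribed-ellipsoid method for `n = 0` -/

section InscribedEllipsoidMethod

open Matrix

variable {d : ℕ} {R M ρ ε : ℝ}

/-- Hadamard's inequality. -/
theorem abs_det_le_prod_euclNorm (B : Matrix (Fin d) (Fin d) ℝ) :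
    |B.det| ≤ ∏ i, euclNorm (B i) := by
  let b := EuclideanSpace.basisFun (Fin d) ℝ
  have : Fact (Module.finrank ℝ (EuclideanSpace ℝ (Fin d)) = d) := ⟨by simp⟩
  have h := b.toBasis.orientation.abs_volumeForm_apply_le fun i => WithLp.toLp 2 (B i)
  rw [Orientation.volumeForm_robust _ b rfl, Module.Basis.det_apply] at h
  have hB : b.toBasis.toMatrix (fun i => WithLp.toLp 2 (B i)) = Bᵀ := by
    ext i j
    simp [b, Module.Basis.toMatrix_apply]
  rw [hB, det_transpose] at h
  simpa [euclNorm_eq] using h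

/-- The constraints `‖x‖_∞ ≤ R`. -/
def boxConstraints (d : ℕ) (R : ℝ) : Set ((Fin d → ℝ) × ℝ) :=
  Set.range (fun i => (Pi.single i 1, R)) ∪ Set.range fun i => (Pi.single i (-1), R)

theorem boxConstraints_finite : (boxConstraints d R).Finite :=
  (Set.finite_range _).union (Set.finite_range _)

/-- The constraint with normal `±eᵢ` reads `±cᵢ + |row i of B| ≤ R`. This gives compactness and,
with Hadamard's inequality, the initial volume bound. -/
theorem row_bounds_of_mem {𝓗 : Set ((Fin d → ℝ) × ℝ)} (h𝓗 : boxConstraints d R ⊆ 𝓗)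
    {p : (Fin d → ℝ) × Matrix (Fin d) (Fin d) ℝ} (hp : p ∈ inscribedEllipsoids 𝓗) (i : Fin d) :
    |p.1 i| ≤ R ∧ euclNorm (p.2 i) ≤ R := by
  have h1 := hp _ (h𝓗 (Or.inl ⟨i, rfl⟩))
  have h2 := hp _ (h𝓗 (Or.inr ⟨i, rfl⟩))
  have e1 : p.2ᵀ *ᵥ Pi.single i 1 = p.2 i := by ext j; simp
  have e2 : p.2ᵀ *ᵥ Pi.single i (-1) = -p.2 i := by ext j; simp
  have e3 : euclNorm (-p.2 i) = euclNorm (p.2 i) := by simp [euclNorm]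
  simp only [e1, e2, e3, single_dotProduct] at h1 h2
  have := euclNorm_nonneg (p.2 i)
  rw [abs_le]
  refine ⟨⟨?_, ?_⟩, ?_⟩ <;> linarith

theorem isCompact_inscribedEllipsoids {𝓗 : Set ((Fin d → ℝ) × ℝ)} (h𝓗 : boxConstraints d R ⊆ 𝓗) :
    IsCompact (inscribedEllipsoids 𝓗) := by
  have hclosed : IsClosed (inscribedEllipsoids 𝓗) := by
    have : inscribedEllipsoids 𝓗 = ⋂ h ∈ 𝓗, {p : (Fin d → ℝ) × Matrix (Fin d) (Fin d) ℝ |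
        h.1 ⬝ᵥ p.1 + euclNorm (p.2ᵀ *ᵥ h.1) ≤ h.2} := by
      ext p; simp [inscribedEllipsoids]
    rw [this]
    refine isClosed_biInter fun h _ => isClosed_le ?_ continuous_const
    refine Continuous.add ?_ (continuous_euclNorm.comp ?_)
    · unfold dotProduct; fun_prop
    · exact (continuous_snd.matrix_transpose).matrix_mulVec continuous_const
  have hK : IsCompact ((Set.univ.pi fun _ : Fin d => Set.Icc (-R) R) ×ˢ
      (Set.univ.pi fun _ : Fin d => Set.univ.pi fun _ : Fin d => Set.Icc (-R) R)) :=
    (isCompact_univ_pi fun _ => isCompact_Icc).prod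
      (isCompact_univ_pi fun _ => isCompact_univ_pi fun _ => isCompact_Icc)
  refine IsCompact.of_isClosed_subset hK hclosed fun p hp => ?_
  refine Set.mem_prod.2 ⟨fun i _ => abs_le.1 (row_bounds_of_mem h𝓗 hp i).1, fun i _ j _ => ?_⟩
  exact abs_le.1 ((abs_apply_le_euclNorm (p.2 i) j).trans (row_bounds_of_mem h𝓗 hp i).2)

/-- The constraints given by the box and the cuts `𝒞`. -/
def cutConstraints (R : ℝ) (𝒞 : Set (MISpace 0 d × MISpace 0 d)) : Set ((Fin d → ℝ) × ℝ) :=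
  boxConstraints d R ∪ (fun p => (p.1.2, p.1.2 ⬝ᵥ p.2.2)) '' 𝒞

/-- The largest value of `|det B|` over the ellipsoids `c + B u` that satisfy the constraints. -/
noncomputable def maxDet (R : ℝ) (𝒞 : Set (MISpace 0 d × MISpace 0 d)) : ℝ :=
  sSup ((fun p => |p.2.det|) '' inscribedEllipsoids (cutConstraints R 𝒞))

theorem exists_isMaxDet {𝒞 : Set (MISpace 0 d × MISpace 0 d)}
    (h : (inscribedEllipsoids (cutConstraints R 𝒞)).Nonempty) :
    ∃ p ∈ inscribedEllipsoids (cutConstraints R 𝒞),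
      (∀ q ∈ inscribedEllipsoids (cutConstraints R 𝒞), |q.2.det| ≤ |p.2.det|) ∧
      |p.2.det| = maxDet R 𝒞 := by
  have hc : Continuous fun p : (Fin d → ℝ) × Matrix (Fin d) (Fin d) ℝ => |p.2.det| :=
    continuous_snd.matrix_det.abs
  obtain ⟨p, hp, hmax⟩ := (isCompact_inscribedEllipsoids (R := R)
    (Set.subset_union_left (t := (fun p : MISpace 0 d × MISpace 0 d =>
      (p.1.2, p.1.2 ⬝ᵥ p.2.2)) '' 𝒞))).exists_isMaxOn h hc.continuousOn
  refine ⟨p, hp, fun q hq => hmax hq, ?_⟩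
  symm
  refine IsGreatest.csSup_eq (a := |p.2.det|) ⟨⟨p, hp, rfl⟩, ?_⟩
  rintro _ ⟨q, hq, rfl⟩
  exact hmax hq

/-- The centre of a largest ellipsoid: an ellipsoid that survives the new cut is inscribed for the
old constraints and lies behind a hyperplane through that centre. If no ellipsoid is inscribed,
`maxDet` is `sSup ∅ = 0` and the positivity hypothesis fails. -/
theorem exists_center_maxDet (𝒞 : Set (MISpace 0 d × MISpace 0 d)) : ∃ z : MISpace 0 d,
    𝒞.Finite → 0 < maxDet R 𝒞 → ∀ a, a ≠ 0 →
      maxDet R (insert (a, z) 𝒞) ≤ Real.exp (-(1 / 100)) * maxDet R 𝒞 := by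
  rcases (inscribedEllipsoids (cutConstraints R 𝒞)).eq_empty_or_nonempty with h | h
  · exact ⟨0, fun _ h0 => by simp [maxDet, h] at h0⟩
  obtain ⟨⟨c₀, B₀⟩, hp, hmax, heq⟩ := exists_isMaxDet h
  refine ⟨(0, c₀), fun hfin hpos a ha => ?_⟩
  rw [← heq] at hpos ⊢
  refine Real.sSup_le ?_ (by positivity)
  rintro _ ⟨⟨c₁, B₁⟩, hq, rfl⟩
  refine abs_det_le_of_cut (a := a.2) (c₁ := c₁) (boxConstraints_finite.union (hfin.image _)) hp
    (abs_pos.1 hpos) hmax ?_ ?_ ?_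
  · intro h hh
    refine hq h ?_
    rcases hh with hh | ⟨p, hp, rfl⟩
    · exact Or.inl hh
    · exact Or.inr ⟨p, Set.mem_insert_of_mem _ hp, rfl⟩
  · intro h0
    exact ha (Prod.ext (Subsingleton.elim _ _) h0)
  · exact hq (a.2, a.2 ⬝ᵥ c₀) (Or.inr ⟨(a, (0, c₀)), Set.mem_insert _ _, rfl⟩)

theorem maxDet_empty_le (hR : 0 ≤ R) : maxDet (d := d) R ∅ ≤ R ^ d := by
  refine Real.sSup_le ?_ (by positivity)
  rintro _ ⟨p, hp, rfl⟩
  refine (abs_det_le_prod_euclNorm p.2).trans ?_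
  calc ∏ i, euclNorm (p.2 i) ≤ ∏ _i : Fin d, R :=
        Finset.prod_le_prod (fun i _ => euclNorm_nonneg _) fun i _ =>
          (row_bounds_of_mem (R := R) Set.subset_union_left hp i).2
    _ = R ^ d := by simp

/-- A ball of the sup norm contains the Euclidean ball of the same radius, an ellipsoid with matrix
`r • 1` and determinant `r ^ d`. A linear constraint needs to be tested only at its extreme point `c
+ (r / |a|) a`. -/
theorem le_maxDet_of_ball {r : ℝ} (hr : 0 < r) {c : Fin d → ℝ}
    (hbox : ∀ y, ‖y - c‖ ≤ r → ‖y‖ ≤ R) {𝒞 : Set (MISpace 0 d × MISpace 0 d)}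
    (h𝒞 : ∀ y, ‖y - c‖ ≤ r → ∀ p ∈ 𝒞, p.1.2 ⬝ᵥ y ≤ p.1.2 ⬝ᵥ p.2.2) : r ^ d ≤ maxDet R 𝒞 := by
  have hin : (c, r • (1 : Matrix (Fin d) (Fin d) ℝ)) ∈ inscribedEllipsoids (cutConstraints R 𝒞) := by
    have key : ∀ (a : Fin d → ℝ) (b : ℝ), (∀ y, ‖y - c‖ ≤ r → a ⬝ᵥ y ≤ b) →
        a ⬝ᵥ c + euclNorm ((r • (1 : Matrix (Fin d) (Fin d) ℝ))ᵀ *ᵥ a) ≤ b := by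
      intro a b hab
      rw [transpose_smul, transpose_one, smul_mulVec, one_mulVec, euclNorm_smul hr.le]
      rcases eq_or_ne a 0 with rfl | ha
      · simpa using hab c (by simpa using hr.le)
      have h0 := euclNorm_pos ha
      have h1 := hab (c + (r / euclNorm a) • a) (by
        rw [add_sub_cancel_left, norm_smul, Real.norm_of_nonneg (by positivity),
          div_mul_eq_mul_div, div_le_iff₀ h0]
        exact mul_le_mul_of_nonneg_left ((pi_norm_le_iff_of_nonneg h0.le).2 fun i =>
          abs_apply_le_euclNorm a i) hr.le)
      rw [dotProduct_add, dotProduct_smul, ← euclNorm_sq, smul_eq_mul] at h1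
      have : r / euclNorm a * euclNorm a ^ 2 = r * euclNorm a := by field_simp
      linarith
    rintro h ((⟨i, rfl⟩ | ⟨i, rfl⟩) | ⟨p, hp, rfl⟩)
    · refine key _ _ fun y hy => ?_
      have := (norm_le_pi_norm y i).trans (hbox y hy)
      simpa using (abs_le.1 this).2
    · refine key _ _ fun y hy => ?_
      have := (norm_le_pi_norm y i).trans (hbox y hy)
      simpa using neg_le.1 (abs_le.1 this).1
    · exact key _ _ fun y hy => h𝒞 y hy p hp
  obtain ⟨p, -, hmax, heq⟩ := exists_isMaxDet ⟨_, hin⟩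
  rw [← heq]
  refine le_trans ?_ (hmax _ hin)
  simp [abs_of_pos hr]

/-- The inscribed-ellipsoid method. -/
theorem miInfoComp_zero_le (hM : 0 < M) (hR : 0 < R) (hε : 0 < ε) (hρ : 0 < ρ) {m : ℕ}
    (hm : 100 * (d * Real.log (R / (ρ * min 1 (ε / (2 * M * R))))) < m) :
    miInfoComp ε 0 d R M ρ ≤ (2 * m : ℕ) := by
  set r := ρ * min 1 (ε / (2 * M * R)) with hr
  have hr0 : 0 < r := mul_pos hρ (lt_min one_pos (by positivity))
  choose cen hcen using exists_center_maxDet (d := d) (R := R)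
  refine miInfoComp_le_of_potential hε.le cen (maxDet R) (φ₀ := r ^ d) (Real.exp_pos _).le
    (fun _ i => i.elim0) (fun 𝒞 hfin h a ha => hcen 𝒞 hfin (lt_of_lt_of_le (by positivity) h) a ha)
    (fun I => ?_) ?_
  · obtain ⟨z, -, hz⟩ := I.mem.exists_good_ball hM hR hε
    refine ⟨{w | ∃ y, ‖y - z.2‖ ≤ r ∧ w = (z.1, y)}, ?_, ?_, fun 𝒞 _ h => ?_⟩
    · rintro _ ⟨y, hy, rfl⟩; exact (hz y hy).1
    · rintro _ ⟨y, hy, rfl⟩; exact (hz y hy).2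
    · refine le_maxDet_of_ball hr0 (c := z.2)
        (fun y hy => (norm_fst_le_of_mem I.mem (hz y hy).1).2) fun y hy p hp => ?_
      have := h _ ⟨y, hy, rfl⟩ p hp
      rw [miDot_sub] at this
      simp only [miDot, dotProduct_of_isEmpty] at this
      linarith
  · have h1 : Real.exp (-(1 / 100)) ^ m * maxDet (d := d) R ∅ ≤ Real.exp (-(1 / 100)) ^ m * R ^ d := by
      have := maxDet_empty_le (d := d) hR.le
      gcongr
    refine h1.trans_lt ?_
    rw [← Real.exp_nat_mul, ← Real.exp_log (pow_pos hR d), ← Real.exp_log (pow_pos hr0 d),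
      ← Real.exp_add, Real.exp_lt_exp, Real.log_pow, Real.log_pow]
    rw [Real.log_div hR.ne' hr0.ne'] at hm
    linarith

end InscribedEllipsoidMethod

/-! ### The three upper bounds -/

section UpperBounds

variable {n d : ℕ} {R M ρ ε : ℝ}

/-- Used with `m = ⌊B⌋ + 1`. The additive `2` is later absorbed into the constants, since the main
terms are at least `1/2` by `half_le_log`. -/
theorem toENNReal_le_of_forall_lt {N : ℕ∞} {B : ℝ} (hB : 0 ≤ B)
    (h : ∀ m : ℕ, B < m → N ≤ (2 * m : ℕ)) : (N : ℝ≥0∞) ≤ ENNReal.ofReal (2 * B + 2) := by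
  have h1 := h (⌊B⌋₊ + 1) (by exact_mod_cast Nat.lt_floor_add_one B)
  calc (N : ℝ≥0∞) ≤ (((2 * (⌊B⌋₊ + 1) : ℕ) : ℕ∞) : ℝ≥0∞) := ENat.toENNReal_le.2 h1
    _ = ENNReal.ofReal ((2 * (⌊B⌋₊ + 1) : ℕ) : ℝ) := by
      rw [ENNReal.ofReal_natCast, ENat.toENNReal_coe]
    _ ≤ _ := ENNReal.ofReal_le_ofReal (by
      push_cast
      linarith [Nat.floor_le hB])

theorem log_natCast_le {k : ℕ} {B : ℝ} (h : (k : ℝ) ≤ B) (hB : 1 ≤ B) : Real.log k ≤ Real.log B := by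
  rcases Nat.eq_zero_or_pos k with rfl | hk
  · simpa using Real.log_nonneg hB
  · exact Real.log_le_log (by exact_mod_cast hk) h

theorem half_le_log {x : ℝ} (hx : 2 ≤ x) : 1 / 2 ≤ Real.log x := by
  have h1 := Real.log_le_log two_pos hx
  have := Real.log_two_gt_d9
  linarith

/-- With `X = MR/(ρε)`, the assumptions `ε ≤ M` and `ρ ≤ 1` give `R ≤ R/ρ ≤ X`. The ratio of `R` to
the target radius is `R/ρ` or `2RX`, depending on the minimum. -/
theorem div_radius_le (hR : 0 < R) (hρ : 0 < ρ) (hρ1 : ρ ≤ 1) (hε : 0 < ε) (hεM : ε ≤ M)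
    (hX : 2 ≤ M * R / (ρ * ε)) :
    R ≤ M * R / (ρ * ε) ∧
      R / (ρ * min 1 (ε / (2 * M * R))) ≤ 2 * (M * R / (ρ * ε)) ^ 2 := by
  have hM : 0 < M := hε.trans_le hεM
  set X := M * R / (ρ * ε) with hXdef
  have hXρ : R / ρ ≤ X := by
    rw [hXdef, div_le_div_iff₀ hρ (by positivity)]
    nlinarith [mul_pos hR hρ]
  have hRX : R ≤ X := le_trans ((le_div_iff₀ hρ).2 (by nlinarith)) hXρ
  refine ⟨hRX, ?_⟩
  rw [div_le_iff₀ (mul_pos hρ (lt_min one_pos (by positivity)))]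
  rcases min_cases 1 (ε / (2 * M * R)) with ⟨h, -⟩ | ⟨h, -⟩ <;> rw [h]
  · rw [div_le_iff₀ hρ] at hXρ
    have : X ≤ 2 * X ^ 2 := by nlinarith
    nlinarith
  · have : 2 * X ^ 2 * (ρ * (ε / (2 * M * R))) = X := by
      rw [hXdef]; field_simp
    rw [this]
    exact hRX

theorem miInfoComp_le_of_pos (hd : 1 ≤ d) (hR : 0 < R) (hρ : 0 < ρ) (hρ1 : ρ ≤ 1) (hε : 0 < ε)
    (hεM : ε ≤ M) (hX : 2 ≤ M * R / (ρ * ε)) : (miInfoComp ε n d R M ρ : ℝ≥0∞) ≤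
      ENNReal.ofReal (20 * ((n + d) * d * 2 ^ n * Real.log (M * R / (ρ * ε)))) := by
  obtain ⟨hRX, hrX⟩ := div_radius_le hR hρ hρ1 hε hεM hX
  have hM : 0 < M := hε.trans_le hεM
  set X := M * R / (ρ * ε) with hXdef
  set r := ρ * min 1 (ε / (2 * M * R)) with hr
  have hr0 : 0 < r := mul_pos hρ (lt_min one_pos (by positivity))
  have hlogX := half_le_log hX
  have hd' : (1 : ℝ) ≤ d := by exact_mod_cast hd
  have hn' : (0 : ℝ) ≤ n := Nat.cast_nonneg n
  have h2n : (1 : ℝ) ≤ 2 ^ n := one_le_pow₀ one_le_two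
  have hlog : Real.log (gridPoints n d R r).card ≤ 4 * (n + d) * Real.log X := by
    -- For `X ≥ 2` both `2R + 1 ≤ 2X + 1` and `R/r + 1 ≤ 2X² + 1` are at most `X⁴`.
    have hcard : ((gridPoints n d R r).card : ℝ) ≤ (X ^ 4) ^ n * (X ^ 4) ^ d := by
      refine (card_gridPoints_le hR.le hr0).trans ?_
      have h4 : 4 * X ^ 2 ≤ X ^ 4 := by nlinarith [sq_nonneg X, mul_self_nonneg (X ^ 2 - 4)]
      gcongr
      · nlinarith
      · nlinarith
    have h1 : (1 : ℝ) ≤ (X ^ 4) ^ n * (X ^ 4) ^ d := by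
      have : (1 : ℝ) ≤ X := by linarith
      exact one_le_mul_of_one_le_of_one_le (one_le_pow₀ (one_le_pow₀ this))
        (one_le_pow₀ (one_le_pow₀ this))
    refine (log_natCast_le hcard h1).trans (le_of_eq ?_)
    rw [← pow_add, Real.log_pow, Real.log_pow]
    push_cast; ring
  set B : ℝ := (2 ^ n * (d + 1)) * (4 * (n + d) * Real.log X) with hB
  have hB0 : 0 ≤ B := by positivity
  refine (toENNReal_le_of_forall_lt hB0 fun m hm => ?_).trans (ENNReal.ofReal_le_ofReal ?_)
  · refine miInfoComp_le_of_finset hε.le (gridPoints n d R r)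
      (fun z hz => mem_miLattice_of_mem_gridPoints hz) (fun I => ?_)
      (lt_of_le_of_lt (mul_le_mul_of_nonneg_left hlog (by positivity)) hm)
    obtain ⟨z, hz, hzr⟩ := I.mem.exists_good_ball hM hR hε
    obtain ⟨w, hw, hw1, hw2⟩ := exists_grid_point_near hr0 hz
      (norm_fst_le_of_mem I.mem (hzr z.2 (by simpa using hr0.le)).1).1
      (fun y hy => (norm_fst_le_of_mem I.mem (hzr y hy).1).2)
    have := hzr w.2 hw2
    rw [← hw1] at this
    exact ⟨w, hw, this⟩
  · have hP : 1 / 2 ≤ (n + d) * d * 2 ^ n * Real.log X := by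
      have h1 : (1 : ℝ) ≤ (n + d) * d * 2 ^ n :=
        one_le_mul_of_one_le_of_one_le (one_le_mul_of_one_le_of_one_le (by linarith) hd') h2n
      nlinarith
    have hB2 : B ≤ 8 * ((n + d) * d * 2 ^ n * Real.log X) := by
      have : B = 4 * ((n + d) * 2 ^ n * Real.log X) * (d + 1) := by rw [hB]; ring
      rw [this]
      have h0 : 0 ≤ 4 * ((n + d) * 2 ^ n * Real.log X) := by positivity
      nlinarith [mul_le_mul_of_nonneg_left (by linarith : (d : ℝ) + 1 ≤ 2 * d) h0]
    linarith

theorem miInfoComp_int_le (hn : 1 ≤ n) (hR : 2 ≤ R) (hε : 0 ≤ ε) :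
    (miInfoComp ε n 0 R M ρ : ℝ≥0∞) ≤ ENNReal.ofReal (20 * (n * 2 ^ n * Real.log R)) := by
  have hlogR := half_le_log hR
  have hn' : (1 : ℝ) ≤ n := by exact_mod_cast hn
  have h2n : (1 : ℝ) ≤ 2 ^ n := one_le_pow₀ one_le_two
  have hlog : Real.log (gridPoints n 0 R 1).card ≤ 3 * n * Real.log R := by
    have hcard : ((gridPoints n 0 R 1).card : ℝ) ≤ (R ^ 3) ^ n := by
      refine (card_gridPoints_le (by linarith) one_pos).trans ?_
      rw [pow_zero, mul_one]
      gcongr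
      nlinarith [sq_nonneg R, mul_self_nonneg (R ^ 2 - 4)]
    refine (log_natCast_le hcard (one_le_pow₀ (one_le_pow₀ (by linarith)))).trans (le_of_eq ?_)
    rw [Real.log_pow, Real.log_pow]
    push_cast; ring
  set B : ℝ := 2 ^ n * (3 * n * Real.log R) with hB
  have hB0 : 0 ≤ B := by positivity
  refine (toENNReal_le_of_forall_lt hB0 fun m hm => ?_).trans (ENNReal.ofReal_le_ofReal ?_)
  · refine miInfoComp_le_of_finset hε (gridPoints n 0 R 1)
      (fun z hz => mem_miLattice_of_mem_gridPoints hz) (fun I => ?_) ?_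
    · obtain ⟨z, ⟨hzC, hzL⟩, hopt⟩ := I.mem.exists_optimal
      obtain ⟨w, hw, hw1, -⟩ := exists_grid_point_near one_pos hzL
        (norm_fst_le_of_mem I.mem hzC).1
        (fun y _ => by rw [Subsingleton.elim y 0, norm_zero]; linarith)
      obtain rfl : w = z := Prod.ext hw1 (Subsingleton.elim _ _)
      exact ⟨w, hw, hzC, fun w' hw' => by linarith [hopt w' hw']⟩
    · refine lt_of_le_of_lt ?_ hm
      simp only [Nat.cast_zero, zero_add, mul_one]
      exact mul_le_mul_of_nonneg_left hlog (by positivity)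
  · have hP : 1 / 2 ≤ n * 2 ^ n * Real.log R := by
      have h1 : (1 : ℝ) ≤ n * 2 ^ n := one_le_mul_of_one_le_of_one_le hn' h2n
      nlinarith
    have : B = 3 * (n * 2 ^ n * Real.log R) := by rw [hB]; ring
    linarith

theorem miInfoComp_convex_le (hd : 1 ≤ d) (hR : 0 < R) (hρ : 0 < ρ) (hρ1 : ρ ≤ 1) (hε : 0 < ε)
    (hεM : ε ≤ M) (hX : 2 ≤ M * R / (ρ * ε)) : (miInfoComp ε 0 d R M ρ : ℝ≥0∞) ≤
      ENNReal.ofReal (1000 * (d * Real.log (M * R / (ρ * ε)))) := by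
  obtain ⟨hRX, hrX⟩ := div_radius_le hR hρ hρ1 hε hεM hX
  have hM : 0 < M := hε.trans_le hεM
  set X := M * R / (ρ * ε) with hXdef
  have hr0 : 0 < ρ * min 1 (ε / (2 * M * R)) := mul_pos hρ (lt_min one_pos (by positivity))
  have hlogX := half_le_log hX
  have hd' : (1 : ℝ) ≤ d := by exact_mod_cast hd
  have hlog : Real.log (R / (ρ * min 1 (ε / (2 * M * R)))) ≤ 3 * Real.log X := by
    have h1 : 2 * X ^ 2 ≤ X ^ 3 := by nlinarith [sq_nonneg X]
    have := Real.log_le_log (by positivity) (hrX.trans h1)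
    rwa [Real.log_pow] at this
  have hB0 : 0 ≤ 100 * (d * (3 * Real.log X)) := by positivity
  refine (toENNReal_le_of_forall_lt hB0 fun m hm => ?_).trans (ENNReal.ofReal_le_ofReal ?_)
  · refine miInfoComp_zero_le hM hR hε hρ (lt_of_le_of_lt ?_ hm)
    gcongr
  · have : 1 / 2 ≤ d * Real.log X := by nlinarith
    linarith

end UpperBounds

/-! ### The adversary over the vertices of a cube -/

section FeasibilityAdversary

variable {n d : ℕ} {R M ρ ε : ℝ} {J : Finset (Fin n)}

/-- The points whose coordinates in `J` form the vertex of the cube `{0, 1}^J` given by `v`. -/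
def cubeFiber (J v : Finset (Fin n)) : Set (MISpace n d) :=
  {z | ∀ i ∈ J, z.1 i = if i ∈ v then 1 else 0}

/-- The fiber `K` contains a lattice point, and around each of them it allows for the `ρ`-ball that
strict feasibility asks for. -/
def IsGoodFiber (ρ : ℝ) (K : Set (MISpace n d)) : Prop :=
  (K ∩ miLattice n d).Nonempty ∧
    ∀ z ∈ K ∩ miLattice n d, ∃ ŷ : Fin d → ℝ, ∀ y, ‖y - ŷ‖ ≤ ρ → (z.1, y) ∈ K

/-- The adversary can answer `j` queries in `K`, cutting off the query point each time and leaving a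
good fiber until the last time. -/
def HasDepth (ρ : ℝ) : ℕ → Set (MISpace n d) → Prop
  | 0, K => K = ∅
  | j + 1, K => IsGoodFiber ρ K ∧
      ∀ z ∈ K, ∃ a b, b < miDot a z ∧ HasDepth ρ j (K ∩ {w | miDot a w ≤ b})

/-- The distance in `ℓ¹` of the coordinates in `J` from the vertex `v`, for points of the cube. -/
def cubeDist (J v : Finset (Fin n)) (z : MISpace n d) : ℝ :=
  ∑ i ∈ J, if i ∈ v then 1 - z.1 i else z.1 i

theorem cubeDist_eq_zero_of_mem {v : Finset (Fin n)} {z : MISpace n d} (hz : z ∈ cubeFiber J v) :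
    cubeDist J v z = 0 := by
  refine Finset.sum_eq_zero fun i hi => ?_
  rw [hz i hi]; split_ifs <;> norm_num

theorem cubeDist_pos {v : Finset (Fin n)} {z : MISpace n d}
    (hcube : ∀ i ∈ J, 0 ≤ z.1 i ∧ z.1 i ≤ 1) (hz : z ∉ cubeFiber J v) : 0 < cubeDist J v z := by
  have h0 : ∀ i ∈ J, 0 ≤ if i ∈ v then 1 - z.1 i else z.1 i := fun i hi => by
    have := hcube i hi
    split_ifs <;> linarith
  refine (Finset.sum_nonneg h0).lt_of_ne fun h => hz fun i hi => ?_
  have := (Finset.sum_eq_zero_iff_of_nonneg h0).1 h.symm i hi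
  split_ifs at this ⊢ <;> linarith

theorem one_le_cubeDist {u v : Finset (Fin n)} (hu : u ⊆ J) (hv : v ⊆ J) (huv : u ≠ v)
    {z : MISpace n d} (hz : z ∈ cubeFiber J u) : 1 ≤ cubeDist J v z := by
  have h0 : ∀ i ∈ J, 0 ≤ if i ∈ v then 1 - z.1 i else z.1 i := fun i hi => by
    rw [hz i hi]; split_ifs <;> norm_num
  obtain ⟨i, hi, hne⟩ : ∃ i ∈ J, ¬ (i ∈ u ↔ i ∈ v) := by
    by_contra! h
    refine huv (Finset.ext fun i => ?_)
    by_cases hi : i ∈ J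
    · exact h i hi
    · exact ⟨fun h => absurd (hu h) hi, fun h => absurd (hv h) hi⟩
  refine le_trans ?_ (Finset.single_le_sum h0 hi)
  rw [hz i hi]
  by_cases h1 : i ∈ u <;> by_cases h2 : i ∈ v <;> simp [h1, h2] at hne ⊢

theorem exists_mem_cubeFiber {z : MISpace n d} (hz : z ∈ miLattice n d)
    (hcube : ∀ i ∈ J, 0 ≤ z.1 i ∧ z.1 i ≤ 1) : ∃ v ∈ J.powerset, z ∈ cubeFiber J v := by
  classical
  refine ⟨J.filter fun i => z.1 i = 1, by simp, fun i hi => ?_⟩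
  obtain ⟨m, hm⟩ := hz i
  have h := hcube i hi
  rw [hm] at h
  have h0 : 0 ≤ m := by exact_mod_cast h.1
  have h1 : m ≤ 1 := by exact_mod_cast h.2
  by_cases h2 : z.1 i = 1
  · simp [hi, h2]
  · have : m = 0 := by
      have : m ≠ 1 := fun h => h2 (by rw [hm, h]; simp)
      omega
    simp [hm, this]

/-- The slope of a half-space can be changed along the cube so that only the points near the vertex
`v` are cut. -/
theorem exists_tilt (J v : Finset (Fin n)) (hv : v ⊆ J) (a : MISpace n d) (b L : ℝ) :
    ∃ a' b', ∀ w, miDot a' w - b' = miDot a w - b - L * cubeDist J v w := by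
  classical
  let s : MISpace n d := (fun i => if i ∈ J then (if i ∈ v then -1 else 1) else 0, 0)
  have hs : ∀ w : MISpace n d, cubeDist J v w = v.card + miDot s w := by
    intro w
    have h1 : (v.card : ℝ) = ∑ i ∈ J, if i ∈ v then 1 else 0 := by
      rw [Finset.sum_ite_mem, Finset.inter_eq_right.2 hv]; simp
    have h2 : miDot s w = ∑ i ∈ J, (if i ∈ v then -1 else 1) * w.1 i := by
      simp [miDot, s, dotProduct, ite_mul, Finset.sum_ite_mem]
    rw [h1, h2, cubeDist, ← Finset.sum_add_distrib]
    refine Finset.sum_congr rfl fun i _ => ?_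
    split_ifs <;> ring
  refine ⟨a + (-L) • s, b + L * v.card, fun w => ?_⟩
  rw [miDot_add_left, miDot_smul_left, hs]
  ring

/-- The state of the adversary: the largest possible feasible region `C`, the points `P` that were
declared feasible, the recorded answers `rec`, and the depths `j` of the fibers. -/
structure IsAdversaryState (R ρ : ℝ) (J : Finset (Fin n)) (C P : Set (MISpace n d))
    (rec : MISpace n d → Option (Option (MISpace n d × ℝ))) (j : Finset (Fin n) → ℕ) : Prop where
  closed : IsClosed C
  convex : Convex ℝ C
  bounded : ∀ z ∈ C, ‖z‖ ≤ R
  cube : ∀ z ∈ C, ∀ i ∈ J, 0 ≤ z.1 i ∧ z.1 i ≤ 1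
  finite : P.Finite
  subset : P ⊆ C
  notMem : ∀ z ∈ P, ∀ v ∈ J.powerset, z ∉ cubeFiber J v
  depth : ∀ v ∈ J.powerset, HasDepth ρ (j v) (C ∩ cubeFiber J v)
  correct : ∀ z r, rec z = some r → ∀ C', P ⊆ C' → C' ⊆ C → (r = none ↔ z ∈ C') ∧
    ∀ a b, r = some (a, b) → (∀ w ∈ C', miDot a w ≤ b) ∧ b < miDot a z

/-- The instances that agree with the answers given so far. -/
def compatible (R M ρ : ℝ) (C P : Set (MISpace n d))
    (rec : MISpace n d → Option (Option (MISpace n d × ℝ))) : Set (MIInstance n d R M ρ) :=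
  {I | I.f = 0 ∧ I.subgrad = 0 ∧ P ⊆ I.C ∧ I.C ⊆ C ∧ ∀ z r, rec z = some r → I.sep z = r}

variable {C P : Set (MISpace n d)} {rec : MISpace n d → Option (Option (MISpace n d × ℝ))}
  {j : Finset (Fin n) → ℕ}

/-- With `f = 0` every feasible lattice point is optimal and lies over a vertex. Its fiber is
nonempty, hence of positive depth and good, which is the strict feasibility condition; exhausted
fibers are empty and impose nothing. -/
theorem IsAdversaryState.exists_instance (h : IsAdversaryState R ρ J C P rec j) (hM : 0 ≤ M)
    (hj : 0 < ∑ v ∈ J.powerset, j v) : ∃ I ∈ compatible R M ρ C P rec, I.C = C := by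
  obtain ⟨sep, hsep⟩ := exists_separationOracle h.convex h.closed
  have hgood : ∀ v ∈ J.powerset, (C ∩ cubeFiber J v).Nonempty → IsGoodFiber ρ (C ∩ cubeFiber J v) := by
    intro v hv hne
    have hd := h.depth v hv
    rcases hjv : j v with _ | k
    · rw [hjv] at hd; exact absurd hd hne.ne_empty
    · rw [hjv] at hd; exact hd.1
  have hmem : IsMIConvex n d R M ρ (0 : MISpace n d → ℝ) C :=
    { convex_f := convexOn_const 0 convex_univ
      closed_C := h.closed
      convex_C := h.convex
      feasible := by
        obtain ⟨v, hv, hjv⟩ : ∃ v ∈ J.powerset, 0 < j v := by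
          by_contra! h0
          have := Finset.sum_eq_zero fun v hv => Nat.le_zero.1 (h0 v hv)
          omega
        have hd := h.depth v hv
        obtain ⟨k, hk⟩ := Nat.exists_eq_succ_of_ne_zero hjv.ne'
        rw [hk] at hd
        obtain ⟨z, hz, hz'⟩ := hd.1.1
        exact ⟨z, hz.1, hz'⟩
      bounded := h.bounded
      lipschitz := fun x _ _ y y' _ _ => by simpa using mul_nonneg hM (norm_nonneg _)
      strictly_feasible := fun z hz => by
        obtain ⟨v, hv, hzv⟩ := exists_mem_cubeFiber hz.1.2 (h.cube z hz.1.1)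
        obtain ⟨ŷ, hŷ⟩ := (hgood v hv ⟨z, hz.1.1, hzv⟩).2 z ⟨⟨hz.1.1, hzv⟩, hz.1.2⟩
        exact ⟨ŷ, fun y hy => (hŷ y hy).1⟩ }
  refine ⟨⟨0, C, hmem, fun z => (rec z).getD (sep z), fun z => ?_, 0, fun z w => by simp⟩,
    ⟨rfl, rfl, h.subset, subset_rfl, fun z r hr => by simp [hr]⟩, rfl⟩
  rcases hz : rec z with _ | r
  · simpa only [hz, Option.getD_none] using hsep z
  · simpa only [hz, Option.getD_some] using h.correct z r hz C h.subset subset_rfl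

/-- The cut supplied by the depth of the fiber over `v` is tilted along the cube, so that only this
fiber loses depth, and by one. -/
theorem IsAdversaryState.exists_cut (h : IsAdversaryState R ρ J C P rec j) {z : MISpace n d}
    (hz : z ∈ C) {v : Finset (Fin n)} (hv : v ∈ J.powerset) (hzv : z ∈ cubeFiber J v) :
    ∃ a b j', b < miDot a z ∧ IsAdversaryState R ρ J (C ∩ {w | miDot a w ≤ b}) P rec j' ∧
      ∑ v ∈ J.powerset, j v = ∑ v ∈ J.powerset, j' v + 1 := by
  classical
  obtain ⟨k, hk⟩ : ∃ k, j v = k + 1 := by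
    refine Nat.exists_eq_succ_of_ne_zero fun h0 => ?_
    have hd := h.depth v hv
    rw [h0] at hd
    exact (Set.eq_empty_iff_forall_notMem.1 hd) z ⟨hz, hzv⟩
  have hd := h.depth v hv
  rw [hk] at hd
  obtain ⟨a, b, hab, hd'⟩ := hd.2 z ⟨hz, hzv⟩
  have hCc : IsCompact C := Metric.isCompact_of_isClosed_isBounded h.closed
    ((Metric.isBounded_closedBall (x := 0) (r := R)).subset fun z hz => by simpa using h.bounded z hz)
  obtain ⟨B, hB⟩ := hCc.bddAbove_image (f := miDot a) (continuous_miDot a).continuousOn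
  have hB' : ∀ w ∈ C, miDot a w ≤ B := fun w hw => hB ⟨w, hw, rfl⟩
  -- `L` must be steep enough to spare the finitely many points of `P`, each at positive distance
  -- from `v`, and the parts of `C` over the other vertices, at distance at least `1`.
  obtain ⟨L, hLP, hLB, hL0⟩ : ∃ L : ℝ, (∀ p ∈ P, miDot a p - b ≤ L * cubeDist J v p) ∧
      B - b ≤ L ∧ 0 ≤ L := by
    have h1 : ∀ᶠ L : ℝ in Filter.atTop, ∀ p ∈ P, miDot a p - b ≤ L * cubeDist J v p := by
      refine (Filter.eventually_all_finite h.finite).2 fun p hp => ?_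
      have := cubeDist_pos (h.cube p (h.subset hp)) (h.notMem p hp v hv)
      filter_upwards [Filter.eventually_ge_atTop ((miDot a p - b) / cubeDist J v p)] with L hL
      rwa [div_le_iff₀ this] at hL
    obtain ⟨L, hL⟩ := (h1.and ((Filter.eventually_ge_atTop (B - b)).and
      (Filter.eventually_ge_atTop 0))).exists
    exact ⟨L, hL.1, hL.2.1, hL.2.2⟩
  obtain ⟨a', b', hab'⟩ := exists_tilt J v (Finset.mem_powerset.1 hv) a b L
  refine ⟨a', b', Function.update j v k, ?_, ?_, ?_⟩
  · have := hab' z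
    rw [cubeDist_eq_zero_of_mem hzv] at this
    linarith
  · refine ⟨h.closed.inter (isClosed_miDot_le a' b'), h.convex.inter (convex_miDot_le a' b'),
      fun z hz => h.bounded z hz.1, fun z hz => h.cube z hz.1, h.finite, fun p hp => ⟨h.subset hp, ?_⟩,
      h.notMem, fun u hu => ?_, fun z r hr C' hP hC' => h.correct z r hr C' hP
        (hC'.trans Set.inter_subset_left)⟩
    · have h1 := hab' p
      have h2 := hLP p hp
      change miDot a' p ≤ b'
      linarith
    · by_cases huv : u = v
      · subst huv
        rw [Function.update_self]
        convert hd' using 1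
        ext w
        simp only [Set.mem_inter_iff, Set.mem_ofPred_eq]
        constructor
        · rintro ⟨⟨h1, h2⟩, h3⟩
          have := hab' w
          rw [cubeDist_eq_zero_of_mem h3] at this
          exact ⟨⟨h1, h3⟩, by linarith⟩
        · rintro ⟨⟨h1, h3⟩, h2⟩
          have := hab' w
          rw [cubeDist_eq_zero_of_mem h3] at this
          exact ⟨⟨h1, by linarith⟩, h3⟩
      · rw [Function.update_of_ne huv]
        convert h.depth u hu using 1
        ext w
        simp only [Set.mem_inter_iff, Set.mem_ofPred_eq]
        refine ⟨fun hw => ⟨hw.1.1, hw.2⟩, fun hw => ⟨⟨hw.1, ?_⟩, hw.2⟩⟩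
        have h1 := hab' w
        have h2 := one_le_cubeDist (Finset.mem_powerset.1 hu) (Finset.mem_powerset.1 hv) huv hw.2
        have h3 := hB' w hw.1
        nlinarith
  · rw [← Finset.add_sum_erase _ _ hv, ← Finset.add_sum_erase _ (Function.update j v k) hv, hk,
      Function.update_self]
    have : ∑ u ∈ J.powerset.erase v, Function.update j v k u = ∑ u ∈ J.powerset.erase v, j u :=
      Finset.sum_congr rfl fun u hu => Function.update_of_ne (Finset.ne_of_mem_erase hu) _ _
    rw [this]; ring

theorem IsAdversaryState.record (h : IsAdversaryState R ρ J C P rec j) {z : MISpace n d}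
    {r : Option (MISpace n d × ℝ)} (hr : ∀ C', P ⊆ C' → C' ⊆ C → (r = none ↔ z ∈ C') ∧
      ∀ a b, r = some (a, b) → (∀ w ∈ C', miDot a w ≤ b) ∧ b < miDot a z) :
    IsAdversaryState R ρ J C P (Function.update rec z (some r)) j :=
  { h with
    correct := fun z' r' hr' C' => by
      by_cases hzz : z' = z
      · subst hzz
        obtain rfl : r = r' := by simpa using hr'
        exact hr C'
      · rw [Function.update_of_ne hzz] at hr'
        exact h.correct z' r' hr' C' }

theorem compatible_record_subset {C' P' : Set (MISpace n d)} (hC : C' ⊆ C) (hP : P ⊆ P')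
    {z : MISpace n d} (hz : rec z = none) {r : Option (MISpace n d × ℝ)} :
    compatible R M ρ C' P' (Function.update rec z (some r)) ⊆ compatible R M ρ C P rec := by
  rintro I ⟨h1, h2, h3, h4, h5⟩
  refine ⟨h1, h2, hP.trans h3, h4.trans hC, fun z' r' hr' => h5 z' r' ?_⟩
  rw [Function.update_of_ne (fun h => by rw [h, hz] at hr'; simp at hr')]
  exact hr'

/-- One answer of the adversary to a separation query. -/
theorem IsAdversaryState.exists_answer (h : IsAdversaryState R ρ J C P rec j) (z : MISpace n d) :
    ∃ r C' P' rec' j', IsAdversaryState R ρ J C' P' rec' j' ∧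
      ∑ v ∈ J.powerset, j v ≤ ∑ v ∈ J.powerset, j' v + 1 ∧ rec' z = some r ∧
      compatible R M ρ C' P' rec' ⊆ compatible R M ρ C P rec := by
  rcases hz : rec z with _ | r
  swap
  · exact ⟨r, C, P, rec, j, h, Nat.le_succ _, hz, subset_rfl⟩
  by_cases hzC : z ∈ C
  swap
  · obtain ⟨a, b, hab, hb⟩ := exists_separating h.convex h.closed hzC
    refine ⟨some (a, b), C, P, _, j, h.record fun C' _ hC' => ⟨by simpa using fun h => hzC (hC' h), ?_⟩,
      Nat.le_succ _, Function.update_self .., compatible_record_subset subset_rfl subset_rfl hz⟩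
    rintro _ _ ⟨⟩
    exact ⟨fun w hw => hab w (hC' hw), hb⟩
  by_cases hzv : ∃ v ∈ J.powerset, z ∈ cubeFiber J v
  · obtain ⟨v, hv, hzv⟩ := hzv
    obtain ⟨a, b, j', hab, h', hsum⟩ := h.exists_cut hzC hv hzv
    refine ⟨some (a, b), _, P, _, j', h'.record fun C' _ hC' => ⟨?_, ?_⟩, hsum.le,
      Function.update_self .., compatible_record_subset Set.inter_subset_left subset_rfl hz⟩
    · simpa using fun h => not_le.2 hab (hC' h).2
    · rintro _ _ ⟨⟩
      exact ⟨fun w hw => (hC' hw).2, hab⟩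
  -- A point of `C` over no vertex is not a lattice point, so declaring it feasible reveals nothing
  -- and costs no depth.
  · push Not at hzv
    have h' : IsAdversaryState R ρ J C (insert z P) rec j :=
      { h with
        finite := h.finite.insert z
        subset := Set.insert_subset hzC h.subset
        notMem := by
          rintro w (rfl | hw)
          · exact hzv
          · exact h.notMem w hw
        correct := fun z' r hr C' hP => h.correct z' r hr C' ((Set.subset_insert z P).trans hP) }
    exact ⟨none, C, insert z P, _, j, h'.record fun C' hP _ => ⟨by simpa using hP (Set.mem_insert _ _),
      by simp⟩, Nat.le_succ _, Function.update_self ..,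
      compatible_record_subset subset_rfl (Set.subset_insert _ _) hz⟩

/-- Lower bound from finding a feasible point: each of the `2^|J|` fibers costs its full depth. -/
theorem le_miInfoComp_of_hasDepth (hM : 0 ≤ M) (hcl : IsClosed C) (hconv : Convex ℝ C)
    (hbdd : ∀ z ∈ C, ‖z‖ ≤ R) (hcube : ∀ z ∈ C, ∀ i ∈ J, 0 ≤ z.1 i ∧ z.1 i ≤ 1) {k m : ℕ}
    (hdepth : ∀ v ∈ J.powerset, HasDepth ρ k (C ∩ cubeFiber J v)) (hm : m + 1 ≤ 2 ^ J.card * k) :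
    (m : ℕ∞) ≤ miInfoComp ε n d R M ρ := by
  refine le_infoComp_of_adversary (fun m 𝒞 => ∃ C P rec j, IsAdversaryState R ρ J C P rec j ∧
    m + 1 ≤ ∑ v ∈ J.powerset, j v ∧ 𝒞 = compatible R M ρ C P rec) ?_ ?_ ?_
    (𝒞 := compatible R M ρ C ∅ fun _ => none)
    ⟨C, ∅, fun _ => none, fun _ => k, ⟨hcl, hconv, hbdd, hcube, Set.finite_empty, by simp, by simp,
      hdepth, by simp⟩, by simpa using hm, rfl⟩
  · rintro m _ ⟨C, P, rec, j, h, hj, rfl⟩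
    obtain ⟨I, hI, -⟩ := h.exists_instance hM (by omega)
    exact ⟨I, hI⟩
  · rintro m _ ⟨C, P, rec, j, h, hj, rfl⟩ z
    by_cases hz : z ∈ C ∩ miLattice n d
    · obtain ⟨v, hv, hzv⟩ := exists_mem_cubeFiber hz.2 (h.cube z hz.1)
      -- The candidate `z` is refuted by one more, unrecorded cut that removes it. The unit of depth
      -- spent here is why the invariant asks for `m + 1`.
      obtain ⟨a, b, j', hab, h', hsum⟩ := h.exists_cut hz.1 hv hzv
      obtain ⟨I, ⟨h1, h2, h3, h4, h5⟩, hIC⟩ := h'.exists_instance hM (by omega)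
      refine ⟨I, ⟨h1, h2, h3, h4.trans Set.inter_subset_left, h5⟩, fun hzI => ?_⟩
      exact not_le.2 hab (h4 hzI.1.1).2
    · obtain ⟨I, hI, hIC⟩ := h.exists_instance hM (by omega)
      exact ⟨I, hI, fun hzI => hz (hIC ▸ hzI.1)⟩
  · rintro m _ ⟨C, P, rec, j, h, hj, rfl⟩ (z | z)
    · obtain ⟨r, C', P', rec', j', h', hsum, hr, hsub⟩ := h.exists_answer (M := M) z
      exact ⟨.separation r, _, hsub, ⟨C', P', rec', j', h', by omega, rfl⟩, fun I hI => by
        simp [miAnswer, hI.2.2.2.2 z r hr]⟩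
    · exact ⟨.firstOrder 0 0, _, subset_rfl, ⟨C, P, rec, j, h, by omega, rfl⟩, fun I hI => by
        simp [miAnswer, hI.1, hI.2.1]⟩

end FeasibilityAdversary

/-! ### Depth of boxes and of integer intervals -/

section FeasibilityBounds

variable {n d : ℕ} {R M ρ ε : ℝ}

/-- The fiber over a vertex `v` of the cube that is a box with the corners `l` and `u`. -/
def boxFiber (v : Finset (Fin n)) (l u : Fin d → ℝ) : Set (MISpace n d) :=
  {z | z ∈ cubeFiber Finset.univ v ∧ ∀ i, l i ≤ z.2 i ∧ z.2 i ≤ u i}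

theorem isGoodFiber_boxFiber (hρ : 0 ≤ ρ) {v : Finset (Fin n)} {l u : Fin d → ℝ}
    (h : ∀ i, 2 * ρ ≤ u i - l i) : IsGoodFiber ρ (boxFiber v l u) := by
  constructor
  · refine ⟨((fun i => if i ∈ v then 1 else 0), l), ⟨fun i _ => rfl, fun i => ⟨le_rfl, ?_⟩⟩, fun i => ?_⟩
    · linarith [h i]
    · by_cases hi : i ∈ v
      · exact ⟨1, by simp [hi]⟩
      · exact ⟨0, by simp [hi]⟩
  · rintro z ⟨hz, -⟩
    refine ⟨fun i => (l i + u i) / 2, fun y hy => ⟨hz.1, fun i => ?_⟩⟩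
    have := (norm_le_pi_norm _ i).trans hy
    simp only [Pi.sub_apply, Real.norm_eq_abs, abs_le] at this
    have hi := h i
    constructor <;> simp only <;> linarith

/-- `s i` is the number of cuts still available in direction `i`. A query in one half of the side is
answered by keeping the outer third of the other half, which separates strictly even from the
midpoint. When no cut is left, the infeasible half-space `0 ≤ -1` empties the fiber, which is the
extra `1`. -/
theorem hasDepth_boxFiber (hρ : 0 < ρ) {v : Finset (Fin n)} (N : ℕ) : ∀ (l u : Fin d → ℝ)
    (s : Fin d → ℕ), (∀ i, 2 * ρ * 3 ^ s i ≤ u i - l i) → ∑ i, s i = N →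
    HasDepth ρ (N + 1) (boxFiber v l u) := by
  classical
  have hgood : ∀ (l u : Fin d → ℝ) (s : Fin d → ℕ), (∀ i, 2 * ρ * 3 ^ s i ≤ u i - l i) →
      IsGoodFiber ρ (boxFiber v l u) := fun l u s hs => isGoodFiber_boxFiber hρ.le fun i => by
    refine le_trans ?_ (hs i)
    exact le_mul_of_one_le_right (by positivity) (one_le_pow₀ (by norm_num))
  induction N with
  | zero =>
    refine fun l u s hs _ => ⟨hgood l u s hs, fun z _ => ⟨0, -1, by simp, ?_⟩⟩
    ext w
    simp only [miDot_zero_left, Set.mem_inter_iff, Set.mem_ofPred_eq, Set.mem_empty_iff_false,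
      iff_false, not_and, not_le]
    intro; norm_num
  | succ N ih =>
    refine fun l u s hs hN => ⟨hgood l u s hs, fun z hz => ?_⟩
    obtain ⟨i, -, hi⟩ : ∃ i ∈ Finset.univ, s i ≠ 0 := by
      by_contra! h
      rw [Finset.sum_eq_zero h] at hN
      omega
    obtain ⟨k, hk⟩ := Nat.exists_eq_succ_of_ne_zero hi
    have hsi := hs i
    rw [hk, pow_succ] at hsi
    have hk0 : 0 < 2 * ρ * 3 ^ k := by positivity
    have hsum : ∑ j, Function.update s i k j = N := by
      rw [← Finset.add_sum_erase _ _ (Finset.mem_univ i), Function.update_self]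
      rw [← Finset.add_sum_erase _ _ (Finset.mem_univ i), hk] at hN
      have : ∑ j ∈ Finset.univ.erase i, Function.update s i k j = ∑ j ∈ Finset.univ.erase i, s j :=
        Finset.sum_congr rfl fun j hj => Function.update_of_ne (Finset.ne_of_mem_erase hj) _ _
      omega
    rcases le_or_gt ((l i + u i) / 2) (z.2 i) with hmid | hmid
    · set b := l i + (u i - l i) / 3 with hb
      refine ⟨(0, Pi.single i 1), b, ?_, ?_⟩
      · simp only [miDot, zero_dotProduct, single_dotProduct, zero_add, one_mul]
        nlinarith [(hz.2 i).2]
      · have : boxFiber v l u ∩ {w | miDot (0, Pi.single i 1) w ≤ b} =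
            boxFiber v l (Function.update u i b) := by
          ext w
          simp only [miDot, zero_dotProduct, single_dotProduct, zero_add, one_mul, boxFiber,
            Set.mem_inter_iff, Set.mem_ofPred_eq, and_assoc]
          refine and_congr_right fun _ => ⟨fun h j => ?_, fun h => ⟨fun j => ?_, ?_⟩⟩
          · rcases eq_or_ne j i with rfl | hj
            · simpa using ⟨(h.1 j).1, h.2⟩
            · simpa [hj] using h.1 j
          · have hj' := h j
            rcases eq_or_ne j i with rfl | hj
            · simp only [Function.update_self] at hj'
              exact ⟨hj'.1, by linarith⟩
            · simpa [hj] using hj'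
          · simpa using (h i).2
        rw [this]
        refine ih _ _ (Function.update s i k) (fun j => ?_) hsum
        rcases eq_or_ne j i with rfl | hj
        · simp only [Function.update_self]; linarith
        · simpa [hj] using hs j
    · set b := u i - (u i - l i) / 3 with hb
      refine ⟨(0, Pi.single i (-1)), -b, ?_, ?_⟩
      · simp only [miDot, zero_dotProduct, single_dotProduct, zero_add]
        linarith
      · have : boxFiber v l u ∩ {w | miDot (0, Pi.single i (-1)) w ≤ -b} =
            boxFiber v (Function.update l i b) u := by
          ext w
          simp only [miDot, zero_dotProduct, single_dotProduct, zero_add, neg_mul, one_mul, boxFiber,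
            Set.mem_inter_iff, Set.mem_ofPred_eq, and_assoc, neg_le_neg_iff]
          refine and_congr_right fun _ => ⟨fun h j => ?_, fun h => ⟨fun j => ?_, ?_⟩⟩
          · rcases eq_or_ne j i with rfl | hj
            · simpa using ⟨h.2, (h.1 j).2⟩
            · simpa [hj] using h.1 j
          · have hj' := h j
            rcases eq_or_ne j i with rfl | hj
            · simp only [Function.update_self] at hj'
              exact ⟨by linarith, hj'.2⟩
            · simpa [hj] using hj'
          · simpa using (h i).1
        rw [this]
        refine ih _ _ (Function.update s i k) (fun j => ?_) hsum
        rcases eq_or_ne j i with rfl | hj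
        · simp only [Function.update_self]; linarith
        · simpa [hj] using hs j

/-- On `[0,1]ⁿ × [-R,R]ᵈ` every side allows `S` cuts, so a fiber has depth `d * S + 1`. The `2ⁿ`
extra units cover the one that the adversary must hold back. -/
theorem le_miInfoComp_box (hR : 1 ≤ R) (hM : 0 ≤ M) (hρ : 0 < ρ) {S : ℕ} (hS : ρ * 3 ^ S ≤ R) :
    ((2 ^ n * (d * S) : ℕ) : ℕ∞) ≤ miInfoComp ε n d R M ρ := by
  have hcoord : ∀ (p : Fin n → ℝ → Prop) (q : Fin d → ℝ → Prop),
      {z : MISpace n d | (∀ i, p i (z.1 i)) ∧ ∀ i, q i (z.2 i)} =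
        (Set.univ.pi fun i => {x | p i x}) ×ˢ (Set.univ.pi fun i => {x | q i x}) := by
    intro p q; ext z; simp [Set.mem_prod, Set.mem_pi]
  set C : Set (MISpace n d) := {z | (∀ i, z.1 i ∈ Set.Icc (0 : ℝ) 1) ∧ ∀ i, z.2 i ∈ Set.Icc (-R) R}
    with hC
  have hC' := hcoord (fun _ x => x ∈ Set.Icc (0 : ℝ) 1) (fun _ x => x ∈ Set.Icc (-R) R)
  refine le_miInfoComp_of_hasDepth (J := Finset.univ) (C := C) (k := d * S + 1) hM ?_ ?_ ?_
    (fun z hz i _ => hz.1 i) (fun v _ => ?_) ?_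
  · rw [hC, hC']
    exact (isClosed_set_pi fun _ _ => isClosed_Icc).prod (isClosed_set_pi fun _ _ => isClosed_Icc)
  · rw [hC, hC']
    exact (convex_pi fun _ _ => convex_Icc _ _).prod (convex_pi fun _ _ => convex_Icc _ _)
  · intro z hz
    refine max_le ((pi_norm_le_iff_of_nonneg (by linarith)).2 fun i => ?_)
      ((pi_norm_le_iff_of_nonneg (by linarith)).2 fun i => abs_le.2 (hz.2 i))
    rw [Real.norm_of_nonneg (hz.1 i).1]
    exact (hz.1 i).2.trans hR
  · have : C ∩ cubeFiber Finset.univ v = boxFiber v (fun _ => -R) fun _ => R := by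
      ext z
      simp only [hC, Set.mem_inter_iff, Set.mem_ofPred_eq, boxFiber, Set.mem_Icc]
      refine ⟨fun h => ⟨h.2, h.1.2⟩, fun h => ⟨⟨fun i => ?_, h.2⟩, h.1⟩⟩
      rw [h.1 i (Finset.mem_univ i)]
      split_ifs <;> norm_num
    rw [this]
    exact hasDepth_boxFiber hρ _ _ _ (fun _ => S) (fun _ => by linarith) (by simp)
  · rw [Finset.card_univ, Fintype.card_fin, mul_add, mul_one]
    exact Nat.add_le_add_left Nat.one_le_two_pow _

theorem ofReal_le_of_natCast_le {N : ℕ∞} {m : ℕ} {x : ℝ} (h : (m : ℕ∞) ≤ N) (hx : x ≤ m) :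
    ENNReal.ofReal x ≤ (N : ℝ≥0∞) :=
  calc ENNReal.ofReal x ≤ ENNReal.ofReal m := ENNReal.ofReal_le_ofReal hx
    _ = ((m : ℕ∞) : ℝ≥0∞) := by rw [ENNReal.ofReal_natCast, ENat.toENNReal_coe]
    _ ≤ _ := ENat.toENNReal_le.2 h

theorem ofReal_le_miInfoComp_feasibility (hR : 1 ≤ R) (hM : 0 ≤ M) (hρ : 0 < ρ) (hK : 3 ≤ R / ρ) :
    ENNReal.ofReal (1 / 4 * (d * 2 ^ n * Real.log (R / ρ))) ≤ (miInfoComp ε n d R M ρ : ℝ≥0∞) := by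
  have hfl : 3 ≤ ⌊R / ρ⌋₊ := Nat.le_floor (by exact_mod_cast hK)
  set S := Nat.log 3 ⌊R / ρ⌋₊ with hS
  have hS1 : 1 ≤ S := Nat.log_pos (by norm_num) hfl
  have hSle : ((3 : ℝ)) ^ S ≤ R / ρ := by
    have h1 : 3 ^ S ≤ ⌊R / ρ⌋₊ := Nat.pow_log_le_self 3 (by omega)
    exact le_trans (by exact_mod_cast h1) (Nat.floor_le (by positivity))
  -- From `log 3 ≤ 2` and `S + 1 ≤ 2S`.
  have hlog : Real.log (R / ρ) ≤ 4 * S := by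
    have h1 : ⌊R / ρ⌋₊ < 3 ^ (S + 1) := Nat.lt_pow_succ_log_self (by norm_num) _
    have h2 : R / ρ ≤ 3 ^ (S + 1) := by
      have h3 := (Nat.lt_floor_add_one (R / ρ)).le
      have h4 : ((⌊R / ρ⌋₊ : ℝ)) + 1 ≤ 3 ^ (S + 1) := by exact_mod_cast h1
      linarith
    have h3 := Real.log_le_log (by linarith) h2
    rw [Real.log_pow] at h3
    have h4 := Real.log_le_sub_one_of_pos (x := 3) (by norm_num)
    have h5 : (1 : ℝ) ≤ S := by exact_mod_cast hS1
    push_cast at h3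
    nlinarith
  refine ofReal_le_of_natCast_le (le_miInfoComp_box hR hM hρ (S := S) ?_) ?_
  · rw [le_div_iff₀ hρ] at hSle; linarith
  · push_cast
    have : (0 : ℝ) ≤ d * 2 ^ n := by positivity
    nlinarith [mul_le_mul_of_nonneg_left hlog this]

/-- The fiber over a vertex of the cube in the coordinates other than `i₀` that consists of an
interval in the coordinate `i₀`. -/
def intervalFiber (i₀ : Fin n) (v : Finset (Fin n)) (l u : ℤ) : Set (MISpace n 0) :=
  {z | z ∈ cubeFiber (Finset.univ.erase i₀) v ∧ l ≤ z.1 i₀ ∧ z.1 i₀ ≤ u}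

theorem isGoodFiber_intervalFiber {i₀ : Fin n} {v : Finset (Fin n)} {l u : ℤ} (h : l ≤ u) :
    IsGoodFiber ρ (intervalFiber i₀ v l u) := by
  refine ⟨⟨((fun i => if i = i₀ then (l : ℝ) else if i ∈ v then 1 else 0), 0), ⟨fun i hi => ?_, ?_⟩,
    fun i => ?_⟩, fun z hz => ⟨0, fun y _ => ?_⟩⟩
  · simp [Finset.ne_of_mem_erase hi]
  · simpa using h
  · by_cases hi : i = i₀
    · exact ⟨l, by simp [hi]⟩
    by_cases hv : i ∈ v
    · exact ⟨1, by simp [hi, hv]⟩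
    · exact ⟨0, by simp [hi, hv]⟩
  · rw [Subsingleton.elim y z.2]
    exact hz.1

/-- Binary search: the hypothesis says that the interval has at least `2^(k+1) - 1` integers. For `k
+ 1`, splitting at `c` leaves at least `2^(k+1) - 1` of them on either side, whether or not the
query is integral. -/
theorem hasDepth_intervalFiber {i₀ : Fin n} {v : Finset (Fin n)} (k : ℕ) : ∀ l u : ℤ,
    2 ^ (k + 1) ≤ u - l + 2 → HasDepth ρ (k + 1) (intervalFiber i₀ v l u) := by
  induction k with
  | zero =>
    refine fun l u h => ⟨isGoodFiber_intervalFiber (by norm_num at h; linarith),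
      fun z _ => ⟨0, -1, by simp, ?_⟩⟩
    ext w
    simp only [miDot_zero_left, Set.mem_inter_iff, Set.mem_ofPred_eq, Set.mem_empty_iff_false,
      iff_false, not_and, not_le]
    intro; norm_num
  | succ k ih =>
    intro l u h
    have hp : (1 : ℤ) ≤ 2 ^ k := one_le_pow₀ (by norm_num)
    rw [pow_succ, pow_succ] at h
    refine ⟨isGoodFiber_intervalFiber (by linarith), fun z _ => ?_⟩
    set c : ℤ := l + 2 ^ (k + 1) - 1 with hc
    have hpk : (2 : ℤ) ^ (k + 1) = 2 ^ k * 2 := pow_succ 2 k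
    rcases le_or_gt (c : ℝ) (z.1 i₀) with hz | hz
    · refine ⟨(Pi.single i₀ 1, 0), ((c - 1 : ℤ) : ℝ), ?_, ?_⟩
      · simp only [miDot, zero_dotProduct, single_dotProduct, add_zero, one_mul]
        push_cast; linarith
      · have : intervalFiber i₀ v l u ∩ {w | miDot (Pi.single i₀ 1, 0) w ≤ ((c - 1 : ℤ) : ℝ)} =
            intervalFiber i₀ v l (c - 1) := by
          have hcu : ((c - 1 : ℤ) : ℝ) ≤ u := by exact_mod_cast (by linarith : c - 1 ≤ u)
          ext w
          simp only [miDot, zero_dotProduct, single_dotProduct, add_zero, one_mul, intervalFiber,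
            Set.mem_inter_iff, Set.mem_ofPred_eq]
          exact ⟨fun h => ⟨h.1.1, h.1.2.1, h.2⟩, fun h => ⟨⟨h.1, h.2.1, h.2.2.trans hcu⟩, h.2.2⟩⟩
        rw [this]
        exact ih _ _ (by linarith)
    · refine ⟨(Pi.single i₀ (-1), 0), -c, ?_, ?_⟩
      · simp only [miDot, zero_dotProduct, single_dotProduct, add_zero]
        linarith
      · have : intervalFiber i₀ v l u ∩ {w | miDot (Pi.single i₀ (-1), 0) w ≤ -c} =
            intervalFiber i₀ v c u := by
          have hcl : (l : ℝ) ≤ c := by exact_mod_cast (by linarith : l ≤ c)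
          ext w
          simp only [miDot, zero_dotProduct, single_dotProduct, add_zero, neg_mul, one_mul,
            intervalFiber, Set.mem_inter_iff, Set.mem_ofPred_eq, neg_le_neg_iff]
          exact ⟨fun h => ⟨h.1.1, h.2, h.1.2.2⟩, fun h => ⟨⟨h.1, hcl.trans h.2.1, h.2.2⟩, h.2.1⟩⟩
        rw [this]
        exact ih _ _ (by linarith)

/-- One coordinate carries the interval `[-⌊R⌋, ⌊R⌋]` and the others the cube. This leaves `2^(n-1)`
fibers, and the lost factor `2` goes into the constant. -/
theorem ofReal_le_miInfoComp_int (hn : 1 ≤ n) (hR : 1 ≤ R) (hM : 0 ≤ M) :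
    ENNReal.ofReal (1 / 4 * (2 ^ n * Real.log R)) ≤ (miInfoComp ε n 0 R M ρ : ℝ≥0∞) := by
  have hfl : 1 ≤ ⌊R⌋₊ := Nat.le_floor (by exact_mod_cast hR)
  set k := Nat.log 2 (⌊R⌋₊ + 1) with hk
  have hk1 : 1 ≤ k := Nat.log_pos (by norm_num) (by omega)
  have hkle : 2 ^ k ≤ ⌊R⌋₊ + 1 := Nat.pow_log_le_self 2 (by omega)
  have hlog : Real.log R ≤ 2 * k := by
    have h1 : ⌊R⌋₊ + 1 < 2 ^ (k + 1) := Nat.lt_pow_succ_log_self (by norm_num) _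
    have h2 : R ≤ 2 ^ (k + 1) := by
      have h3 := (Nat.lt_floor_add_one R).le
      have h4 : ((⌊R⌋₊ : ℝ)) + 1 ≤ 2 ^ (k + 1) := by exact_mod_cast h1.le
      linarith
    have h3 := Real.log_le_log (by linarith) h2
    rw [Real.log_pow] at h3
    have h4 := Real.log_le_sub_one_of_pos (x := 2) (by norm_num)
    have h5 : (1 : ℝ) ≤ k := by exact_mod_cast hk1
    push_cast at h3
    nlinarith
  obtain ⟨n', rfl⟩ := Nat.exists_eq_add_of_le' hn
  set F : ℤ := (⌊R⌋₊ : ℤ) with hF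
  have hF0 : (0 : ℝ) ≤ (F : ℝ) := by rw [hF]; positivity
  have hFR : (F : ℝ) ≤ R := by
    rw [hF, Int.cast_natCast]; exact Nat.floor_le (by linarith)
  set J : Finset (Fin (n' + 1)) := Finset.univ.erase 0 with hJ
  set C : Set (MISpace (n' + 1) 0) := {z | (∀ i ∈ J, 0 ≤ z.1 i ∧ z.1 i ≤ 1) ∧
    ((-F : ℤ) : ℝ) ≤ z.1 0 ∧ z.1 0 ≤ F} with hC
  have hlow : ((2 ^ n' * k : ℕ) : ℕ∞) ≤ miInfoComp ε (n' + 1) 0 R M ρ := by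
    have hC' : C = (⋂ i ∈ J, (fun z : MISpace (n' + 1) 0 => z.1 i) ⁻¹' Set.Icc 0 1) ∩
        (fun z : MISpace (n' + 1) 0 => z.1 0) ⁻¹' Set.Icc ((-F : ℤ) : ℝ) F := by
      ext z; simp [hC]
    have hlin : ∀ i, IsLinearMap ℝ fun z : MISpace (n' + 1) 0 => z.1 i := fun i =>
      ⟨fun _ _ => rfl, fun _ _ => rfl⟩
    refine le_miInfoComp_of_hasDepth (J := J) (C := C) (k := k + 1) hM ?_ ?_ ?_
      (fun z hz => hz.1) (fun v _ => ?_) ?_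
    · rw [hC']
      exact (isClosed_biInter fun i _ => isClosed_Icc.preimage (by fun_prop)).inter
        (isClosed_Icc.preimage (by fun_prop))
    · rw [hC']
      exact (convex_iInter₂ fun i _ => (convex_Icc _ _).is_linear_preimage (hlin i)).inter
        ((convex_Icc _ _).is_linear_preimage (hlin 0))
    · intro z hz
      refine max_le ((pi_norm_le_iff_of_nonneg (by linarith)).2 fun i => ?_)
        (by rw [Subsingleton.elim z.2 0, norm_zero]; linarith)
      rw [Real.norm_eq_abs, abs_le]
      by_cases hi : i = 0
      · subst hi
        have := hz.2
        push_cast at this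
        constructor <;> linarith
      · have := hz.1 i (Finset.mem_erase.2 ⟨hi, Finset.mem_univ i⟩)
        constructor <;> linarith
    · have : C ∩ cubeFiber J v = intervalFiber 0 v (-F) F := by
        ext z
        simp only [hC, Set.mem_inter_iff, Set.mem_ofPred_eq, intervalFiber]
        refine ⟨fun h => ⟨h.2, h.1.2⟩, fun h => ⟨⟨fun i hi => ?_, h.2⟩, h.1⟩⟩
        rw [h.1 i hi]
        split_ifs <;> norm_num
      rw [this]
      refine hasDepth_intervalFiber k _ _ ?_
      have : (2 : ℤ) ^ k ≤ F + 1 := by rw [hF]; exact_mod_cast hkle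
      rw [pow_succ]; linarith
    · have hJc : J.card = n' := by simp [hJ]
      rw [hJc, mul_add, mul_one]
      exact Nat.add_le_add_left Nat.one_le_two_pow _
  refine ofReal_le_of_natCast_le hlow ?_
  push_cast
  rw [pow_succ]
  have : (0 : ℝ) ≤ 2 ^ n' := by positivity
  nlinarith [mul_le_mul_of_nonneg_left hlog this]

end FeasibilityBounds

/-! ### Functions of one variable with a V-shaped tip -/

section VShape

variable {R M : ℝ}

/-- At each point the function has a subgradient of absolute value at most `M`. -/
def HasBoundedSubgradients (M : ℝ) (f : ℝ → ℝ) : Prop :=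
  ∀ y, ∃ σ, |σ| ≤ M ∧ ∀ w, f y + σ * (w - y) ≤ f w

theorem HasBoundedSubgradients.max {f g : ℝ → ℝ} (hf : HasBoundedSubgradients M f)
    (hg : HasBoundedSubgradients M g) : HasBoundedSubgradients M fun y => max (f y) (g y) := by
  intro y
  rcases le_total (f y) (g y) with h | h
  · obtain ⟨σ, h1, h2⟩ := hg y
    exact ⟨σ, h1, fun w => by beta_reduce; rw [max_eq_right h]; exact (h2 w).trans (le_max_right _ _)⟩
  · obtain ⟨σ, h1, h2⟩ := hf y
    exact ⟨σ, h1, fun w => by beta_reduce; rw [max_eq_left h]; exact (h2 w).trans (le_max_left _ _)⟩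

theorem hasBoundedSubgradients_affine {σ : ℝ} (hσ : |σ| ≤ M) (b c : ℝ) :
    HasBoundedSubgradients M fun y => b + σ * (y - c) :=
  fun y => ⟨σ, hσ, fun w => by apply le_of_eq; ring⟩

theorem hasBoundedSubgradients_abs {s : ℝ} (hs : 0 ≤ s) (hsM : s ≤ M) (b c : ℝ) :
    HasBoundedSubgradients M fun y => b + s * |y - c| := by
  have h : (fun y => b + s * |y - c|) = fun y => max (b + s * (y - c)) (b + -s * (y - c)) := by
    ext y
    rw [abs_eq_max_neg, mul_max_of_nonneg _ _ hs, ← max_add_add_left]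
    congr 2
    ring
  rw [h]
  exact (hasBoundedSubgradients_affine (by rwa [abs_of_nonneg hs]) _ _).max
    (hasBoundedSubgradients_affine (by rwa [abs_neg, abs_of_nonneg hs]) _ _)

/-- The function `max (O y) (v + s |y - c|)`. -/
noncomputable def vShape (s v : ℝ) (O : ℝ → ℝ) (c y : ℝ) : ℝ := max (O y) (v + s * |y - c|)

/-- `O` is a convex function that leaves room for the tip `v + s |y - c|` on `[c - r, c + r]` and is
much steeper outside. -/
structure IsVShape (R M r s v : ℝ) (O : ℝ → ℝ) (c : ℝ) : Prop where
  subgrad : HasBoundedSubgradients M O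
  inside : ∀ y, |y - c| ≤ r → O y ≤ v + s * r + 3 * s * (|y - c| - r)
  outside : ∀ y, r ≤ |y - c| → v + s * r + 3 * s * (|y - c| - r) ≤ O y
  range : |c| + r ≤ R

theorem IsVShape.tip_le {r s v : ℝ} {O : ℝ → ℝ} {c : ℝ} (h : IsVShape R M r s v O c) (hs : 0 ≤ s)
    {y : ℝ} (hy : r ≤ |y - c|) : v + s * |y - c| ≤ O y :=
  le_trans (by nlinarith) (h.outside y hy)

theorem IsVShape.vShape_eq {r s v : ℝ} {O : ℝ → ℝ} {c : ℝ} (h : IsVShape R M r s v O c) (hs : 0 ≤ s)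
    {y : ℝ} (hy : r ≤ |y - c|) : vShape s v O c y = O y :=
  max_eq_left (h.tip_le hs hy)

/-- The tip can be replaced by a smaller and deeper one on the side of `c` opposite to `x`. -/
theorem IsVShape.exists_deeper {r s v : ℝ} {O : ℝ → ℝ} {c : ℝ} (h : IsVShape R M r s v O c)
    (hr : 0 < r) (hs : 0 < s) (hsM : 3 * s ≤ M) (x : ℝ) :
    ∃ O' c', IsVShape R M (r / 3) (s / 3) (v - s * r / 9) O' c' ∧ (∀ y, O y ≤ O' y) ∧
      (∀ y, vShape (s / 3) (v - s * r / 9) O' c' y ≤ vShape s v O c y) ∧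
      (∀ y, y = x ∨ r ≤ |y - c| → vShape (s / 3) (v - s * r / 9) O' c' y = vShape s v O c y ∧
        r / 3 ≤ |y - c'|) := by
  obtain ⟨e, he, hex⟩ : ∃ e : ℝ, (e = 1 ∨ e = -1) ∧ 0 ≤ e * (x - c) := by
    rcases le_total c x with h | h
    · exact ⟨1, Or.inl rfl, by linarith⟩
    · exact ⟨-1, Or.inr rfl, by linarith⟩
  have hee : e * e = 1 := by rcases he with rfl | rfl <;> norm_num
  have heabs : |e| = 1 := by rcases he with rfl | rfl <;> norm_num
  have habs : ∀ y, |y - c| = |e * (y - c)| := fun y => by rw [abs_mul, heabs, one_mul]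
  have habs' : ∀ y, |y - (c - e * (r / 3))| = |e * (y - c) + r / 3| := fun y => by
    rw [← one_mul |y - _|, ← heabs, ← abs_mul]
    congr 1
    linear_combination (r / 3) * hee
  have hsr : 0 < s * r := mul_pos hs hr
  -- In the coordinate `t = e (y - c)`, where `x` has `t ≥ 0`, two lines are added: the arm of the V
  -- on the side of `x`, prolonged below the tip, and the steep line through the other end of the V.
  -- They leave room for a tip of radius `r/3` centred at `t = -r/3`, and nothing changes at `x`.
  set O' : ℝ → ℝ := fun y => max (max (O y) (v + s * e * (y - c)))
    (v + s * r - 3 * s * r + (-(3 * s * e)) * (y - c)) with hO'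
  have hO : ∀ y, O y ≤ O' y := fun y => (le_max_left _ _).trans (le_max_left _ _)
  have hl1 : ∀ y, v + s * (e * (y - c)) ≤ O' y := fun y =>
    le_trans (le_of_eq (by ring)) ((le_max_right (O y) _).trans (le_max_left _ _))
  have hl2 : ∀ y, v + s * r - 3 * s * (e * (y - c) + r) ≤ O' y := fun y =>
    le_trans (le_of_eq (by ring)) (le_max_right _ _)
  have hle : ∀ y B, O y ≤ B → v + s * (e * (y - c)) ≤ B →
      v + s * r - 3 * s * (e * (y - c) + r) ≤ B → O' y ≤ B := fun y B h1 h2 h3 =>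
    max_le (max_le h1 (le_trans (le_of_eq (by ring)) h2)) (le_trans (le_of_eq (by ring)) h3)
  have hdeep : ∀ y, vShape (s / 3) (v - s * r / 9) O' (c - e * (r / 3)) y ≤ vShape s v O c y := by
    intro y
    have h1 : O y ≤ vShape s v O c y := le_max_left _ _
    have h2 : v + s * |y - c| ≤ vShape s v O c y := le_max_right _ _
    refine max_le (hle y _ h1 ?_ ?_) ?_
    · refine le_trans ?_ h2
      rw [habs]
      have := mul_le_mul_of_nonneg_left (le_abs_self (e * (y - c))) hs.le
      linarith
    · rcases le_total r |y - c| with hy | hy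
      · refine le_trans ?_ ((h.outside y hy).trans h1)
        rw [habs]
        nlinarith [neg_abs_le (e * (y - c))]
      · refine le_trans ?_ h2
        rw [habs] at hy ⊢
        nlinarith [neg_abs_le (e * (y - c))]
    · refine le_trans ?_ h2
      rw [habs, habs']
      have h3 := abs_add_le (e * (y - c)) (r / 3)
      rw [abs_of_pos (by positivity : 0 < r / 3)] at h3
      have h4 := mul_le_mul_of_nonneg_left h3 hs.le
      have h5 := mul_nonneg hs.le (abs_nonneg (e * (y - c)))
      linarith
  refine ⟨O', c - e * (r / 3), ⟨?_, ?_, ?_, ?_⟩, hO, hdeep, ?_⟩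
  · refine (h.subgrad.max (hasBoundedSubgradients_affine ?_ _ _)).max
      (hasBoundedSubgradients_affine ?_ _ _)
    · rw [abs_mul, heabs, abs_of_pos hs]; linarith
    · rw [abs_neg, abs_mul, heabs, abs_of_pos (by positivity)]; linarith
  · intro y hy
    rw [habs'] at hy ⊢
    set t := e * (y - c) with ht
    obtain ⟨h1, h2⟩ := abs_le.1 hy
    have ht0 : t ≤ 0 := by linarith
    have e1 : v - s * r / 9 + s / 3 * (r / 3) + 3 * (s / 3) * (|t + r / 3| - r / 3) =
        v + s * (|t + r / 3| - r / 3) := by ring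
    rw [e1]
    have h3 := mul_le_mul_of_nonneg_left (neg_abs_le (t + r / 3)) hs.le
    have h4 := mul_le_mul_of_nonneg_left (le_abs_self (t + r / 3)) hs.le
    have h5 := mul_le_mul_of_nonneg_left h1 hs.le
    have hl3 : v + s * r - 3 * s * (t + r) ≤ v + s * (|t + r / 3| - r / 3) := by linarith
    refine hle y _ ?_ (by linarith) hl3
    refine le_trans (h.inside y ?_) (le_trans (le_of_eq ?_) hl3)
    · rw [habs, abs_of_nonpos ht0]; linarith
    · rw [habs, ← ht, abs_of_nonpos ht0]; ring
  · intro y hy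
    rw [habs'] at hy ⊢
    set t := e * (y - c) with ht
    have e1 : v - s * r / 9 + s / 3 * (r / 3) + 3 * (s / 3) * (|t + r / 3| - r / 3) =
        v + s * (|t + r / 3| - r / 3) := by ring
    rw [e1]
    rcases le_total 0 (t + r / 3) with h0 | h0
    · rw [abs_of_nonneg h0] at hy ⊢
      exact le_trans (le_of_eq (by ring)) (hl1 y)
    · rw [abs_of_nonpos h0] at hy ⊢
      refine le_trans ?_ (hl2 y)
      have := mul_le_mul_of_nonneg_left hy hs.le
      linarith
  · have h1 := abs_sub c (e * (r / 3))
    rw [abs_mul, heabs, one_mul, abs_of_pos (by positivity : 0 < r / 3)] at h1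
    linarith [h.range]
  · intro y hy
    refine ⟨le_antisymm (hdeep y) ?_, ?_⟩
    · refine max_le ((hO y).trans (le_max_left _ _)) (le_trans ?_ (le_max_left _ _))
      rcases hy with rfl | hy
      · rw [habs, abs_of_nonneg hex]
        exact hl1 y
      · exact (h.tip_le hs.le hy).trans (hO y)
    · rw [habs']
      rcases hy with rfl | hy
      · rw [abs_of_nonneg (by positivity)]; linarith
      · rw [habs] at hy
        rcases le_abs.1 hy with h1 | h1
        · exact le_trans (by linarith) (le_abs_self _)
        · exact le_trans (by linarith) (neg_le_abs _)

/-- The radius of the tip at the level `k`. -/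
noncomputable def tipRadius (R : ℝ) (k : ℕ) : ℝ := R / 3 ^ k

/-- The slope of the tip at the level `k`. -/
noncomputable def tipSlope (M : ℝ) (k : ℕ) : ℝ := M / 3 / 3 ^ k

/-- The minimum of the tip at the level `k`. -/
noncomputable def tipMin (R M : ℝ) : ℕ → ℝ
  | 0 => 0
  | k + 1 => tipMin R M k - tipSlope M k * tipRadius R k / 9

theorem tipRadius_pos (hR : 0 < R) (k : ℕ) : 0 < tipRadius R k := by unfold tipRadius; positivity

theorem tipSlope_pos (hM : 0 < M) (k : ℕ) : 0 < tipSlope M k := by unfold tipSlope; positivity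

theorem tipSlope_le (hM : 0 < M) (k : ℕ) : 3 * tipSlope M k ≤ M := by
  have : M / 3 / 3 ^ k ≤ M / 3 := div_le_self (by positivity) (one_le_pow₀ (by norm_num))
  rw [tipSlope]; linarith

theorem tipMin_antitone (hR : 0 < R) (hM : 0 < M) : Antitone (tipMin R M) :=
  antitone_nat_of_succ_le fun k => by
    have := mul_pos (tipSlope_pos hM k) (tipRadius_pos hR k)
    rw [tipMin]; linarith

theorem tipRadius_succ (k : ℕ) : tipRadius R (k + 1) = tipRadius R k / 3 := by
  rw [tipRadius, tipRadius, pow_succ, div_div]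

theorem tipSlope_succ (k : ℕ) : tipSlope M (k + 1) = tipSlope M k / 3 := by
  rw [tipSlope, tipSlope, pow_succ, div_div _ _ (3 : ℝ)]

/-- A shape at the level `k`. -/
def IsTip (R M : ℝ) (k : ℕ) (O : ℝ → ℝ) (c : ℝ) : Prop :=
  IsVShape R M (tipRadius R k) (tipSlope M k) (tipMin R M k) O c

/-- The function of a shape at the level `k`. -/
noncomputable def tipFun (R M : ℝ) (k : ℕ) (O : ℝ → ℝ) (c : ℝ) : ℝ → ℝ :=
  vShape (tipSlope M k) (tipMin R M k) O c

/-- The outer slope `3 * tipSlope M 0` is exactly `M`, and both conditions on `O` hold with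
equality. -/
theorem isTip_zero (hM : 0 < M) : IsTip R M 0
    (fun y => -(2 * tipSlope M 0 * tipRadius R 0) + 3 * tipSlope M 0 * |y - 0|) 0 := by
  have h0 : tipRadius R 0 = R := by simp [tipRadius]
  refine ⟨hasBoundedSubgradients_abs (by have := tipSlope_pos hM 0; positivity)
    (tipSlope_le hM 0) _ _, fun y _ => le_of_eq ?_, fun y _ => le_of_eq ?_, by simp [h0]⟩ <;>
  · simp only [tipMin]; ring

theorem tipFun_center_le {k : ℕ} {O : ℝ → ℝ} {c : ℝ} (hR : 0 < R) (hM : 0 < M)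
    (h : IsTip R M k O c) : tipFun R M k O c c ≤ tipMin R M k := by
  have h1 := h.inside c (by simpa using (tipRadius_pos hR k).le)
  have h2 := mul_pos (tipSlope_pos hM k) (tipRadius_pos hR k)
  simp only [sub_self, abs_zero, zero_sub] at h1
  refine max_le (by linarith) (by simp)

theorem tipMin_le_tipFun {k : ℕ} {O : ℝ → ℝ} {c : ℝ} (hM : 0 < M) (y : ℝ) :
    tipMin R M k ≤ tipFun R M k O c y :=
  le_trans (le_add_of_nonneg_right (mul_nonneg (tipSlope_pos hM k).le (abs_nonneg _)))
    (le_max_right _ _)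

theorem IsTip.hasBoundedSubgradients {k : ℕ} {O : ℝ → ℝ} {c : ℝ} (hM : 0 < M)
    (h : IsTip R M k O c) : HasBoundedSubgradients M (tipFun R M k O c) :=
  h.subgrad.max (hasBoundedSubgradients_abs (tipSlope_pos hM k).le (by
    have := tipSlope_le hM k
    have := tipSlope_pos hM k
    linarith) _ _)

theorem IsTip.exists_succ {k : ℕ} {O : ℝ → ℝ} {c : ℝ} (hR : 0 < R) (hM : 0 < M)
    (h : IsTip R M k O c) (x : ℝ) : ∃ O' c', IsTip R M (k + 1) O' c' ∧ (∀ y, O y ≤ O' y) ∧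
      (∀ y, tipFun R M (k + 1) O' c' y ≤ tipFun R M k O c y) ∧
      (∀ y, y = x ∨ tipRadius R k ≤ |y - c| →
        tipFun R M (k + 1) O' c' y = tipFun R M k O c y ∧ tipRadius R (k + 1) ≤ |y - c'|) := by
  unfold IsTip tipFun
  rw [tipRadius_succ, tipSlope_succ]
  exact IsVShape.exists_deeper h (tipRadius_pos hR k) (tipSlope_pos hM k) (tipSlope_le hM k) x

end VShape

/-! ### The adversary for function values when `n = 0` -/

section ValueAdversary

variable {d : ℕ} {R M ρ ε : ℝ}

/-- The box `‖z‖ ≤ R`. -/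
def ballBox (d : ℕ) (R : ℝ) : Set (MISpace 0 d) := Metric.closedBall 0 R

theorem mem_ballBox {z : MISpace 0 d} : z ∈ ballBox d R ↔ ‖z.2‖ ≤ R := by
  rw [ballBox, mem_closedBall_zero_iff, Prod.norm_def, Subsingleton.elim z.1 0, norm_zero,
    max_eq_right (norm_nonneg _)]

theorem miDot_single (i : Fin d) (σ : ℝ) (z : MISpace 0 d) :
    miDot (0, Pi.single i σ) z = σ * z.2 i := by
  simp [miDot]

/-- The state of the adversary for the first-order oracle: a shape in every coordinate, its level, and
the recorded answers. -/
structure IsValueState (R M : ℝ) (O : Fin d → ℝ → ℝ) (c : Fin d → ℝ) (k : Fin d → ℕ)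
    (rec : MISpace 0 d → Option (ℝ × MISpace 0 d)) : Prop where
  tip : ∀ i, IsTip R M (k i) (O i) (c i)
  correct : ∀ z val g, rec z = some (val, g) → ∃ i σ, tipRadius R (k i) ≤ |z.2 i - c i| ∧
    val = O i (z.2 i) ∧ g = (0, Pi.single i σ) ∧ (∀ w, O i (z.2 i) + σ * (w - z.2 i) ≤ O i w) ∧
    ∀ j, tipFun R M (k j) (O j) (c j) (z.2 j) ≤ val

variable {O : Fin d → ℝ → ℝ} {c : Fin d → ℝ} {k : Fin d → ℕ}
  {rec : MISpace 0 d → Option (ℝ × MISpace 0 d)}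

/-- The tips of the coordinates in `T` are made deeper without changing the values at `z`. -/
theorem IsValueState.exists_deeper (hR : 0 < R) (hM : 0 < M) (h : IsValueState R M O c k rec)
    (z : MISpace 0 d) (T : Finset (Fin d)) : ∃ O' c',
      IsValueState R M O' c' (fun i => if i ∈ T then k i + 1 else k i) rec ∧
      (∀ i, tipFun R M (if i ∈ T then k i + 1 else k i) (O' i) (c' i) (z.2 i) =
        tipFun R M (k i) (O i) (c i) (z.2 i)) ∧
      ∀ i ∈ T, tipRadius R (k i + 1) ≤ |z.2 i - c' i| := by
  have hex : ∀ i, ∃ O' c', IsTip R M (if i ∈ T then k i + 1 else k i) O' c' ∧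
      (∀ y, O i y ≤ O' y) ∧ (∀ y, tipFun R M (if i ∈ T then k i + 1 else k i) O' c' y ≤
        tipFun R M (k i) (O i) (c i) y) ∧
      (∀ y, tipRadius R (k i) ≤ |y - c i| →
        tipRadius R (if i ∈ T then k i + 1 else k i) ≤ |y - c'|) ∧
      tipFun R M (if i ∈ T then k i + 1 else k i) O' c' (z.2 i) =
        tipFun R M (k i) (O i) (c i) (z.2 i) ∧
      (i ∈ T → tipRadius R (k i + 1) ≤ |z.2 i - c'|) := by
    intro i
    by_cases hi : i ∈ T
    · obtain ⟨O', c', h1, h2, h3, h4⟩ := (h.tip i).exists_succ hR hM (z.2 i)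
      simp only [hi, if_true]
      exact ⟨O', c', h1, h2, h3, fun y hy => (h4 y (Or.inr hy)).2, (h4 _ (Or.inl rfl)).1,
        fun _ => (h4 _ (Or.inl rfl)).2⟩
    · simp only [hi, if_false]
      exact ⟨O i, c i, h.tip i, fun _ => le_rfl, fun _ => le_rfl, fun _ h => h, rfl, by simp⟩
  choose O' c' h1 h2 h3 h4 h5 h6 using hex
  refine ⟨O', c', ⟨h1, fun w val g hw => ?_⟩, h5, h6⟩
  obtain ⟨i, σ, e1, e2, e3, e4, e5⟩ := h.correct w val g hw
  -- A recorded query lies outside the tip, where `tipFun` equals `O`. Since `O` only grows and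
  -- `tipFun` only decreases, the recorded value is frozen.
  have hval : O' i (w.2 i) = O i (w.2 i) := by
    refine le_antisymm ?_ (h2 i _)
    have : tipFun R M (k i) (O i) (c i) (w.2 i) = O i (w.2 i) :=
      IsVShape.vShape_eq (h.tip i) (tipSlope_pos hM _).le e1
    exact (le_max_left _ _).trans ((h3 i (w.2 i)).trans this.le)
  exact ⟨i, σ, h4 i _ e1, by rw [hval, e2], e3, fun y => by rw [hval]; exact (e4 y).trans (h2 i y),
    fun j => (h3 j _).trans (e5 j)⟩

variable [NeZero d]

/-- The function that is the maximum of the shapes of the coordinates. -/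
noncomputable def maxTip (R M : ℝ) (O : Fin d → ℝ → ℝ) (c : Fin d → ℝ) (k : Fin d → ℕ)
    (z : MISpace 0 d) : ℝ :=
  Finset.univ.sup' Finset.univ_nonempty fun i => tipFun R M (k i) (O i) (c i) (z.2 i)

theorem tipFun_le_maxTip (z : MISpace 0 d) (i : Fin d) :
    tipFun R M (k i) (O i) (c i) (z.2 i) ≤ maxTip R M O c k z :=
  Finset.le_sup' (fun i => tipFun R M (k i) (O i) (c i) (z.2 i)) (Finset.mem_univ i)

theorem maxTip_le {z : MISpace 0 d} {B : ℝ}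
    (h : ∀ i, tipFun R M (k i) (O i) (c i) (z.2 i) ≤ B) : maxTip R M O c k z ≤ B :=
  Finset.sup'_le _ _ fun i _ => h i

theorem exists_maxTip_eq (R M : ℝ) (O : Fin d → ℝ → ℝ) (c : Fin d → ℝ) (k : Fin d → ℕ)
    (z : MISpace 0 d) : ∃ i, maxTip R M O c k z = tipFun R M (k i) (O i) (c i) (z.2 i) := by
  obtain ⟨i, -, hi⟩ := Finset.exists_mem_eq_sup' Finset.univ_nonempty
    fun i => tipFun R M (k i) (O i) (c i) (z.2 i)
  exact ⟨i, hi⟩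

theorem IsValueState.exists_subgradient (hM : 0 < M) (h : IsValueState R M O c k rec)
    (z : MISpace 0 d) : ∃ i σ, |σ| ≤ M ∧
      ∀ w, maxTip R M O c k z + miDot (0, Pi.single i σ) (w - z) ≤ maxTip R M O c k w := by
  obtain ⟨i, hi⟩ := exists_maxTip_eq R M O c k z
  obtain ⟨σ, hσ, hsub⟩ := (h.tip i).hasBoundedSubgradients hM (z.2 i)
  refine ⟨i, σ, hσ, fun w => ?_⟩
  rw [hi, miDot_single]
  exact (hsub (w.2 i)).trans (tipFun_le_maxTip w i)

theorem convexOn_of_subgradients {n d : ℕ} {f : MISpace n d → ℝ}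
    (h : ∀ z, ∃ g, ∀ w, f z + miDot g (w - z) ≤ f w) : ConvexOn ℝ Set.univ f := by
  refine ⟨convex_univ, fun x _ y _ a b ha hb hab => ?_⟩
  obtain ⟨g, hg⟩ := h (a • x + b • y)
  have hx := mul_le_mul_of_nonneg_left (hg x) ha
  have hy := mul_le_mul_of_nonneg_left (hg y) hb
  rw [miDot_sub, miDot_add, miDot_smul, miDot_smul] at hx hy
  simp only [smul_eq_mul]
  have hb' : b = 1 - a := by linarith
  subst hb'
  nlinarith

/-- The instances that agree with the answers given so far. -/
def valueCompatible (R M ρ : ℝ) (sep : MISpace 0 d → Option (MISpace 0 d × ℝ))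
    (rec : MISpace 0 d → Option (ℝ × MISpace 0 d)) : Set (MIInstance 0 d R M ρ) :=
  {I | I.C = ballBox d R ∧ I.sep = sep ∧
    ∀ z val g, rec z = some (val, g) → I.f z = val ∧ I.subgrad z = g}

/-- The maximum has subgradients supported on a single coordinate and bounded by `M`, which yields
convexity and the Lipschitz bound. At a recorded point it equals the recorded `O i`, so the recorded
subgradient remains valid. -/
theorem IsValueState.exists_instance (hR : 0 < R) (hM : 0 < M) (hρR : ρ ≤ R)
    {sep : MISpace 0 d → Option (MISpace 0 d × ℝ)} (hsep : IsSeparationOracle (ballBox d R) sep)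
    (h : IsValueState R M O c k rec) :
    ∃ I ∈ valueCompatible R M ρ sep rec, I.f = maxTip R M O c k := by
  set f := maxTip R M O c k with hf
  choose i σ hσ hsub using h.exists_subgradient hM
  have hmem : IsMIConvex 0 d R M ρ f (ballBox d R) :=
    { convex_f := convexOn_of_subgradients fun z => ⟨_, hsub z⟩
      closed_C := Metric.isClosed_closedBall
      convex_C := convex_closedBall 0 R
      feasible := ⟨0, mem_ballBox.2 (by simpa using hR.le), fun i => i.elim0⟩
      bounded := fun z hz => by simpa [ballBox] using hz
      lipschitz := fun x _ _ y y' _ _ => by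
        have key : ∀ y y' : Fin d → ℝ, f (x, y) - f (x, y') ≤ M * ‖y - y'‖ := by
          intro y y'
          have h1 := hsub (x, y) (x, y')
          rw [miDot_single] at h1
          have h2 := (abs_le.1 (norm_le_pi_norm (y - y') (i (x, y)))).2
          have h3 : σ (x, y) * (y - y') (i (x, y)) ≤ M * ‖y - y'‖ := by
            refine (le_abs_self _).trans ?_
            rw [abs_mul]
            exact mul_le_mul (hσ _) (norm_le_pi_norm (y - y') _) (abs_nonneg _) hM.le
          simp only [Prod.mk_sub_mk, Pi.sub_apply] at h1 h3
          linarith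
        rw [abs_le]
        have h1 := key y y'
        have h2 := key y' y
        rw [norm_sub_rev] at h2
        constructor <;> linarith
      strictly_feasible := fun z _ => ⟨0, fun y hy => mem_ballBox.2 (by
        simp only [sub_zero] at hy
        exact hy.trans hρR)⟩ }
  have hcorrect : ∀ z val g, rec z = some (val, g) → f z = val ∧
      ∀ w, f z + miDot g (w - z) ≤ f w := by
    intro z val g hz
    obtain ⟨i, σ, h1, rfl, rfl, h4, h5⟩ := h.correct z val g hz
    have hfz : f z = O i (z.2 i) := le_antisymm (maxTip_le h5)
      ((le_max_left _ _).trans (tipFun_le_maxTip z i))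
    refine ⟨hfz, fun w => ?_⟩
    rw [hfz, miDot_single]
    exact (h4 (w.2 i)).trans ((le_max_left _ _).trans (tipFun_le_maxTip w i))
  refine ⟨⟨f, ballBox d R, hmem, sep, hsep,
    fun z => ((rec z).map Prod.snd).getD (0, Pi.single (i z) (σ z)), fun z w => ?_⟩,
    ⟨rfl, rfl, fun z val g hz => ⟨(hcorrect z val g hz).1, by simp [hz]⟩⟩, rfl⟩
  rcases hz : rec z with _ | ⟨val, g⟩
  · simpa only [hz, Option.map_none, Option.getD_none] using hsub z w
  · simpa only [hz, Option.map_some, Option.getD_some] using (hcorrect z val g hz).2 w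

/-- While some level is low, no point is a solution of all compatible instances. -/
theorem IsValueState.exists_unsolved (hR : 0 < R) (hM : 0 < M) (hρR : ρ ≤ R)
    {sep : MISpace 0 d → Option (MISpace 0 d × ℝ)} (hsep : IsSeparationOracle (ballBox d R) sep)
    (h : IsValueState R M O c k rec) {N : ℕ} (hN : ε < tipSlope M N * tipRadius R N / 9)
    (hk : ∃ i, k i ≤ N) (z : MISpace 0 d) :
    ∃ I ∈ valueCompatible R M ρ sep rec, z ∉ approxSolutions I.f I.C ε := by
  -- All tips are deepened away from the candidate `z`. The value there still exceeds the tip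
  -- minimum of the lowest level `k j`, or equals it, while at the new centres it is at most the
  -- minimum of level `k j + 1`; the gap is more than `ε`.
  obtain ⟨O', c', h', heq, -⟩ := h.exists_deeper hR hM z Finset.univ
  simp only [Finset.mem_univ, if_true] at h' heq
  obtain ⟨I, hI, hIf⟩ := h'.exists_instance hR hM hρR hsep
  refine ⟨I, hI, fun hz => ?_⟩
  obtain ⟨j, -, hj⟩ := Finset.exists_min_image Finset.univ k Finset.univ_nonempty
  have hjN : k j ≤ N := by
    obtain ⟨i, hi⟩ := hk
    exact (hj i (Finset.mem_univ i)).trans hi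
  have hlow : tipMin R M (k j) ≤ I.f z := by
    rw [hIf]
    refine le_trans ?_ (tipFun_le_maxTip z j)
    rw [heq]
    exact tipMin_le_tipFun hM _
  have hup : I.f ((0, c') : MISpace 0 d) ≤ tipMin R M (k j + 1) := by
    rw [hIf]
    refine maxTip_le fun i => (tipFun_center_le hR hM (h'.tip i)).trans ?_
    exact tipMin_antitone hR hM (Nat.succ_le_succ (hj i (Finset.mem_univ i)))
  have hc' : ((0, c') : MISpace 0 d) ∈ I.C ∩ miLattice 0 d := by
    refine ⟨?_, fun i => i.elim0⟩
    rw [hI.1, mem_ballBox]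
    refine (pi_norm_le_iff_of_nonneg hR.le).2 fun i => ?_
    have h1 := (h'.tip i).range
    have h2 := tipRadius_pos hR (k i + 1)
    rw [Real.norm_eq_abs]
    linarith
  have h1 := hz.2 _ hc'
  have h2 : tipSlope M N * tipRadius R N ≤ tipSlope M (k j) * tipRadius R (k j) := by
    unfold tipSlope tipRadius
    have : (3 : ℝ) ^ k j ≤ 3 ^ N := pow_le_pow_right₀ (by norm_num) hjN
    gcongr
  rw [tipMin] at hup
  linarith

/-- Lower bound from minimizing a Lipschitz convex function on the box. -/
theorem le_miInfoComp_value (hR : 0 < R) (hM : 0 < M) (hρR : ρ ≤ R) {N : ℕ}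
    (hN : ε < tipSlope M N * tipRadius R N / 9) :
    ((d * (N + 1) : ℕ) : ℕ∞) ≤ miInfoComp ε 0 d R M ρ := by
  classical
  obtain ⟨sep, hsep⟩ := exists_separationOracle (C := ballBox d R) (convex_closedBall 0 R)
    Metric.isClosed_closedBall
  refine le_infoComp_of_adversary (fun m 𝒞 => ∃ O c k rec, IsValueState R M O c k rec ∧
    m ≤ ∑ i, (N + 1 - k i) ∧ 𝒞 = valueCompatible R M ρ sep rec) ?_ ?_ ?_
    (𝒞 := valueCompatible R M ρ sep fun _ => none)
    ⟨fun _ y => -(2 * tipSlope M 0 * tipRadius R 0) + 3 * tipSlope M 0 * |y - 0|, fun _ => 0,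
      fun _ => 0, fun _ => none, ⟨fun i => isTip_zero hM, by simp⟩, by simp, rfl⟩
  · rintro m _ ⟨O, c, k, rec, h, -, rfl⟩
    obtain ⟨I, hI, -⟩ := h.exists_instance hR hM hρR hsep
    exact ⟨I, hI⟩
  · rintro m _ ⟨O, c, k, rec, h, hk, rfl⟩ z
    refine h.exists_unsolved hR hM hρR hsep hN ?_ z
    by_contra! hlt
    rw [Finset.sum_eq_zero fun i _ => Nat.sub_eq_zero_of_le (hlt i)] at hk
    omega
  · rintro m _ ⟨O, c, k, rec, h, hk, rfl⟩ (z | z)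
    · exact ⟨.separation (sep z), _, subset_rfl, ⟨O, c, k, rec, h, by omega, rfl⟩, fun I hI => by
        simp [miAnswer, hI.2.1]⟩
    rcases hz : rec z with _ | ⟨val, g⟩
    swap
    · exact ⟨.firstOrder val g, _, subset_rfl, ⟨O, c, k, rec, h, by omega, rfl⟩, fun I hI => by
        simp [miAnswer, hI.2.2 z val g hz]⟩
    obtain ⟨i, hi⟩ := exists_maxTip_eq R M O c k z
    -- Only the coordinate attaining the maximum is deepened, so a query raises one level by one.
    -- The answer is read off `O' i`, which agrees with the old value at `z`.
    obtain ⟨O', c', h', heq, hrad⟩ := h.exists_deeper hR hM z {i}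
    obtain ⟨σ, -, hσ⟩ := (h'.tip i).subgrad (z.2 i)
    have hradi := hrad i (Finset.mem_singleton_self i)
    have hval : tipFun R M (k i) (O i) (c i) (z.2 i) = O' i (z.2 i) := by
      rw [← heq]
      refine IsVShape.vShape_eq (h'.tip i) (tipSlope_pos hM _).le ?_
      simpa using hradi
    refine ⟨.firstOrder (O' i (z.2 i)) (0, Pi.single i σ),
      valueCompatible R M ρ sep (Function.update rec z (some (O' i (z.2 i), (0, Pi.single i σ)))),
      ?_, ⟨O', c', _, _, ⟨h'.tip, fun w val g hw => ?_⟩, ?_, rfl⟩, fun I hI => ?_⟩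
    · rintro I ⟨h1, h2, h3⟩
      refine ⟨h1, h2, fun w val g hw => h3 w val g ?_⟩
      rwa [Function.update_of_ne (fun hwz => by rw [hwz, hz] at hw; simp at hw)]
    · by_cases hwz : w = z
      · subst hwz
        simp only [Function.update_self, Option.some.injEq, Prod.mk.injEq] at hw
        obtain ⟨rfl, rfl⟩ := hw
        refine ⟨i, σ, by simpa using hradi, rfl, rfl, hσ, fun j => ?_⟩
        rw [heq j, ← hval, ← hi]
        exact tipFun_le_maxTip w j
      · rw [Function.update_of_ne hwz] at hw
        exact h'.correct w val g hw
    · have hsum : ∑ j, (N + 1 - k j) ≤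
          ∑ j, ((N + 1 - if j ∈ ({i} : Finset (Fin d)) then k j + 1 else k j) +
            if j = i then 1 else 0) := Finset.sum_le_sum fun j _ => by
        simp only [Finset.mem_singleton]
        split_ifs <;> omega
      rw [Finset.sum_add_distrib, Finset.sum_ite_eq' Finset.univ i fun _ => 1,
        if_pos (Finset.mem_univ i)] at hsum
      omega
    · have := hI.2.2 z (O' i (z.2 i)) (0, Pi.single i σ) (Function.update_self ..)
      simp [miAnswer, this]

end ValueAdversary

/-! ### The lower bound for `n = 0` and the main theorem -/

theorem ofReal_le_miInfoComp_convex {d : ℕ} {R M ρ ε : ℝ} (hd : 1 ≤ d) (hR : 1 ≤ R) (hM : 0 ≤ M)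
    (hρ : 0 < ρ) (hρ1 : ρ ≤ 1) (hε : 0 < ε) (hK : 27 ^ 4 ≤ M * R / (ρ * ε)) :
    ENNReal.ofReal (1 / 12 * (d * Real.log (M * R / (ρ * ε)))) ≤
      (miInfoComp ε 0 d R M ρ : ℝ≥0∞) := by
  have hM0 : 0 < M := by
    refine hM.lt_of_ne ?_
    rintro rfl
    norm_num at hK
  have : NeZero d := ⟨by omega⟩
  set X := M * R / (ρ * ε) with hX
  have hX0 : 0 < X := by positivity
  -- One of the two logarithms is at least half of `log X`: if the first, the feasibility bound is
  -- used, otherwise the value bound.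
  have hlogX : Real.log X ≤ Real.log (R / ρ) + Real.log (M * R / ε) := by
    rw [← Real.log_mul (by positivity) (by positivity)]
    refine Real.log_le_log hX0 ?_
    have : R / ρ * (M * R / ε) = X * R := by rw [hX]; field_simp
    rw [this]
    exact le_mul_of_one_le_right hX0.le hR
  have hlog27 : 0 < Real.log 27 := Real.log_pos (by norm_num)
  have hlogK : 4 * Real.log 27 ≤ Real.log X := by
    have := Real.log_le_log (by norm_num) hK
    rwa [Real.log_pow] at this
  rcases le_total (Real.log X / 2) (Real.log (R / ρ)) with h | h
  · have h3 : 3 ≤ R / ρ := by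
      have h1 : Real.log 27 ≤ Real.log (R / ρ) := by linarith
      have := (Real.log_le_log_iff (by norm_num) (by positivity)).1 h1
      linarith
    refine le_trans (ENNReal.ofReal_le_ofReal ?_)
      (ofReal_le_miInfoComp_feasibility (n := 0) (d := d) hR hM hρ h3)
    rw [pow_zero, mul_one]
    have hd0 : (0 : ℝ) ≤ d := Nat.cast_nonneg d
    nlinarith [mul_le_mul_of_nonneg_left h hd0]
  · set Y := M * R / ε with hY
    have hY0 : 0 < Y := by positivity
    have hlogY : Real.log X / 2 ≤ Real.log Y := by linarith
    have hY27 : 2 * Real.log 27 ≤ Real.log Y := by linarith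
    -- the number of levels
    have hlog9 : 0 < Real.log 9 := Real.log_pos (by norm_num)
    have hlog9' : Real.log 9 ≤ 3 := by
      have h1 : Real.log 9 = 2 * Real.log 3 := by
        rw [show (9 : ℝ) = 3 ^ 2 by norm_num, Real.log_pow]; norm_num
      have h2 : Real.log 3 = Real.log 2 + Real.log (3 / 2) := by
        rw [← Real.log_mul (by norm_num) (by norm_num)]; norm_num
      have h3 := Real.log_le_sub_one_of_pos (x := 3 / 2) (by norm_num)
      have := Real.log_two_lt_d9
      linarith
    -- The gap at level `N` is `MR / (27 * 9 ^ N)`, which exceeds `ε` exactly when `N < t`. Hence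
    -- the last usable level is `⌈t⌉ - 1`.
    set t := (Real.log Y - Real.log 27) / Real.log 9 with ht
    have ht0 : 0 < t := div_pos (by linarith) hlog9
    obtain ⟨N, hN⟩ : ∃ N, ⌈t⌉₊ = N + 1 := Nat.exists_eq_succ_of_ne_zero (Nat.ceil_pos.2 ht0).ne'
    have hNt : (N : ℝ) < t := by
      have := Nat.ceil_lt_add_one ht0.le
      rw [hN] at this
      push_cast at this
      linarith
    have htN : t ≤ N + 1 := by
      have := Nat.le_ceil t
      rw [hN] at this
      exact_mod_cast this
    have hcond : ε < tipSlope M N * tipRadius R N / 9 := by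
      have e1 : tipSlope M N * tipRadius R N / 9 = M * R / (27 * 9 ^ N) := by
        rw [tipSlope, tipRadius, show (9 : ℝ) ^ N = 3 ^ N * 3 ^ N by rw [← mul_pow]; norm_num]
        field_simp
        norm_num
      rw [e1, lt_div_iff₀ (by positivity), ← lt_div_iff₀' hε, ← hY,
        ← Real.log_lt_log_iff (by positivity) hY0, Real.log_mul (by norm_num) (by positivity),
        Real.log_pow]
      rw [ht, lt_div_iff₀ hlog9] at hNt
      linarith
    refine ofReal_le_of_natCast_le (le_miInfoComp_value (by linarith) hM0 (by linarith) hcond) ?_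
    push_cast
    -- `log Y - log 27` is at least `log Y / 2`, hence `log X / 4`; division by `log 9 ≤ 3` gives
    -- the `12`.
    have h1 : Real.log X / 12 ≤ N + 1 := by
      have : Real.log X / 4 ≤ t * Real.log 9 := by
        rw [ht, div_mul_cancel₀ _ hlog9.ne']; linarith
      nlinarith
    have hd0 : (0 : ℝ) ≤ d := Nat.cast_nonneg d
    nlinarith [mul_le_mul_of_nonneg_left h1 hd0]

theorem mainTheorem1 :
    -- lower bound, `n, d ≥ 1`
    (∃ c > (0 : ℝ), ∃ K : ℝ, ∀ (n d : ℕ) (R M ρ ε : ℝ), 1 ≤ n → 1 ≤ d →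
      1 ≤ R → 0 ≤ M → 0 < ρ → ρ ≤ 1 → 0 ≤ ε → K ≤ R / ρ →
        ENNReal.ofReal (c * (d * 2 ^ n * Real.log (R / ρ))) ≤
          (miInfoComp ε n d R M ρ : ℝ≥0∞)) ∧
    -- lower bound, `d = 0`
    (∃ c > (0 : ℝ), ∀ (n : ℕ) (R M ρ ε : ℝ), 1 ≤ n →
      1 ≤ R → 0 ≤ M → 0 < ρ → ρ ≤ 1 → 0 ≤ ε →
        ENNReal.ofReal (c * (2 ^ n * Real.log R)) ≤ (miInfoComp ε n 0 R M ρ : ℝ≥0∞)) ∧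
    -- lower bound, `n = 0`
    (∃ c > (0 : ℝ), ∃ K : ℝ, ∀ (d : ℕ) (R M ρ ε : ℝ), 1 ≤ d →
      1 ≤ R → 0 ≤ M → 0 < ρ → ρ ≤ 1 → 0 < ε → K ≤ M * R / (ρ * ε) →
        ENNReal.ofReal (c * (d * Real.log (M * R / (ρ * ε)))) ≤
          (miInfoComp ε 0 d R M ρ : ℝ≥0∞)) ∧
    -- upper bound, `n, d ≥ 1`
    (∃ c > (0 : ℝ), ∀ (n d : ℕ) (R M ρ ε : ℝ), 1 ≤ n → 1 ≤ d →
      0 < R → 0 < ρ → ρ ≤ 1 → 0 < ε → ε ≤ M → 2 ≤ M * R / (ρ * ε) →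
        (miInfoComp ε n d R M ρ : ℝ≥0∞) ≤
          ENNReal.ofReal (c * ((n + d) * d * 2 ^ n * Real.log (M * R / (ρ * ε))))) ∧
    -- upper bound, `d = 0`
    (∃ c > (0 : ℝ), ∀ (n : ℕ) (R M ρ ε : ℝ), 1 ≤ n →
      2 ≤ R → 0 ≤ M → 0 < ρ → ρ ≤ 1 → 0 ≤ ε →
        (miInfoComp ε n 0 R M ρ : ℝ≥0∞) ≤ ENNReal.ofReal (c * (n * 2 ^ n * Real.log R))) ∧
    -- upper bound, `n = 0`
    (∃ c > (0 : ℝ), ∀ (d : ℕ) (R M ρ ε : ℝ), 1 ≤ d →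
      0 < R → 0 < ρ → ρ ≤ 1 → 0 < ε → ε ≤ M → 2 ≤ M * R / (ρ * ε) →
        (miInfoComp ε 0 d R M ρ : ℝ≥0∞) ≤
          ENNReal.ofReal (c * (d * Real.log (M * R / (ρ * ε))))) := by
  refine ⟨⟨1 / 4, by norm_num, 3, ?_⟩, ⟨1 / 4, by norm_num, ?_⟩, ⟨1 / 12, by norm_num, 27 ^ 4, ?_⟩,
    ⟨20, by norm_num, ?_⟩, ⟨20, by norm_num, ?_⟩, ⟨1000, by norm_num, ?_⟩⟩
  · intro n d R M ρ ε _ _ hR hM hρ _ _ hK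
    exact ofReal_le_miInfoComp_feasibility hR hM hρ hK
  · intro n R M ρ ε hn hR hM _ _ _
    exact ofReal_le_miInfoComp_int hn hR hM
  · intro d R M ρ ε hd hR hM hρ hρ1 hε hK
    exact ofReal_le_miInfoComp_convex hd hR hM hρ hρ1 hε hK
  · intro n d R M ρ ε _ hd hR hρ hρ1 hε hεM hX
    exact miInfoComp_le_of_pos hd hR hρ hρ1 hε hεM hX
  · intro n R M ρ ε hn hR _ _ _ hε
    exact miInfoComp_int_le hn hR hε
  · intro d R M ρ ε hd hR hρ hρ1 hε hεM hX
    exact miInfoComp_convex_le hd hR hρ hρ1 hε hεM hX
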